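/- Let $k$ be a finite field with $q$ elements, $\bar k$ an algebraic closure, $F=k((t))$, $L=\bar k((t))$, $\mathfrak o=\bar k[[t]]$, $\mathfrak p=t\mathfrak o$, and $\sigma(\sum a_nt^n)=\sum a_n^qt^n$. Let $I\subset GL_2(L)$ be the Iwahori subgroup $\begin{pmatrix}\mathfrak o^\times&\mathfrak o\\ \mathfrak p&\mathfrak o^\times\end{pmatrix}$, $I^{SL_2}=I\cap SL_2(L)$, let $T$ be the diagonal torus of $SL_2$, $N$ its normalizer, and $W_a=N(L)/T(\mathfrak o)$ the affine Weyl group, a Coxeter group generated by the classes of $\begin{pmatrix}0&1\\-1&0\end{pmatrix}$ and $\begin{pmatrix}0&t^{-1}\\-t&0\end{pmatrix}$, with length function $\ell$. Put $b_1=\begin{pmatrix}0&1\\t&0\end{pmatrix}$. For $w\in W_a$ and $b\in GL_2(L)$ with $v=v_L(\det b)$ let $$X^{SL_2}_w(b)(\bar k)=\{xI^{SL_2}\in SL_2(L)/I^{SL_2}: x^{-1}b\,\sigma(x)\in I\,w\,b_1^{v}\,I\}.$$ The building $\mathfrak B_\infty$ of $SL_2(L)$ has as vertices the homothety classes of $\mathfrak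 o$-lattices in $L^2$, and two vertices are joined by an edge (alcove) iff they have representatives with $t\mathfrak L_1\subsetneq\mathfrak L_0\subsetneq\mathfrak L_1$. The building $\mathfrak B_1$ of $SL_2(F)$ is defined in the same way and is viewed as a subcomplex of $\mathfrak B_\infty$ by $\mathfrak L\mapsto\mathfrak L\otimes_{k[[t]]}\mathfrak o$. The type of the vertex $[\mathfrak L]$ is the residue in $\{0,1\}$ of $n$ mod $2$, where $\wedge^2\mathfrak L=t^n\mathfrak o$. Let $C^i$ be the alcove with vertices $[\mathfrak o\oplus t^i\mathfrak o]$, $[\mathfrak o\oplus t^{i+1}\mathfrak o]$ $(i\in\mathbb Z)$, let $A$ be the standard apartment (the full subcomplex whose alcoves form the $N(L)$-orbit of $C^0$), $\overline{C^0}$ the subcomplex consisting of $C^0$ and its vertices, and $P_m=[\mathfrak o\oplus t^m\mathfrak o]$ for $m=0,1$. The map $xI^{SL_2}\mapsto xC^0$ is a bijection from $SL_2(L)/I^{SL_2}$ onto the set of alcoves of $\mathfrak B_\infty$, by which the sets $X^{SL_2}_w(b)(\bar k)$ are regarded as sets of alcoves. A gallery of length $n$ is a sequence $(D_0,\dots,D_n)$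 of alcoves such that $D_j$ and $D_{j+1}$ have a common vertex. For $\mathfrak C\in\{\mathfrak B_1,A,\overline{C^0}\}$, a vertex $P$ of $\mathfrak C$ and $n>0$, let $D^n_{\mathfrak C}(P)$ be the set of alcoves $D$ of $\mathfrak B_\infty$ not in $\mathfrak C$ such that a shortest gallery with first alcove $D$ containing a vertex of $\mathfrak C$ contains $P$ and has length $n-1$. Let $\mathfrak C^{(m)}$ be the set of vertices of $\mathfrak C$ of type $m$. For $w\in W_a$, $i>0$ and $j>0$ with $wC^0\in\{C^j,C^{-j}\}$ put $m(w,i,j)=0$ if $i$ is odd and $wC^0=C^{-j}$, or $i$ is even and $wC^0=C^j$; and $m(w,i,j)=1$ if $i$ is odd and $wC^0=C^j$, or $i$ is even and $wC^0=C^{-j}$. **(A)** $X^{SL_2}_w(1)(\bar k)\neq\emptyset$ if and only if $w=1$ or $\ell(w)$ is odd. The set $X^{SL_2}_1(1)(\bar k)$ is the set of all alcoves of $\mathfrak B_1$. If $\ell(w)=2i-1$ with $i>0$, then $wC^0=C^{\pm(2i-1)}$ and, with $m=m(w,i,2i-1)$, $$X^{SL_2}_w(1)(\bar k)=\coprod_{P\in\mathfrak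 B_1^{(m)}}D^i_{\mathfrak B_1}(P).$$ **(B)** Let $b=\begin{pmatrix}1&0\\0&t^\alpha\end{pmatrix}$ with $\alpha>0$. Then $X^{SL_2}_w(b)(\bar k)\ne\emptyset$ if and only if $\ell(w)=\alpha$ or $\ell(w)=\alpha+2i-1$ for some $i>0$. The alcoves $C^j$ $(j\in\mathbb Z)$ are pairwise distinct. If $\ell(w)=\alpha$, then $wC^0=C^{\pm\alpha}$. If $wC^0=C^\alpha$, then $X^{SL_2}_w(b)(\bar k)=\coprod_{j\in\mathbb Z}\{C^{2j}\}$; if $wC^0=C^{-\alpha}$, then $X^{SL_2}_w(b)(\bar k)=\coprod_{j\in\mathbb Z}\{C^{2j+1}\}$. If $\ell(w)=\alpha+2i-1$ with $i>0$, then $wC^0=C^{\pm(\alpha+2i-1)}$ and, with $m=m(w,i,\alpha+2i-1)$, $$X^{SL_2}_w(b)(\bar k)=\coprod_{P\in A^{(m)}}D^i_{A}(P).$$ **(C)** $X^{SL_2}_w(b_1)(\bar k)\neq\emptyset$ if and only if $\ell(w)$ is even. One has $X^{SL_2}_1(b_1)(\bar k)=\{C^0\}$. If $\ell(w)=2i$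 with $i>0$, then $wC^0=C^{\pm2i}$ and, with $m=m(w,i,2i)$, $$X^{SL_2}_w(b_1)(\bar k)=D^i_{\overline{C^0}}(P_m).$$ -/

import Mathlib

namespace ADLV

open Matrix

section Lattices

/-- The ring of formal power series `κ[[t]]`. -/
abbrev PS (κ : Type*) [Field κ] : Type _ := PowerSeries κ

/-- The field of formal Laurent series `κ((t))`. -/
abbrev LS (κ : Type*) [Field κ] : Type _ := LaurentSeries κ

variable (κ : Type*) [Field κ]

/-- The uniformizer `t` of `κ((t))`. -/
noncomputable def unif : LS κ := algebraMap (PS κ) (LS κ) PowerSeries.X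

variable {κ}

theorem unif_ne_zero : unif κ ≠ 0 := by
  intro h
  have h' : algebraMap (PS κ) (LS κ) PowerSeries.X = algebraMap (PS κ) (LS κ) 0 := by
    rw [map_zero]; exact h
  exact PowerSeries.X_ne_zero (IsFractionRing.injective (PS κ) (LS κ) h')

/-- The homothety `x ↦ c x` of `κ((t))²`, as a `κ[[t]]`-linear map. -/
noncomputable def homothety (c : LS κ) : (Fin 2 → LS κ) →ₗ[PS κ] (Fin 2 → LS κ) :=
  (LinearMap.lsmul (LS κ) (Fin 2 → LS κ) c).restrictScalars (PS κ)

/-- The linear map of `κ((t))²` given by a matrix, as a `κ[[t]]`-linear map. -/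
noncomputable def linAct (g : Matrix (Fin 2) (Fin 2) (LS κ)) :
    (Fin 2 → LS κ) →ₗ[PS κ] (Fin 2 → LS κ) :=
  (Matrix.mulVecLin g).restrictScalars (PS κ)

@[simp] theorem homothety_apply (c : LS κ) (x : Fin 2 → LS κ) : homothety c x = c • x := rfl

@[simp] theorem linAct_apply (g : Matrix (Fin 2) (Fin 2) (LS κ)) (x : Fin 2 → LS κ) :
    linAct g x = g *ᵥ x := rfl

variable (κ)

/-- The `κ[[t]]`-lattices in `κ((t))²`: the finitely generated submodules which span `κ((t))²`. -/
def Lat : Type _ :=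
  {M : Submodule (PS κ) (Fin 2 → LS κ) // Submodule.IsLattice (LS κ) M}

variable {κ}

/-- Two lattices are equivalent if one is a scalar multiple of the other. -/
instance latSetoid : Setoid (Lat κ) where
  r M N := ∃ c : LS κ, c ≠ 0 ∧ M.1.map (homothety c) = N.1
  iseqv := by
    refine ⟨fun M => ⟨1, one_ne_zero, ?_⟩, ?_, ?_⟩
    · ext x; simp
    · rintro M N ⟨c, hc, h⟩
      refine ⟨c⁻¹, inv_ne_zero hc, ?_⟩
      rw [← h, ← Submodule.map_comp]
      ext x; simp [hc]
    · rintro M N P ⟨c, hc, h⟩ ⟨d, hd, h'⟩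
      refine ⟨d * c, mul_ne_zero hd hc, ?_⟩
      rw [← h', ← h, ← Submodule.map_comp]
      ext x; simp [mul_smul]

variable (κ)

/-- The vertices of the Bruhat-Tits building of `SL₂(κ((t)))`. -/
def Vertex : Type _ := Quotient (latSetoid (κ := κ))

variable {κ}

/-- The vertex represented by a lattice. -/
def Lat.vertex (M : Lat κ) : Vertex κ := Quotient.mk _ M

theorem isLattice_map (f : (Fin 2 → LS κ) →ₗ[LS κ] (Fin 2 → LS κ))
    (hf : Function.Surjective f) (M : Lat κ) :
    Submodule.IsLattice (LS κ) (M.1.map (f.restrictScalars (PS κ))) := by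
  have hM := M.2
  refine ⟨hM.fg.map _, ?_⟩
  have : ((M.1.map (f.restrictScalars (PS κ)) : Submodule _ _) : Set (Fin 2 → LS κ)) =
      f '' (M.1 : Set _) := rfl
  rw [this, ← Submodule.map_span, hM.span_eq_top, Submodule.map_top, LinearMap.range_eq_top]
  exact hf

theorem map_unif_le (M : Submodule (PS κ) (Fin 2 → LS κ)) :
    M.map (homothety (unif κ)) ≤ M := by
  rintro _ ⟨x, hx, rfl⟩
  have : homothety (unif κ) x = (PowerSeries.X : PS κ) • x := by
    rw [homothety_apply, unif, algebraMap_smul]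
  rw [this]
  exact M.smul_mem _ hx

theorem not_chain (M : Submodule (PS κ) (Fin 2 → LS κ)) (c : LS κ) (hc : c ≠ 0)
    (h1 : M.map (homothety (unif κ)) < M.map (homothety c)) (h2 : M.map (homothety c) < M) :
    False := by
  rcases ValuationRing.isInteger_or_isInteger (PS κ) c with ⟨a, ha⟩ | ⟨a, ha⟩
  · by_cases hu : PowerSeries.constantCoeff a = 0
    · obtain ⟨d, rfl⟩ := PowerSeries.X_dvd_iff.mpr hu
      refine not_le_of_gt h1 ?_
      rintro _ ⟨x, hx, rfl⟩
      refine ⟨d • x, M.smul_mem _ hx, ?_⟩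
      rw [homothety_apply, homothety_apply, ← ha, map_mul, mul_smul, unif, algebraMap_smul,
        algebraMap_smul, algebraMap_smul]
    · have hu' : IsUnit a := PowerSeries.isUnit_iff_constantCoeff.mpr (isUnit_iff_ne_zero.mpr hu)
      obtain ⟨u, rfl⟩ := hu'
      refine not_le_of_gt h2 ?_
      intro x hx
      refine ⟨(↑u⁻¹ : PS κ) • x, M.smul_mem _ hx, ?_⟩
      rw [homothety_apply, ← ha, algebraMap_smul, smul_smul]
      simp
  · refine not_le_of_gt h2 ?_
    intro x hx
    refine ⟨a • x, M.smul_mem _ hx, ?_⟩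
    rw [homothety_apply, ← algebraMap_smul (LS κ) a x, ha, smul_smul, mul_inv_cancel₀ hc, one_smul]

variable (κ)

/-- The Bruhat-Tits building of `SL₂(κ((t)))`, a one-dimensional simplicial complex, as a graph:
two vertices are joined by an edge (an alcove) iff they have representatives `M₀`, `M₁` with
`t M₁ ⊊ M₀ ⊊ M₁`. -/
noncomputable def building : SimpleGraph (Vertex κ) where
  Adj v w := ∃ M₀ M₁ : Lat κ, M₀.vertex = v ∧ M₁.vertex = w ∧
    M₁.1.map (homothety (unif κ)) < M₀.1 ∧ M₀.1 < M₁.1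
  symm := ⟨by
    rintro v w ⟨M₀, M₁, rfl, rfl, h1, h2⟩
    have hinj : Function.Injective (Submodule.map (homothety (unif κ))) :=
      Submodule.map_injective_of_injective fun x y h => by
        simpa [unif_ne_zero] using h
    have hlat : Submodule.IsLattice (LS κ) (M₁.1.map (homothety (unif κ))) := by
      refine isLattice_map (LinearMap.lsmul (LS κ) (Fin 2 → LS κ) (unif κ)) (fun x => ?_) M₁
      exact ⟨(unif κ)⁻¹ • x, by simp [unif_ne_zero]⟩
    refine ⟨⟨_, hlat⟩, M₀, ?_, rfl, ?_, h1⟩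
    · exact Quotient.sound (Setoid.symm ⟨unif κ, unif_ne_zero, rfl⟩)
    · exact lt_of_le_of_ne (Submodule.map_mono h2.le) fun h => h2.ne (hinj h)⟩
  loopless := ⟨by
    rintro v ⟨M₀, M₁, h0, rfl, h1, h2⟩
    obtain ⟨c, hc, h⟩ := Quotient.exact h0.symm
    rw [← h] at h1 h2
    exact not_chain _ c hc h1 h2⟩

variable {κ}

/-- The submodule `∧² M` of `∧² κ((t))² = κ((t))`, the last identification being given by the
determinant. -/
noncomputable def wedge (M : Submodule (PS κ) (Fin 2 → LS κ)) : Submodule (PS κ) (LS κ) :=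
  Submodule.span (PS κ) {d | ∃ x ∈ M, ∃ y ∈ M, d = Matrix.det (Matrix.of ![x, y])}

/-- The vertex `v` has type `m` (`m = 0, 1`): it is represented by a lattice `M` such that
`∧² M = t^n κ[[t]]` where `n` has the parity of `m`. -/
def HasType (v : Vertex κ) (m : ℕ) : Prop :=
  ∃ (M : Lat κ) (n : ℤ), M.vertex = v ∧ wedge M.1 = Submodule.span (PS κ) {unif κ ^ n} ∧
    n % 2 = (m : ℤ)

end Lattices

section Galleries

variable {V : Type*}

/-- A gallery `(C₀, …, C_n)` of length `n` in a one-dimensional simplicial complex: a sequence of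
alcoves such that `C_i` and `C_{i+1}` have a common vertex. -/
structure Gallery (G : SimpleGraph V) (n : ℕ) where
  alcove : Fin (n + 1) → Sym2 V
  mem : ∀ i, alcove i ∈ G.edgeSet
  adjacent : ∀ i : Fin n, ∃ v, v ∈ alcove i.castSucc ∧ v ∈ alcove i.succ

/-- The gallery has first alcove `D` and contains the vertex `P`. -/
def Gallery.Joins {G : SimpleGraph V} {n : ℕ} (Γ : Gallery G n) (D : Sym2 V) (P : V) : Prop :=
  Γ.alcove 0 = D ∧ ∃ i, P ∈ Γ.alcove i

/-- `departing S P n` is the set of alcoves `D` which are not contained in the subcomplex `S`, have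
the vertex `P` of `S` as vertex of departure from `S`, and have distance `n` from `S`:
among all the galleries with first alcove `D` which contain a vertex of `S`, one of minimal length
contains `P`, and its length plus one is `n`. -/
def departing {G : SimpleGraph V} (S : G.Subgraph) (P : V) (n : ℕ) : Set (Sym2 V) :=
  {D | D ∈ G.edgeSet ∧ D ∉ S.edgeSet ∧ P ∈ S.verts ∧
    ∃ (l : ℕ) (Γ : Gallery G l), Γ.Joins D P ∧ 1 + l = n ∧
      ∀ (l' : ℕ) (Γ' : Gallery G l') (P' : V), P' ∈ S.verts → Γ'.Joins D P' → l ≤ l'}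

/-- The vertices of type `m` of a subcomplex of the building. -/
def vertsOfType {κ : Type*} [Field κ] (S : (building κ).Subgraph) (m : ℕ) : Set (Vertex κ) :=
  {P | P ∈ S.verts ∧ HasType P m}

end Galleries

section Action

variable {κ : Type*} [Field κ]

theorem isLattice_linAct (g : GL (Fin 2) (LS κ)) (M : Lat κ) :
    Submodule.IsLattice (LS κ) (M.1.map (linAct g.1)) := by
  refine isLattice_map (Matrix.mulVecLin g.1) (fun x => ⟨(g⁻¹).1 *ᵥ x, ?_⟩) M
  rw [Matrix.mulVecLin_apply, Matrix.mulVec_mulVec, ← Units.val_mul, mul_inv_cancel,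
    Units.val_one, Matrix.one_mulVec]

/-- The action of `GL₂(κ((t)))` on lattices. -/
noncomputable def actLat (g : GL (Fin 2) (LS κ)) (M : Lat κ) : Lat κ :=
  ⟨M.1.map (linAct g.1), isLattice_linAct g M⟩

/-- The action of `GL₂(κ((t)))` on the vertices of the building. -/
noncomputable def actVertex (g : GL (Fin 2) (LS κ)) : Vertex κ → Vertex κ :=
  Quotient.map (actLat g) (by
    rintro M N ⟨c, hc, h⟩
    refine ⟨c, hc, ?_⟩
    show (M.1.map (linAct g.1)).map (homothety c) = N.1.map (linAct g.1)
    rw [← h, ← Submodule.map_comp, ← Submodule.map_comp]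
    congr 1
    refine LinearMap.ext fun x => ?_
    exact (Matrix.mulVec_smul g.1 c x).symm)

/-- The action of `GL₂(κ((t)))` on pairs of vertices, in particular on alcoves. -/
noncomputable def actAlcove (g : GL (Fin 2) (LS κ)) : Sym2 (Vertex κ) → Sym2 (Vertex κ) :=
  Sym2.map (actVertex g)

variable (κ)

/-- The submodule `κ[[t]] ⊕ t^i κ[[t]]`. -/
noncomputable def stdSubmodule (i : ℤ) : Submodule (PS κ) (Fin 2 → LS κ) :=
  Submodule.span (PS κ) {![1, 0], ![0, unif κ ^ i]}

theorem isLattice_std (i : ℤ) : Submodule.IsLattice (LS κ) (stdSubmodule κ i) := by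
  refine ⟨Submodule.fg_span (Set.toFinite _), ?_⟩
  rw [stdSubmodule, Submodule.span_span_of_tower, eq_top_iff]
  intro x _
  rw [Submodule.mem_span_pair]
  refine ⟨x 0, x 1 * (unif κ ^ i)⁻¹, ?_⟩
  have := zpow_ne_zero i (unif_ne_zero (κ := κ))
  ext j
  fin_cases j <;> simp [this]

/-- The vertex represented by `κ[[t]] ⊕ t^i κ[[t]]`. -/
noncomputable def stdVertex (i : ℤ) : Vertex κ := Lat.vertex ⟨stdSubmodule κ i, isLattice_std κ i⟩

/-- The `i`-th alcove `C^i` of the standard apartment; `C^0` is the base alcove. -/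
noncomputable def stdAlcove (i : ℤ) : Sym2 (Vertex κ) := s(stdVertex κ (i + 1), stdVertex κ i)

end Action

section Groups

variable (κ : Type*) [Field κ]

/-- The standard Iwahori subgroup of `GL₂(κ((t)))`: matrices whose diagonal entries are units of
`κ[[t]]`, whose upper right entry is in `κ[[t]]` and whose lower left entry is in `t κ[[t]]`. -/
noncomputable def iwahori : Subgroup (GL (Fin 2) (LS κ)) where
  carrier := {g | (∃ a : (PS κ)ˣ, g.1 0 0 = algebraMap (PS κ) (LS κ) a) ∧
    (∃ b : PS κ, g.1 0 1 = algebraMap (PS κ) (LS κ) b) ∧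
    (∃ c : PS κ, g.1 1 0 = algebraMap (PS κ) (LS κ) (PowerSeries.X * c)) ∧
    (∃ d : (PS κ)ˣ, g.1 1 1 = algebraMap (PS κ) (LS κ) d)}
  one_mem' := ⟨⟨1, by simp⟩, ⟨0, by simp⟩, ⟨0, by simp⟩, ⟨1, by simp⟩⟩
  mul_mem' := by
    rintro g h ⟨⟨a, ha⟩, ⟨b, hb⟩, ⟨c, hc⟩, ⟨d, hd⟩⟩ ⟨⟨a', ha'⟩, ⟨b', hb'⟩, ⟨c', hc'⟩, ⟨d', hd'⟩⟩
    have u1 : IsUnit (a.val * a'.val + b * (PowerSeries.X * c')) := by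
      rw [PowerSeries.isUnit_iff_constantCoeff]
      simp only [map_add, map_mul, PowerSeries.constantCoeff_X, zero_mul, mul_zero, add_zero]
      exact (a.isUnit.map _).mul (a'.isUnit.map _)
    have u2 : IsUnit (PowerSeries.X * c * b' + d.val * d'.val) := by
      rw [PowerSeries.isUnit_iff_constantCoeff]
      simp only [map_add, map_mul, PowerSeries.constantCoeff_X, zero_mul, zero_add]
      exact (d.isUnit.map _).mul (d'.isUnit.map _)
    refine ⟨⟨u1.unit, ?_⟩, ⟨a.val * b' + b * d'.val, ?_⟩, ⟨c * a'.val + d.val * c', ?_⟩, ⟨u2.unit, ?_⟩⟩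
    · simp [Matrix.mul_apply, Fin.sum_univ_two, ha, hb, ha', hc']
    · simp [Matrix.mul_apply, Fin.sum_univ_two, ha, hb, hb', hd']
    · simp [Matrix.mul_apply, Fin.sum_univ_two, hc, hd, ha', hc']; ring
    · simp [Matrix.mul_apply, Fin.sum_univ_two, hc, hd, hb', hd']
  inv_mem' := by
    rintro g ⟨⟨a, ha⟩, ⟨b, hb⟩, ⟨c, hc⟩, ⟨d, hd⟩⟩
    have u : IsUnit (a.val * d.val - b * (PowerSeries.X * c)) := by
      rw [PowerSeries.isUnit_iff_constantCoeff]
      simp only [map_sub, map_mul, PowerSeries.constantCoeff_X, zero_mul, mul_zero, sub_zero]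
      exact (a.isUnit.map _).mul (d.isUnit.map _)
    obtain ⟨u, hu⟩ := u
    have hdet : g.1.det = algebraMap (PS κ) (LS κ) u := by
      rw [hu, Matrix.det_fin_two, ha, hb, hc, hd]; simp
    have hr : Ring.inverse g.1.det = algebraMap (PS κ) (LS κ) ↑u⁻¹ := by
      rw [hdet, Ring.inverse_eq_inv']
      refine inv_eq_of_mul_eq_one_right ?_
      rw [← map_mul]; simp
    have hinv : (g⁻¹).1 = algebraMap (PS κ) (LS κ) ↑u⁻¹ • !![g.1 1 1, -g.1 0 1; -g.1 1 0, g.1 0 0] := by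
      rw [Matrix.coe_units_inv, Matrix.inv_def, hr, Matrix.adjugate_fin_two]
    refine ⟨⟨u⁻¹ * d, ?_⟩, ⟨-((↑u⁻¹ : PS κ) * b), ?_⟩, ⟨-((↑u⁻¹ : PS κ) * c), ?_⟩, ⟨u⁻¹ * a, ?_⟩⟩
    · rw [hinv]; simp [hd]
    · rw [hinv]; simp [hb]
    · rw [hinv]; simp [hc]; ring
    · rw [hinv]; simp [ha]

/-- The standard Iwahori subgroup of `SL₂(κ((t)))`. -/
noncomputable def iwahoriSL : Subgroup (Matrix.SpecialLinearGroup (Fin 2) (LS κ)) :=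
  (iwahori κ).comap Matrix.SpecialLinearGroup.toGL

/-- The diagonal torus `T(R)` of `SL₂(R)`. -/
def torus (R : Type*) [CommRing R] : Subgroup (Matrix.SpecialLinearGroup (Fin 2) R) where
  carrier := {g | g 0 1 = 0 ∧ g 1 0 = 0}
  one_mem' := by simp
  mul_mem' := by
    rintro g h ⟨h1, h2⟩ ⟨h3, h4⟩
    simp [Matrix.mul_apply, Fin.sum_univ_two, h1, h2, h3, h4]
  inv_mem' := by
    rintro g ⟨h1, h2⟩
    simp [Matrix.adjugate_fin_two, h1, h2]

/-- The subgroup `T(κ[[t]])` of `SL₂(κ((t)))`. -/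
noncomputable def torusO : Subgroup (Matrix.SpecialLinearGroup (Fin 2) (LS κ)) :=
  (torus (PS κ)).map (Matrix.SpecialLinearGroup.map (algebraMap (PS κ) (LS κ)))

/-- The normalizer `N` of the diagonal torus in `SL₂(κ((t)))`. -/
noncomputable def normTorus : Subgroup (Matrix.SpecialLinearGroup (Fin 2) (LS κ)) :=
  Subgroup.normalizer (torus (LS κ) : Set (Matrix.SpecialLinearGroup (Fin 2) (LS κ)))

instance torusO_normal : ((torusO κ).subgroupOf (normTorus κ)).Normal := by
  refine ⟨?_⟩
  rintro ⟨t, ht⟩ ⟨s, ⟨hs1, hs2⟩, rfl⟩ ⟨n, hn⟩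
  refine Subgroup.mem_subgroupOf.mpr ?_
  set T : Matrix.SpecialLinearGroup (Fin 2) (LS κ) :=
    Matrix.SpecialLinearGroup.map (algebraMap (PS κ) (LS κ)) s with hT
  show n * T * n⁻¹ ∈ torusO κ
  have hT' : T ∈ (torus (LS κ) : Set (Matrix.SpecialLinearGroup (Fin 2) (LS κ))) :=
    ⟨by simp [hT, hs1], by simp [hT, hs2]⟩
  obtain ⟨h01, h10⟩ := (Subgroup.mem_normalizer_iff.mp hn T).mp hT'
  have hdet := (n * T * n⁻¹).det_coe
  rw [Matrix.det_fin_two, h01, h10] at hdet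
  have hdets := s.det_coe
  rw [Matrix.det_fin_two, hs1, hs2] at hdets
  have htr : (↑(n * T * n⁻¹) : Matrix (Fin 2) (Fin 2) (LS κ)).trace =
      (↑T : Matrix (Fin 2) (Fin 2) (LS κ)).trace := by
    refine (congrArg Matrix.trace (Matrix.SpecialLinearGroup.coe_mul (n * T) n⁻¹)).trans ?_
    refine (Matrix.trace_mul_comm _ _).trans ?_
    refine (congrArg Matrix.trace (Matrix.SpecialLinearGroup.coe_mul n⁻¹ (n * T)).symm).trans ?_
    rw [inv_mul_cancel_left]
  rw [Matrix.trace_fin_two, Matrix.trace_fin_two] at htr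
  have e0 : T 0 0 = algebraMap (PS κ) (LS κ) (s 0 0) := rfl
  have e1 : T 1 1 = algebraMap (PS κ) (LS κ) (s 1 1) := rfl
  have hdetL := congrArg (algebraMap (PS κ) (LS κ)) hdets
  simp only [mul_zero, sub_zero, map_mul, map_one] at hdetL hdet
  rw [← e0, ← e1] at hdetL
  have key : ((n * T * n⁻¹) 0 0 - T 0 0) * ((n * T * n⁻¹) 0 0 - T 1 1) = 0 := by
    linear_combination hdetL - hdet + (n * T * n⁻¹) 0 0 * htr
  rcases mul_eq_zero.mp key with h | h
  · refine ⟨s, ⟨hs1, hs2⟩, ?_⟩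
    have h0 := sub_eq_zero.mp h
    have h1 : (n * T * n⁻¹) 1 1 = T 1 1 := by linear_combination htr - h
    refine Matrix.SpecialLinearGroup.ext _ _ fun i j => ?_
    fin_cases i <;> fin_cases j
    · exact h0.symm
    · exact hT'.1.trans h01.symm
    · exact hT'.2.trans h10.symm
    · exact h1.symm
  · refine ⟨s⁻¹, (torus (PS κ)).inv_mem ⟨hs1, hs2⟩, ?_⟩
    have h0 := sub_eq_zero.mp h
    have h1 : (n * T * n⁻¹) 1 1 = T 0 0 := by linear_combination htr - h
    rw [map_inv, ← hT]
    refine Matrix.SpecialLinearGroup.ext _ _ fun i j => ?_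
    fin_cases i <;> fin_cases j
    · simpa [Matrix.adjugate_fin_two] using h0.symm
    · simpa [Matrix.adjugate_fin_two, hT'.1] using h01.symm
    · simpa [Matrix.adjugate_fin_two, hT'.2] using h10.symm
    · simpa [Matrix.adjugate_fin_two] using h1.symm

/-- The affine Weyl group `W_a = N / T(κ[[t]])` of `SL₂(κ((t)))`. -/
abbrev Weyl : Type _ := normTorus κ ⧸ (torusO κ).subgroupOf (normTorus κ)

variable {κ}

/-- The two simple reflections of `W_a`: the classes of the matrices `(0 1; -1 0)` and
`(0 t⁻¹; -t 0)` of `N`. -/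
def simpleReflections : Set (Weyl κ) :=
  {s | ∃ n : normTorus κ, s = (n : Weyl κ) ∧
    ((↑n.1 : Matrix (Fin 2) (Fin 2) (LS κ)) = !![0, 1; -1, 0] ∨
      (↑n.1 : Matrix (Fin 2) (Fin 2) (LS κ)) = !![0, (unif κ)⁻¹; -unif κ, 0])}

/-- The length function of the Coxeter group `W_a`: the minimal length of an expression as a product
of simple reflections. -/
noncomputable def weylLength (w : Weyl κ) : ℕ :=
  sInf {n | ∃ l : List (Weyl κ), l.length = n ∧ (∀ s ∈ l, s ∈ simpleReflections) ∧ l.prod = w}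

theorem actVertex_mul (g h : GL (Fin 2) (LS κ)) (v : Vertex κ) :
    actVertex (g * h) v = actVertex g (actVertex h v) := by
  induction v using Quotient.inductionOn with
  | h M =>
    refine congrArg (Quotient.mk _) (Subtype.ext ?_)
    show M.1.map (linAct (g * h).1) = (M.1.map (linAct h.1)).map (linAct g.1)
    rw [← Submodule.map_comp]
    congr 1
    refine LinearMap.ext fun x => ?_
    exact (Matrix.mulVec_mulVec x g.1 h.1).symm

theorem actAlcove_mul (g h : GL (Fin 2) (LS κ)) (C : Sym2 (Vertex κ)) :
    actAlcove (g * h) C = actAlcove g (actAlcove h C) := by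
  rw [actAlcove, actAlcove, actAlcove, Sym2.map_map]
  congr 1
  funext v
  exact actVertex_mul g h v

theorem iwahori_map_le {g : GL (Fin 2) (LS κ)} (hg : g ∈ iwahori κ) {j : ℤ} (hj : j = 0 ∨ j = 1) :
    (stdSubmodule κ j).map (linAct g.1) ≤ stdSubmodule κ j := by
  obtain ⟨⟨a, ha⟩, ⟨b, hb⟩, ⟨c, hc⟩, ⟨d, hd⟩⟩ := hg
  rw [stdSubmodule, Submodule.map_span_le]
  rintro v (rfl | rfl)
  · rw [Submodule.mem_span_pair]
    rcases hj with rfl | rfl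
    · refine ⟨a.val, PowerSeries.X * c, ?_⟩
      ext i
      fin_cases i <;> simp [linAct_apply, Matrix.mulVec, dotProduct, ha, hc, Algebra.smul_def]
    · refine ⟨a.val, c, ?_⟩
      ext i
      fin_cases i <;>
        simp [linAct_apply, Matrix.mulVec, dotProduct, ha, hc, Algebra.smul_def, unif, mul_comm]
  · rw [Submodule.mem_span_pair]
    rcases hj with rfl | rfl
    · refine ⟨b, d.val, ?_⟩
      ext i
      fin_cases i <;> simp [linAct_apply, Matrix.mulVec, dotProduct, hb, hd, Algebra.smul_def]
    · refine ⟨b * PowerSeries.X, d.val, ?_⟩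
      ext i
      fin_cases i <;>
        simp [linAct_apply, Matrix.mulVec, dotProduct, hb, hd, Algebra.smul_def, unif]

theorem iwahori_fix {g : GL (Fin 2) (LS κ)} (hg : g ∈ iwahori κ) {j : ℤ} (hj : j = 0 ∨ j = 1) :
    actVertex g (stdVertex κ j) = stdVertex κ j := by
  have key : actLat g ⟨stdSubmodule κ j, isLattice_std κ j⟩ =
      ⟨stdSubmodule κ j, isLattice_std κ j⟩ := by
    apply Subtype.ext
    show (stdSubmodule κ j).map (linAct g.1) = stdSubmodule κ j
    refine le_antisymm (iwahori_map_le hg hj) ?_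
    intro x hx
    refine ⟨(g⁻¹).1 *ᵥ x, iwahori_map_le ((iwahori κ).inv_mem hg) hj (Submodule.mem_map_of_mem hx), ?_⟩
    rw [linAct_apply, Matrix.mulVec_mulVec, ← Units.val_mul, mul_inv_cancel, Units.val_one,
      Matrix.one_mulVec]
  exact congrArg Lat.vertex key

theorem iwahori_fix_alcove {g : GL (Fin 2) (LS κ)} (hg : g ∈ iwahori κ) :
    actAlcove g (stdAlcove κ 0) = stdAlcove κ 0 := by
  rw [actAlcove, stdAlcove, Sym2.map_mk, iwahori_fix hg (Or.inl rfl), zero_add,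
    iwahori_fix hg (Or.inr rfl)]

theorem torusO_le : torusO κ ≤ iwahoriSL κ := by
  rintro _ ⟨s, ⟨h1, h2⟩, rfl⟩
  have hd := s.det_coe
  rw [Matrix.det_fin_two, h1, h2, mul_zero, sub_zero] at hd
  refine ⟨⟨⟨s.1 0 0, s.1 1 1, hd, by rw [mul_comm]; exact hd⟩, rfl⟩, ⟨s.1 0 1, rfl⟩, ⟨0, ?_⟩,
    ⟨⟨s.1 1 1, s.1 0 0, by rw [mul_comm]; exact hd, hd⟩, rfl⟩⟩
  show algebraMap (PS κ) (LS κ) (s.1 1 0) = _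
  rw [h2, mul_zero]

theorem actAlcove_eq {x y : Matrix.SpecialLinearGroup (Fin 2) (LS κ)}
    (h : x⁻¹ * y ∈ iwahoriSL κ) :
    actAlcove (Matrix.SpecialLinearGroup.toGL x) (stdAlcove κ 0) =
      actAlcove (Matrix.SpecialLinearGroup.toGL y) (stdAlcove κ 0) := by
  have h1 : actAlcove (Matrix.SpecialLinearGroup.toGL (x⁻¹ * y)) (stdAlcove κ 0) =
      stdAlcove κ 0 := iwahori_fix_alcove h
  have h2 : Matrix.SpecialLinearGroup.toGL y =
      Matrix.SpecialLinearGroup.toGL x * Matrix.SpecialLinearGroup.toGL (x⁻¹ * y) := by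
    rw [← map_mul, mul_inv_cancel_left]
  rw [h2, actAlcove_mul, h1]

/-- The identification `x I ↦ x C^0` of `SL₂(κ((t))) / I`, the set of points of the affine flag
manifold, with the set of alcoves. -/
noncomputable def alcoveOf :
    Matrix.SpecialLinearGroup (Fin 2) (LS κ) ⧸ iwahoriSL κ → Sym2 (Vertex κ) :=
  Quotient.lift (fun x => actAlcove (Matrix.SpecialLinearGroup.toGL x) (stdAlcove κ 0))
    fun _ _ h => actAlcove_eq (QuotientGroup.leftRel_apply.mp h)

/-- The alcove `w C^0` of the standard apartment, for `w ∈ W_a`. -/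
noncomputable def weylAlcove : Weyl κ → Sym2 (Vertex κ) :=
  Quotient.lift (fun n => actAlcove (Matrix.SpecialLinearGroup.toGL n.1) (stdAlcove κ 0))
    fun _ _ h => actAlcove_eq
      (torusO_le (Subgroup.mem_subgroupOf.mp (QuotientGroup.leftRel_apply.mp h)))

variable (κ)

/-- The standard apartment: the full subcomplex of the building whose vertices are the vertices of
the alcoves in the `N`-orbit of `C^0`. -/
noncomputable def apartment : (building κ).Subgraph :=
  (⊤ : (building κ).Subgraph).induce {v | ∃ w : Weyl κ, v ∈ weylAlcove w}

/-- The subcomplex consisting of the base alcove and its two vertices. -/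
noncomputable def baseComplex : (building κ).Subgraph :=
  (⊤ : (building κ).Subgraph).induce {v | v ∈ stdAlcove κ 0}

/-- The matrix `b₁ = (0 1; t 0)`. -/
noncomputable def bOne : GL (Fin 2) (LS κ) :=
  Matrix.GeneralLinearGroup.mkOfDetNeZero !![0, 1; unif κ, 0] (by
    simp [Matrix.det_fin_two, unif_ne_zero])

/-- The matrix `diag(1, t^α)`. -/
noncomputable def bDiag (α : ℕ) : GL (Fin 2) (LS κ) :=
  Matrix.GeneralLinearGroup.mkOfDetNeZero !![1, 0; 0, unif κ ^ α] (by
    simp [Matrix.det_fin_two, unif_ne_zero])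

end Groups

section BaseChange

/-- A homomorphism of fields applied to the coefficients of Laurent series. -/
noncomputable def mapLS {κ κ' : Type*} [Field κ] [Field κ'] (f : κ →+* κ') : LS κ →+* LS κ' where
  toFun x := x.map f
  map_zero' := by ext; simp
  map_one' := by
    ext n
    simp only [HahnSeries.map_coeff, HahnSeries.coeff_one]
    split <;> simp
  map_add' x y := by ext; simp
  map_mul' x y := by
    exact HahnSeries.map_mul (f : κ →ₙ+* κ')

theorem mapLS_coeff {κ κ' : Type*} [Field κ] [Field κ'] (f : κ →+* κ') (x : LS κ) (n : ℤ) :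
    (mapLS f x).coeff n = f (x.coeff n) := rfl

variable (k K : Type*) [Field k] [Field K] [Algebra k K]

/-- The inclusion of `k((t))` into `K((t))`. -/
noncomputable def incl : LS k →+* LS K := mapLS (algebraMap k K)

/-- The inclusion of `k((t))²` into `K((t))²`. -/
noncomputable def inclVec (x : Fin 2 → LS k) : Fin 2 → LS K := fun i => incl k K (x i)

theorem algebraMap_coeff {κ : Type*} [Field κ] (a : PS κ) (n : ℤ) :
    (algebraMap (PS κ) (LS κ) a).coeff n = if n < 0 then 0 else PowerSeries.coeff n.natAbs a :=
  PowerSeries.coeff_coe a n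

theorem incl_ps (a : PS k) :
    incl k K (algebraMap (PS k) (LS k) a) =
      algebraMap (PS K) (LS K) (PowerSeries.map (algebraMap k K) a) := by
  ext n
  rw [incl, mapLS_coeff, algebraMap_coeff, algebraMap_coeff, PowerSeries.coeff_map]
  split <;> simp

variable {k}

/-- The submodule of `K((t))²` generated by a submodule of `k((t))²`. -/
noncomputable def extend (M : Submodule (PS k) (Fin 2 → LS k)) :
    Submodule (PS K) (Fin 2 → LS K) :=
  Submodule.span (PS K) (inclVec k K '' M)

theorem extend_mono {M N : Submodule (PS k) (Fin 2 → LS k)} (h : M ≤ N) :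
    extend K M ≤ extend K N :=
  Submodule.span_mono (Set.image_mono h)

theorem extend_span (s : Set (Fin 2 → LS k)) :
    extend K (Submodule.span (PS k) s) = Submodule.span (PS K) (inclVec k K '' s) := by
  refine le_antisymm (Submodule.span_le.mpr ?_)
    (Submodule.span_mono (Set.image_mono Submodule.subset_span))
  rintro _ ⟨x, hx, rfl⟩
  induction hx using Submodule.span_induction with
  | mem x hx => exact Submodule.subset_span ⟨x, hx, rfl⟩
  | zero =>
    have : inclVec k K 0 = 0 := by ext1 i; simp [inclVec]
    rw [this]; exact Submodule.zero_mem _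
  | add x y _ _ hx hy =>
    have : inclVec k K (x + y) = inclVec k K x + inclVec k K y := by ext1 i; simp [inclVec]
    rw [this]; exact Submodule.add_mem _ hx hy
  | smul a x _ hx =>
    have : inclVec k K (a • x) = PowerSeries.map (algebraMap k K) a • inclVec k K x := by
      ext1 i
      simp only [inclVec, Pi.smul_apply, Algebra.smul_def, map_mul, incl_ps]
    rw [this]; exact Submodule.smul_mem _ _ hx

theorem extend_homothety (c : LS k) (M : Submodule (PS k) (Fin 2 → LS k)) :
    extend K (M.map (homothety c)) = (extend K M).map (homothety (incl k K c)) := by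
  rw [extend, extend, Submodule.map_span, Submodule.map_coe, Set.image_image, Set.image_image]
  congr 2
  funext x i
  simp [inclVec]

theorem isLattice_extend (M : Lat k) : Submodule.IsLattice (LS K) (extend K M.1) := by
  have hM := M.2
  constructor
  · obtain ⟨s, hs⟩ := hM.fg
    rw [← hs, extend_span]
    exact Submodule.fg_span (s.finite_toSet.image _)
  · rw [extend, Submodule.span_span_of_tower, eq_top_iff]
    have key : ∀ x : Fin 2 → LS k, inclVec k K x ∈ Submodule.span (LS K) (inclVec k K '' M.1) := by
      intro x
      have hx : x ∈ Submodule.span (LS k) (M.1 : Set (Fin 2 → LS k)) := by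
        rw [hM.span_eq_top]; trivial
      induction hx using Submodule.span_induction with
      | mem x hx => exact Submodule.subset_span ⟨x, hx, rfl⟩
      | zero =>
        have : inclVec k K 0 = 0 := by ext1 i; simp [inclVec]
        rw [this]; exact Submodule.zero_mem _
      | add x y _ _ hx hy =>
        have : inclVec k K (x + y) = inclVec k K x + inclVec k K y := by ext1 i; simp [inclVec]
        rw [this]; exact Submodule.add_mem _ hx hy
      | smul a x _ hx =>
        have : inclVec k K (a • x) = incl k K a • inclVec k K x := by ext1 i; simp [inclVec]
        rw [this]; exact Submodule.smul_mem _ _ hx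
    intro x _
    have : x = x 0 • inclVec k K ![1, 0] + x 1 • inclVec k K ![0, 1] := by
      ext1 i; fin_cases i <;> simp [inclVec]
    rw [this]
    exact Submodule.add_mem _ (Submodule.smul_mem _ _ (key _)) (Submodule.smul_mem _ _ (key _))

/-- The lattice `M ⊗ K[[t]]` in `K((t))²` generated by a lattice `M` in `k((t))²`. -/
noncomputable def extendLat (M : Lat k) : Lat K := ⟨extend K M.1, isLattice_extend K M⟩

/-- Base change of vertices. -/
noncomputable def extendVertex : Vertex k → Vertex K :=
  Quotient.map (extendLat K) (by
    rintro M N ⟨c, hc, h⟩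
    refine ⟨incl k K c, by simpa using hc, ?_⟩
    show (extend K M.1).map _ = extend K N.1
    rw [← h, extend_homothety])

theorem le_of_extend_le {M N : Submodule (PS k) (Fin 2 → LS k)} (h : extend K M ≤ extend K N) :
    M ≤ N := by
  obtain ⟨p, hp⟩ := (Algebra.linearMap k K).exists_leftInverse_of_injective
    (LinearMap.ker_eq_bot.mpr (algebraMap k K).injective)
  have hp1 : ∀ a, p (algebraMap k K a) = a := fun a => LinearMap.congr_fun hp a
  let q : LS K → LS k := fun x => x.map p
  have hq0 : q 0 = 0 := by ext; simp [q]
  have hqadd : ∀ x y, q (x + y) = q x + q y := fun x y => by ext; simp [q]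
  have hqincl : ∀ x, q (incl k K x) = x := fun x => by
    ext n; exact hp1 _
  have hqmul : ∀ (c : LS K) (x : LS k), q (c * incl k K x) = q c * x := by
    intro c x
    ext n
    have h1 : (q c).support ⊆ c.support := fun i hi h => hi (by simp [q] at h ⊢; simp [h])
    have h2 : (incl k K x).support ⊆ x.support := fun i hi h => hi (by
      show algebraMap k K (x.coeff i) = 0
      rw [h, map_zero])
    rw [HahnSeries.coeff_mul_left' c.isPWO_support h1]
    show p ((c * incl k K x).coeff n) = _
    rw [HahnSeries.coeff_mul_right' x.isPWO_support h2, map_sum]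
    refine Finset.sum_congr rfl fun ij _ => ?_
    show p (c.coeff ij.1 * algebraMap k K (x.coeff ij.2)) = p (c.coeff ij.1) * x.coeff ij.2
    rw [mul_comm, ← Algebra.smul_def, map_smul, smul_eq_mul, mul_comm]
  have hqps : ∀ a : PS K, ∃ b : PS k, q (algebraMap (PS K) (LS K) a) = algebraMap _ _ b := by
    intro a
    refine ⟨PowerSeries.mk fun n => p (PowerSeries.coeff n a), ?_⟩
    ext n
    show p ((algebraMap (PS K) (LS K) a).coeff n) = _
    rw [algebraMap_coeff, algebraMap_coeff, PowerSeries.coeff_mk]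
    split <;> simp
  have key : ∀ x ∈ extend K N, (fun i => q (x i)) ∈ N := by
    intro x hx
    refine Submodule.closure_induction (p := fun x _ => (fun i => q (x i)) ∈ N) ?_ ?_ ?_ hx
    · simp only [Pi.zero_apply, hq0]; exact N.zero_mem
    · intro x y _ _ hx hy
      simp only [Pi.add_apply, hqadd]; exact N.add_mem hx hy
    · rintro a _ ⟨y, hy, rfl⟩
      obtain ⟨b, hb⟩ := hqps a
      have : (fun i => q ((a • inclVec k K y) i)) = b • y := by
        funext i
        simp only [Pi.smul_apply, inclVec, Algebra.smul_def, hqmul, hb]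
      rw [this]; exact N.smul_mem _ hy
  intro x hx
  have := key _ (h (Submodule.subset_span ⟨x, hx, rfl⟩))
  simpa only [inclVec, hqincl] using this

/-- Base change of the building of `SL₂(k((t)))` to the building of `SL₂(K((t)))`. -/
noncomputable def extendHom : building k →g building K where
  toFun := extendVertex K
  map_rel' := by
    rintro _ _ ⟨M₀, M₁, rfl, rfl, h1, h2⟩
    have ht : incl k K (unif k) = unif K := by
      rw [unif, incl_ps, PowerSeries.map_X, unif]
    refine ⟨extendLat K M₀, extendLat K M₁, rfl, rfl, ?_, ?_⟩
    · show (extend K M₁.1).map _ < extend K M₀.1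
      rw [← ht, ← extend_homothety]
      exact lt_of_le_not_ge (extend_mono K h1.le) fun h => not_le_of_gt h1 (le_of_extend_le K h)
    · exact lt_of_le_not_ge (extend_mono K h2.le) fun h => not_le_of_gt h2 (le_of_extend_le K h)

variable (k)

/-- The building of `SL₂(k((t)))` as a subcomplex of the building of `SL₂(K((t)))`. -/
noncomputable def rationalBuilding : (building K).Subgraph :=
  (⊤ : (building k).Subgraph).map (extendHom K)

end BaseChange

section Main

variable (k K : Type*) [Field k] [Fintype k] [Field K] [Algebra k K]

/-- The Frobenius `∑ aₙ tⁿ ↦ ∑ aₙ^q tⁿ` of `K((t))`, where `q` is the cardinality of `k`. -/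
noncomputable def frob : LS K →+* LS K := mapLS (FiniteField.frobeniusAlgHom k K : K →+* K)

variable {K}

/-- The points of the affine Deligne-Lusztig variety of `SL₂` attached to `b` and `w`: the cosets
`x I^{SL₂}` such that `x⁻¹ b σ(x) ∈ I w̃ I`, where `w̃ = (w, m)` is the class of `w b₁^m` in the
extended affine Weyl group, `m` being the valuation of `det b`. -/
def affineDL (w : Weyl K) (b : GL (Fin 2) (LS K)) :
    Set (Matrix.SpecialLinearGroup (Fin 2) (LS K) ⧸ iwahoriSL K) :=
  {c | ∃ (x : Matrix.SpecialLinearGroup (Fin 2) (LS K)) (n : normTorus K),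
    c = (x : Matrix.SpecialLinearGroup (Fin 2) (LS K) ⧸ iwahoriSL K) ∧ w = (n : Weyl K) ∧
    (Matrix.SpecialLinearGroup.toGL x)⁻¹ * b *
        Matrix.SpecialLinearGroup.toGL (Matrix.SpecialLinearGroup.map (frob k K) x) ∈
      DoubleCoset.doubleCoset
        (Matrix.SpecialLinearGroup.toGL n.1 * bOne K ^ (b.1.det : LS K).order)
        (iwahori K) (iwahori K)}

open Classical in
/-- The type `m` in the description of the affine Deligne-Lusztig sets, where `j > 0` is the length
of `w`: it is `0` if `i` is odd and `w C^0 = C^{-j}` or `i` is even and `w C^0 = C^j`, and `1` if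
`i` is odd and `w C^0 = C^j` or `i` is even and `w C^0 = C^{-j}`. -/
noncomputable def departureType (w : Weyl K) (i : ℕ) (j : ℤ) : ℕ :=
  if (Odd i ∧ weylAlcove w = stdAlcove K (-j)) ∨ (Even i ∧ weylAlcove w = stdAlcove K j) then 0
  else 1

end Main
end ADLV

open ADLV

/-!
The building of `SL₂` over `κ((t))` is a tree. Write `P_n` for the vertex of `κ[[t]] ⊕ t^n κ[[t]]`
and `u_y` for the lower triangular unipotent matrix with entry `y`. By the Iwasawa decomposition
every vertex is of the form `u_y P_n`, where `y` matters modulo `t^n κ[[t]]` only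
(`exists_eq_lowerUnip_std`, `actVertex_lowerUnip_std_eq_lowerUnip_iff`). In these coordinates one
sees that the Iwahori subgroup acts transitively on the paths of a given length which start with the
two vertices of the base alcove (`exists_iwahori_of_isPath`); acyclicity follows, and so does the
fact that the relative position of two alcoves, i.e. the orbit of the stabilizer of the first one in
which the second one lies, can be read off the path which joins them: its absolute value is given by
the length, and its sign by the type of the first vertex (`relPos_of_isPath`).

The affine Deligne-Lusztig set of `b` and `w` consists of the alcoves `D` such that `D` and `b σ(D)`
have relative position `w C^0` (`alcoveOf_image_affineDL`). In each of the three cases there is a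
connected full subcomplex `S`, preserved by `b σ`, all of whose vertices are moved by the same
distance `d` (`IsMinSubcomplex`): the building over `k` with `d = 0` for `b = 1`, the standard
apartment with `d = α` for `b = diag(1, t^α)`, and the closed base alcove with `d = 1` for `b = b₁`.
If `D` is an alcove not in `S` with vertex of departure `P` and distance `i`, then the path from `D`
to `b σ(D)` goes from `D` to `P`, inside `S` from `P` to `b σ(P)`, and from there to `b σ(D)`; there
is no backtracking, since `S` contains the fixed vertices if `d = 0`. Thus the relative position of
`D` and `b σ(D)` is `± (2 i + d - 1)`, with a sign determined by `i` and the type of `P`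
(`IsMinSubcomplex.relPos_of_mem_departing`, `IsMinSubcomplex.setOf_relPos`). The alcoves of `S` have
relative position of absolute value at most `d`, and are treated directly.

That the vertices fixed by the Frobenius are the rational ones is clear in terms of the coordinate
`y` (`mem_rationalBuilding_verts_iff_frobHom`). The affine Weyl group is identified with `ℤ` through
its simply transitive action on the alcoves of the standard apartment (`weylAlcove_injective`,
`weylLength_eq`).
-/

namespace ADLV

open scoped Matrix

/-! ### The fractional ideals of `κ((t))` -/

section FracIdeal

variable {κ : Type*} [Field κ]

theorem unif_eq_single : unif κ = HahnSeries.single 1 1 := by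
  rw [unif, LaurentSeries.coe_algebraMap, HahnSeries.ofPowerSeries_X]

theorem unif_zpow_eq_single (n : ℤ) : unif κ ^ n = HahnSeries.single n 1 := by
  rw [unif_eq_single]
  induction n with
  | zero => rfl
  | succ n ih =>
    rw [zpow_add_one₀ (by simp), ih, HahnSeries.single_mul_single, mul_one]
  | pred n ih =>
    rw [zpow_sub_one₀ (by simp), ih, mul_inv_eq_iff_eq_mul₀ (by simp),
      HahnSeries.single_mul_single, mul_one, sub_add_cancel]

theorem unif_zpow_ne_zero (n : ℤ) : unif κ ^ n ≠ 0 := zpow_ne_zero n unif_ne_zero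

theorem order_unif_zpow (n : ℤ) : (unif κ ^ n).order = n := by
  rw [unif_zpow_eq_single, HahnSeries.order_single one_ne_zero]

theorem order_unif : (unif κ).order = 1 := by
  simpa using order_unif_zpow (κ := κ) 1

variable (κ) in
/-- The fractional ideal `t^n κ[[t]]` of `κ((t))`. -/
noncomputable def fracIdeal (n : ℤ) : Submodule (PS κ) (LS κ) := Submodule.span (PS κ) {unif κ ^ n}

theorem mem_fracIdeal_iff_exists {n : ℤ} {x : LS κ} :
    x ∈ fracIdeal κ n ↔ ∃ a : PS κ, x = algebraMap (PS κ) (LS κ) a * unif κ ^ n := by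
  rw [fracIdeal, Submodule.mem_span_singleton]
  simp only [Algebra.smul_def, eq_comm]

theorem mem_fracIdeal_iff_coeff {n : ℤ} {x : LS κ} :
    x ∈ fracIdeal κ n ↔ ∀ m < n, x.coeff m = 0 := by
  rw [mem_fracIdeal_iff_exists]
  constructor
  · rintro ⟨a, rfl⟩ m hm
    rw [unif_zpow_eq_single, HahnSeries.coeff_mul_single, algebraMap_coeff, if_pos (by omega),
      zero_mul]
  · intro h
    refine ⟨PowerSeries.mk fun i => x.coeff (n + i), ?_⟩
    ext m
    rw [unif_zpow_eq_single, HahnSeries.coeff_mul_single, algebraMap_coeff]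
    split
    · rw [zero_mul, h m (by omega)]
    · rw [PowerSeries.coeff_mk, mul_one]
      congr 1
      omega

theorem mem_fracIdeal_iff_order {n : ℤ} {x : LS κ} (hx : x ≠ 0) :
    x ∈ fracIdeal κ n ↔ n ≤ x.order := by
  rw [mem_fracIdeal_iff_coeff]
  constructor
  · intro h
    by_contra hlt
    exact HahnSeries.coeff_order_eq_zero.not.mpr hx (h _ (not_le.mp hlt))
  · intro h m hm
    exact HahnSeries.coeff_eq_zero_of_lt_order (lt_of_lt_of_le hm h)

theorem mul_mem_fracIdeal {n m : ℤ} {x y : LS κ} (hx : x ∈ fracIdeal κ n)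
    (hy : y ∈ fracIdeal κ m) : x * y ∈ fracIdeal κ (n + m) := by
  rw [mem_fracIdeal_iff_exists] at *
  obtain ⟨a, rfl⟩ := hx
  obtain ⟨b, rfl⟩ := hy
  exact ⟨a * b, by rw [map_mul, zpow_add₀ unif_ne_zero]; ring⟩

theorem fracIdeal_mono {n m : ℤ} (h : n ≤ m) : fracIdeal κ m ≤ fracIdeal κ n := by
  intro x hx
  rw [mem_fracIdeal_iff_coeff] at *
  exact fun i hi => hx i (lt_of_lt_of_le hi h)

theorem unif_zpow_mem {n m : ℤ} : unif κ ^ n ∈ fracIdeal κ m ↔ m ≤ n := by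
  rw [mem_fracIdeal_iff_order (unif_zpow_ne_zero n), order_unif_zpow]

theorem mem_fracIdeal_zero {x : LS κ} :
    x ∈ fracIdeal κ 0 ↔ ∃ a : PS κ, x = algebraMap (PS κ) (LS κ) a := by
  simp [mem_fracIdeal_iff_exists]

theorem mem_fracIdeal_one {x : LS κ} :
    x ∈ fracIdeal κ 1 ↔ ∃ a : PS κ, x = algebraMap (PS κ) (LS κ) (PowerSeries.X * a) := by
  simp [mem_fracIdeal_iff_exists, unif, mul_comm]

theorem one_mem_fracIdeal_zero : (1 : LS κ) ∈ fracIdeal κ 0 :=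
  mem_fracIdeal_zero.mpr ⟨1, by simp⟩

/-- Every nonzero Laurent series is a unit of `κ[[t]]` times a power of `t`. -/
theorem exists_unit_mul_zpow {x : LS κ} (hx : x ≠ 0) :
    ∃ u : (PS κ)ˣ, x = algebraMap (PS κ) (LS κ) u * unif κ ^ x.order := by
  obtain ⟨a, ha⟩ := mem_fracIdeal_iff_exists.mp ((mem_fracIdeal_iff_order hx).mpr le_rfl)
  have hu : IsUnit a := by
    rw [PowerSeries.isUnit_iff_constantCoeff, isUnit_iff_ne_zero,
      ← PowerSeries.coeff_zero_eq_constantCoeff_apply]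
    have h := HahnSeries.coeff_order_eq_zero.not.mpr hx
    rw [ha, unif_zpow_eq_single, HahnSeries.coeff_mul_single, ← unif_zpow_eq_single, ← ha,
      sub_self, algebraMap_coeff] at h
    simpa using h
  obtain ⟨u, rfl⟩ := hu
  exact ⟨u, ha⟩

theorem order_eq_zero_iff_unit {x : LS κ} (hx : x ≠ 0) :
    x.order = 0 ↔ ∃ u : (PS κ)ˣ, x = algebraMap (PS κ) (LS κ) u := by
  constructor
  · intro h
    obtain ⟨u, hu⟩ := exists_unit_mul_zpow hx
    exact ⟨u, by rw [hu, h, zpow_zero, mul_one]⟩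
  · rintro ⟨u, rfl⟩
    have h1 : (algebraMap (PS κ) (LS κ) u) ≠ 0 := hx
    have h2 : (algebraMap (PS κ) (LS κ) (u⁻¹ : (PS κ)ˣ)) ≠ 0 := by
      intro h
      have : algebraMap (PS κ) (LS κ) (u * (u⁻¹ : (PS κ)ˣ)) = 0 := by rw [map_mul, h, mul_zero]
      simp at this
    have h3 := (mem_fracIdeal_iff_order h1).mp (mem_fracIdeal_zero.mpr ⟨_, rfl⟩)
    have h4 := (mem_fracIdeal_iff_order h2).mp (mem_fracIdeal_zero.mpr ⟨_, rfl⟩)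
    have h5 := HahnSeries.order_mul h1 h2
    rw [← map_mul, Units.mul_inv, map_one, HahnSeries.order_one] at h5
    omega

theorem order_inv {x : LS κ} (hx : x ≠ 0) : (x⁻¹).order = -x.order := by
  have := HahnSeries.order_mul hx (inv_ne_zero hx)
  rw [mul_inv_cancel₀ hx, HahnSeries.order_one] at this
  omega

/-- The quotient of two elements which generate the same fractional ideal has order zero. -/
theorem order_eq_of_span_eq {x y : LS κ} (hx : x ≠ 0) (hy : y ≠ 0)
    (h : Submodule.span (PS κ) {x} = Submodule.span (PS κ) {y}) : x.order = y.order := by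
  have key : ∀ {a b : LS κ}, a ≠ 0 → b ≠ 0 → a ∈ Submodule.span (PS κ) {b} →
      b.order ≤ a.order := by
    intro a b ha hb hab
    obtain ⟨c, rfl⟩ := Submodule.mem_span_singleton.mp hab
    rw [Algebra.smul_def] at ha ⊢
    rw [HahnSeries.order_mul (left_ne_zero_of_mul ha) hb]
    have := (mem_fracIdeal_iff_order (left_ne_zero_of_mul ha)).mp
      (mem_fracIdeal_zero.mpr ⟨c, rfl⟩)
    omega
  refine le_antisymm (key hy hx ?_) (key hx hy ?_)
  · rw [h]; exact Submodule.mem_span_singleton_self y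
  · rw [← h]; exact Submodule.mem_span_singleton_self x

end FracIdeal

/-! ### Coordinates on the set of vertices -/

section Coordinates

variable {κ : Type*} [Field κ]

theorem zpow_mul_mem_fracIdeal {n m : ℤ} {x : LS κ} :
    unif κ ^ n * x ∈ fracIdeal κ (n + m) ↔ x ∈ fracIdeal κ m := by
  refine ⟨fun h => ?_, mul_mem_fracIdeal (unif_zpow_mem.mpr le_rfl)⟩
  have h' := mul_mem_fracIdeal (unif_zpow_mem.mpr (le_refl (-n))) h
  rwa [← mul_assoc, ← zpow_add₀ unif_ne_zero, neg_add_cancel, zpow_zero, one_mul,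
    neg_add_cancel_left] at h'

theorem mem_stdSubmodule {i : ℤ} {v : Fin 2 → LS κ} :
    v ∈ stdSubmodule κ i ↔ v 0 ∈ fracIdeal κ 0 ∧ v 1 ∈ fracIdeal κ i := by
  rw [stdSubmodule, Submodule.mem_span_pair, mem_fracIdeal_zero, mem_fracIdeal_iff_exists]
  constructor
  · rintro ⟨a, b, rfl⟩
    exact ⟨⟨a, by simp [Algebra.smul_def]⟩, ⟨b, by simp [Algebra.smul_def]⟩⟩
  · rintro ⟨⟨a, ha⟩, ⟨b, hb⟩⟩
    refine ⟨a, b, ?_⟩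
    funext j
    fin_cases j <;> simp [Algebra.smul_def, ha, hb]

theorem GL_mulVec_inv_mulVec (g : GL (Fin 2) (LS κ)) (v : Fin 2 → LS κ) :
    g.1 *ᵥ ((g⁻¹).1 *ᵥ v) = v := by
  rw [Matrix.mulVec_mulVec, ← Units.val_mul, mul_inv_cancel, Units.val_one, Matrix.one_mulVec]

theorem GL_inv_mulVec_mulVec (g : GL (Fin 2) (LS κ)) (v : Fin 2 → LS κ) :
    (g⁻¹).1 *ᵥ (g.1 *ᵥ v) = v := by
  rw [Matrix.mulVec_mulVec, ← Units.val_mul, inv_mul_cancel, Units.val_one, Matrix.one_mulVec]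

theorem actVertex_vertex_eq_iff (g : GL (Fin 2) (LS κ)) (M N : Lat κ) :
    actVertex g M.vertex = N.vertex ↔
      ∃ c : LS κ, c ≠ 0 ∧ ∀ v, v ∈ M.1 ↔ c • (g.1 *ᵥ v) ∈ N.1 := by
  have h0 : actVertex g M.vertex = N.vertex ↔
      ∃ c : LS κ, c ≠ 0 ∧ (M.1.map (linAct g.1)).map (homothety c) = N.1 := Quotient.eq
  rw [h0]
  refine exists_congr fun c => and_congr_right fun hc => ?_
  constructor
  · intro h v
    rw [← h]
    refine ⟨fun hv => ⟨_, ⟨v, hv, rfl⟩, rfl⟩, ?_⟩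
    rintro ⟨_, ⟨w, hw, rfl⟩, hwv⟩
    have h1 : g.1 *ᵥ w = g.1 *ᵥ v := by simpa [hc] using hwv
    have h2 : w = v := by
      rw [← GL_inv_mulVec_mulVec g w, h1, GL_inv_mulVec_mulVec]
    rwa [← h2]
  · intro h
    ext v
    constructor
    · rintro ⟨_, ⟨w, hw, rfl⟩, rfl⟩
      exact (h w).mp hw
    · intro hv
      have e : c • (g.1 *ᵥ ((g⁻¹).1 *ᵥ (c⁻¹ • v))) = v := by
        rw [GL_mulVec_inv_mulVec, smul_smul, mul_inv_cancel₀ hc, one_smul]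
      exact ⟨_, ⟨(g⁻¹).1 *ᵥ (c⁻¹ • v), (h _).mpr (by rwa [e]), rfl⟩, e⟩

theorem actVertex_std_eq_iff (g : GL (Fin 2) (LS κ)) (i j : ℤ) :
    actVertex g (stdVertex κ i) = stdVertex κ j ↔ ∃ c : LS κ, c ≠ 0 ∧
      ∀ v, v ∈ stdSubmodule κ i ↔ c • (g.1 *ᵥ v) ∈ stdSubmodule κ j :=
  actVertex_vertex_eq_iff g _ _

@[simp] theorem actVertex_one (v : Vertex κ) : actVertex 1 v = v := by
  induction v using Quotient.inductionOn with
  | h M =>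
    exact (actVertex_vertex_eq_iff 1 M M).mpr ⟨1, one_ne_zero, fun v => by simp⟩

@[simp] theorem actVertex_inv_actVertex (g : GL (Fin 2) (LS κ)) (v : Vertex κ) :
    actVertex g⁻¹ (actVertex g v) = v := by
  rw [← actVertex_mul, inv_mul_cancel, actVertex_one]

@[simp] theorem actVertex_actVertex_inv (g : GL (Fin 2) (LS κ)) (v : Vertex κ) :
    actVertex g (actVertex g⁻¹ v) = v := by
  rw [← actVertex_mul, mul_inv_cancel, actVertex_one]

theorem actVertex_injective (g : GL (Fin 2) (LS κ)) : Function.Injective (actVertex g) :=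
  Function.LeftInverse.injective (actVertex_inv_actVertex g)

theorem actVertex_eq_iff_eq_inv {g : GL (Fin 2) (LS κ)} {v w : Vertex κ} :
    actVertex g v = w ↔ v = actVertex g⁻¹ w := by
  constructor
  · rintro rfl; simp
  · rintro rfl; simp

@[simp] theorem actAlcove_one (D : Sym2 (Vertex κ)) : actAlcove 1 D = D := by
  have : actVertex (1 : GL (Fin 2) (LS κ)) = id := funext actVertex_one
  rw [actAlcove, this, Sym2.map_id, id]

/-- The lower triangular unipotent matrix with lower left entry `y`. -/
noncomputable def lowerUnip (y : LS κ) : GL (Fin 2) (LS κ) :=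
  Matrix.GeneralLinearGroup.mkOfDetNeZero !![1, 0; y, 1] (by simp [Matrix.det_fin_two])

variable (κ) in
/-- The diagonal matrix `diag(1, t^n)`. -/
noncomputable def diagZpow (n : ℤ) : GL (Fin 2) (LS κ) :=
  Matrix.GeneralLinearGroup.mkOfDetNeZero !![1, 0; 0, unif κ ^ n]
    (by simp [Matrix.det_fin_two, unif_zpow_ne_zero])

@[simp] theorem coe_lowerUnip (y : LS κ) : (lowerUnip y).1 = !![1, 0; y, 1] := rfl

@[simp] theorem coe_diagZpow (n : ℤ) : (diagZpow κ n).1 = !![1, 0; 0, unif κ ^ n] := rfl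

@[simp] theorem coe_bOne : (bOne κ).1 = !![0, 1; unif κ, 0] := rfl

theorem bDiag_eq_diagZpow (α : ℕ) : bDiag κ α = diagZpow κ α :=
  Units.ext (by rw [coe_diagZpow, zpow_natCast]; rfl)

theorem lowerUnip_mulVec (y : LS κ) (v : Fin 2 → LS κ) :
    (lowerUnip y).1 *ᵥ v = ![v 0, y * v 0 + v 1] := by
  funext j
  fin_cases j <;> simp [Matrix.mulVec, dotProduct]

theorem lowerUnip_add (y z : LS κ) : lowerUnip (y + z) = lowerUnip y * lowerUnip z := by
  refine Units.ext ?_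
  rw [Units.val_mul, coe_lowerUnip, coe_lowerUnip, coe_lowerUnip, Matrix.mul_fin_two]
  simp

theorem lowerUnip_neg (y : LS κ) : lowerUnip (-y) = (lowerUnip y)⁻¹ := by
  rw [eq_inv_iff_mul_eq_one, ← lowerUnip_add, neg_add_cancel]
  refine Units.ext ?_
  rw [coe_lowerUnip, Units.val_one, Matrix.one_fin_two]

theorem diagZpow_mul_lowerUnip (n : ℤ) (y : LS κ) :
    diagZpow κ n * lowerUnip y = lowerUnip (unif κ ^ n * y) * diagZpow κ n := by
  refine Units.ext ?_
  simp

theorem actVertex_diagZpow_std (n i : ℤ) :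
    actVertex (diagZpow κ n) (stdVertex κ i) = stdVertex κ (i + n) := by
  refine (actVertex_std_eq_iff _ _ _).mpr ⟨1, one_ne_zero, fun v => ?_⟩
  rw [mem_stdSubmodule, mem_stdSubmodule, add_comm i n, ← zpow_mul_mem_fracIdeal (n := n) (m := i)]
  simp [dotProduct]

theorem actVertex_bOne_std (i : ℤ) :
    actVertex (bOne κ) (stdVertex κ i) = stdVertex κ (1 - i) := by
  refine (actVertex_std_eq_iff _ _ _).mpr ⟨unif κ ^ (-i), unif_zpow_ne_zero _, fun v => ?_⟩
  rw [mem_stdSubmodule, mem_stdSubmodule, ← zpow_mul_mem_fracIdeal (n := -i) (m := i),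
    ← zpow_mul_mem_fracIdeal (n := 1 - i) (m := 0), and_comm, neg_add_cancel, add_zero,
    show (1 - i : ℤ) = -i + 1 by ring, zpow_add_one₀ unif_ne_zero]
  simp [dotProduct, mul_assoc]

/-- The vertices `u_y P_n`, where `u_y` is lower unipotent, are parametrized by `n ∈ ℤ` and
`y ∈ κ((t)) / t^n κ[[t]]`. -/
theorem actVertex_lowerUnip_std_eq_iff {y : LS κ} {n j : ℤ} :
    actVertex (lowerUnip y) (stdVertex κ n) = stdVertex κ j ↔ n = j ∧ y ∈ fracIdeal κ j := by
  rw [actVertex_std_eq_iff]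
  constructor
  · rintro ⟨c, hc, h⟩
    simp only [lowerUnip_mulVec, mem_stdSubmodule, Pi.smul_apply, Matrix.cons_val_zero,
      Matrix.cons_val_one, smul_eq_mul] at h
    have h1 := ((h ![0, unif κ ^ n]).mp (by simp [unif_zpow_mem])).2
    have h2 := (h (c⁻¹ • ![0, unif κ ^ j])).mpr (by simp [hc, unif_zpow_mem])
    have h3 := (h ![1, 0]).mp (by simp [one_mem_fracIdeal_zero])
    have h4 := (h (c⁻¹ • ![1, -y])).mpr (by simp [hc, mul_comm y, one_mem_fracIdeal_zero])
    simp only [Matrix.cons_val_zero, Matrix.cons_val_one, Pi.smul_apply, smul_eq_mul, mul_zero,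
      zero_add, mul_one, add_zero] at h1 h2 h3 h4
    have hci := inv_ne_zero hc
    rw [mem_fracIdeal_iff_order (mul_ne_zero hc (unif_zpow_ne_zero n)),
      HahnSeries.order_mul hc (unif_zpow_ne_zero n), order_unif_zpow] at h1
    have h2' := h2.2
    rw [mem_fracIdeal_iff_order (mul_ne_zero hci (unif_zpow_ne_zero j)),
      HahnSeries.order_mul hci (unif_zpow_ne_zero j), order_unif_zpow, order_inv hc] at h2'
    have h3' := (mem_fracIdeal_iff_order hc).mp h3.1
    have h4' := (mem_fracIdeal_iff_order hci).mp h4.1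
    rw [order_inv hc] at h4'
    refine ⟨by omega, ?_⟩
    have := mul_mem_fracIdeal h4.1 h3.2
    rwa [inv_mul_cancel_left₀ hc, zero_add] at this
  · rintro ⟨rfl, hy⟩
    refine ⟨1, one_ne_zero, fun v => ?_⟩
    rw [lowerUnip_mulVec, one_smul, mem_stdSubmodule, mem_stdSubmodule]
    refine and_congr_right fun h0 => ?_
    have := mul_mem_fracIdeal hy h0
    rw [add_zero] at this
    exact (Submodule.add_mem_iff_right _ this).symm

theorem actVertex_lowerUnip_std {y : LS κ} {n : ℤ} (hy : y ∈ fracIdeal κ n) :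
    actVertex (lowerUnip y) (stdVertex κ n) = stdVertex κ n :=
  actVertex_lowerUnip_std_eq_iff.mpr ⟨rfl, hy⟩

theorem lowerUnip_zero : lowerUnip (0 : LS κ) = 1 :=
  Units.ext (by rw [coe_lowerUnip, Units.val_one, Matrix.one_fin_two])

theorem stdVertex_injective : Function.Injective (stdVertex κ) := by
  intro i j h
  refine (actVertex_lowerUnip_std_eq_iff (κ := κ) (y := 0)).mp ?_ |>.1
  rw [lowerUnip_zero, actVertex_one, h]

theorem actVertex_lowerUnip_std_eq_lowerUnip_iff {y z : LS κ} {n j : ℤ} :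
    actVertex (lowerUnip y) (stdVertex κ n) = actVertex (lowerUnip z) (stdVertex κ j) ↔
      n = j ∧ y - z ∈ fracIdeal κ j := by
  rw [← actVertex_lowerUnip_std_eq_iff, sub_eq_neg_add, lowerUnip_add, lowerUnip_neg,
    actVertex_mul, eq_comm, actVertex_eq_iff_eq_inv, eq_comm]

theorem exists_span_pair (M : Lat κ) : ∃ e f, M.1 = Submodule.span (PS κ) {e, f} := by
  have := M.2
  have hr : Module.finrank (PS κ) M.1 = 2 := by
    rw [Submodule.IsLattice.finrank_of_pi (R := PS κ) (K := LS κ) M.1, Fintype.card_fin]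
  let b := Module.finBasisOfFinrankEq (PS κ) M.1 hr
  refine ⟨b 0, b 1, ?_⟩
  have h := b.span_eq
  have h' := congrArg (Submodule.map M.1.subtype) h
  rw [Submodule.map_top, Submodule.range_subtype, Submodule.map_span, ← Set.range_comp] at h'
  refine h'.symm.trans ?_
  congr 1
  ext x
  simp [Fin.exists_fin_two, eq_comm]

/-- A lattice has a basis in lower triangular form. -/
theorem exists_lower_triangular_span (M : Lat κ) :
    ∃ a y d : LS κ, a ≠ 0 ∧ d ≠ 0 ∧ M.1 = Submodule.span (PS κ) {![a, y], ![0, d]} := by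
  obtain ⟨e, f, h⟩ := exists_span_pair M
  have key : ∃ e f, M.1 = Submodule.span (PS κ) {e, f} ∧ f 0 = 0 := by
    -- one of the first coordinates divides the other one
    have reduce : ∀ e f : Fin 2 → LS κ, M.1 = Submodule.span (PS κ) {e, f} →
        (∃ a : PS κ, f 0 = a • e 0) → ∃ e f, M.1 = Submodule.span (PS κ) {e, f} ∧ f 0 = 0 := by
      rintro e f h ⟨a, ha⟩
      refine ⟨e, f - a • e, ?_, by simp [ha]⟩
      rw [h, Submodule.span_insert, Submodule.span_insert]
      refine le_antisymm (sup_le le_sup_left ?_) (sup_le le_sup_left ?_)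
      · rw [Submodule.span_singleton_le_iff_mem, ← Submodule.span_insert, Submodule.mem_span_pair]
        exact ⟨a, 1, by simp⟩
      · rw [Submodule.span_singleton_le_iff_mem, ← Submodule.span_insert, Submodule.mem_span_pair]
        exact ⟨-a, 1, by rw [neg_smul, one_smul, neg_add_eq_sub]⟩
    by_cases he : e 0 = 0
    · exact ⟨f, e, by rw [h, Set.pair_comm], he⟩
    · rcases ValuationRing.isInteger_or_isInteger (PS κ) (f 0 / e 0) with ⟨a, ha⟩ | ⟨a, ha⟩
      · exact reduce e f h ⟨a, by rw [Algebra.smul_def, ha, div_mul_cancel₀ _ he]⟩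
      · by_cases hf : f 0 = 0
        · exact ⟨e, f, h, hf⟩
        · exact reduce f e (by rw [h, Set.pair_comm])
            ⟨a, by rw [Algebra.smul_def, ha, inv_div, div_mul_cancel₀ _ hf]⟩
  obtain ⟨e, f, h, hf⟩ := key
  have htop : ∀ v : Fin 2 → LS κ, ∃ a b : LS κ, a • e + b • f = v := by
    intro v
    have := M.2.span_eq_top
    rw [h, Submodule.span_span_of_tower] at this
    exact Submodule.mem_span_pair.mp (this ▸ Submodule.mem_top)
  have he0 : e 0 ≠ 0 := by
    intro h0
    obtain ⟨a, b, hab⟩ := htop ![1, 0]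
    have := congrFun hab 0
    simp [h0, hf] at this
  have hf1 : f 1 ≠ 0 := by
    intro h1
    obtain ⟨a, b, hab⟩ := htop ![0, 1]
    have e0 := congrFun hab 0
    have e1 := congrFun hab 1
    simp [hf, he0] at e0
    simp [h1, e0] at e1
  refine ⟨e 0, e 1, f 1, he0, hf1, ?_⟩
  rw [h]
  congr 2
  · funext j; fin_cases j <;> rfl
  · congr 1; funext j; fin_cases j
    · exact hf
    · rfl

/-- The Iwasawa decomposition: every vertex is `u_y P_n` for a lower unipotent matrix `u_y`. -/
theorem exists_eq_lowerUnip_std (v : Vertex κ) :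
    ∃ y n, v = actVertex (lowerUnip y) (stdVertex κ n) := by
  induction v using Quotient.inductionOn with
  | h M =>
    obtain ⟨a, y, d, ha, hd, h⟩ := exists_lower_triangular_span M
    refine ⟨a⁻¹ * y, (d / a).order, ?_⟩
    refine ((actVertex_vertex_eq_iff _ _ M).mpr ⟨a, ha, fun v => ?_⟩).symm
    obtain ⟨u, hu⟩ := exists_unit_mul_zpow (div_ne_zero hd ha)
    have hd' : d = a * (algebraMap (PS κ) (LS κ) u * unif κ ^ (d / a).order) := by
      rw [← hu]; field_simp
    have hui : algebraMap (PS κ) (LS κ) u * algebraMap (PS κ) (LS κ) (u⁻¹ : (PS κ)ˣ) = 1 := by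
      rw [← map_mul, Units.mul_inv, map_one]
    generalize (d / a).order = n at hd'
    rw [h, Submodule.mem_span_pair, lowerUnip_mulVec]
    change v ∈ stdSubmodule κ n ↔ _
    rw [mem_stdSubmodule, mem_fracIdeal_zero, mem_fracIdeal_iff_exists]
    constructor
    · rintro ⟨⟨r, hr⟩, ⟨s, hs⟩⟩
      refine ⟨r, (u⁻¹ : (PS κ)ˣ) * s, ?_⟩
      funext j
      fin_cases j
      · change r • a + ((u⁻¹ : (PS κ)ˣ) * s : PS κ) • (0 : LS κ) = a * v 0
        rw [smul_zero, add_zero, Algebra.smul_def, hr, mul_comm]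
      · change r • y + ((u⁻¹ : (PS κ)ˣ) * s : PS κ) • d = a * (a⁻¹ * y * v 0 + v 1)
        rw [Algebra.smul_def, Algebra.smul_def, map_mul, hr, hs, hd', mul_add, mul_assoc a⁻¹,
          mul_inv_cancel_left₀ ha]
        linear_combination (a * algebraMap (PS κ) (LS κ) s * unif κ ^ n) * hui
    · rintro ⟨r, s, hrs⟩
      have e0 : r • a + s • (0 : LS κ) = a * v 0 := congrFun hrs 0
      have e1 : r • y + s • d = a * (a⁻¹ * y * v 0 + v 1) := congrFun hrs 1
      rw [smul_zero, add_zero, Algebra.smul_def] at e0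
      rw [Algebra.smul_def, Algebra.smul_def] at e1
      have hr : v 0 = algebraMap (PS κ) (LS κ) r :=
        mul_left_cancel₀ ha (by linear_combination -e0)
      refine ⟨⟨r, hr⟩, ⟨s * u, ?_⟩⟩
      refine mul_left_cancel₀ ha ?_
      rw [hd', hr, mul_add, mul_assoc a⁻¹, mul_inv_cancel_left₀ ha] at e1
      rw [map_mul]
      linear_combination -e1

end Coordinates

/-! ### The building is a tree -/

section Tree

variable {κ : Type*} [Field κ]

theorem smul_mem_of_mem_fracIdeal_zero (N : Submodule (PS κ) (Fin 2 → LS κ)) {x : LS κ}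
    (hx : x ∈ fracIdeal κ 0) {v : Fin 2 → LS κ} (hv : v ∈ N) : x • v ∈ N := by
  obtain ⟨a, rfl⟩ := mem_fracIdeal_zero.mp hx
  rw [algebraMap_smul]
  exact N.smul_mem a hv

theorem inv_mem_of_notMem_fracIdeal_one {x : LS κ} (h1 : x ∉ fracIdeal κ 1) :
    x ≠ 0 ∧ x⁻¹ ∈ fracIdeal κ 0 := by
  have hx : x ≠ 0 := by
    rintro rfl
    exact h1 (Submodule.zero_mem _)
  refine ⟨hx, ?_⟩
  rw [mem_fracIdeal_iff_order hx] at h1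
  rw [mem_fracIdeal_iff_order (inv_ne_zero hx), order_inv hx]
  omega

theorem unif_mul_mem_fracIdeal_one {x : LS κ} : unif κ * x ∈ fracIdeal κ 1 ↔ x ∈ fracIdeal κ 0 := by
  have := zpow_mul_mem_fracIdeal (κ := κ) (n := 1) (m := 0) (x := x)
  rwa [zpow_one, add_zero] at this

/-- Multiplication by a matrix in `GL₂(κ((t)))` as an endomorphism of the building. -/
noncomputable def actHom (g : GL (Fin 2) (LS κ)) : building κ →g building κ where
  toFun := actVertex g
  map_rel' := by
    rintro _ _ ⟨M₀, M₁, rfl, rfl, h1, h2⟩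
    have hinj : Function.Injective (Submodule.map (linAct g.1)) :=
      Submodule.map_injective_of_injective fun x y h => by
        have h' : g.1 *ᵥ x = g.1 *ᵥ y := h
        rw [← GL_inv_mulVec_mulVec g x, h', GL_inv_mulVec_mulVec]
    have hmono : ∀ {A B : Submodule (PS κ) (Fin 2 → LS κ)}, A < B →
        A.map (linAct g.1) < B.map (linAct g.1) := fun hAB =>
      lt_of_le_of_ne (Submodule.map_mono hAB.le) fun h => hAB.ne (hinj h)
    refine ⟨actLat g M₀, actLat g M₁, rfl, rfl, ?_, hmono h2⟩
    have : (M₁.1.map (linAct g.1)).map (homothety (unif κ)) =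
        (M₁.1.map (homothety (unif κ))).map (linAct g.1) := by
      rw [← Submodule.map_comp, ← Submodule.map_comp]
      congr 1
      refine LinearMap.ext fun x => ?_
      exact (Matrix.mulVec_smul g.1 (unif κ) x).symm
    exact this.trans_lt (hmono h1)

theorem actHom_apply (g : GL (Fin 2) (LS κ)) (v : Vertex κ) : actHom g v = actVertex g v := rfl

theorem adj_actVertex (g : GL (Fin 2) (LS κ)) {v w : Vertex κ} (h : (building κ).Adj v w) :
    (building κ).Adj (actVertex g v) (actVertex g w) :=
  (actHom g).map_adj h

theorem adj_std_one_zero : (building κ).Adj (stdVertex κ 1) (stdVertex κ 0) := by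
  refine ⟨_, _, rfl, rfl, ?_, ?_⟩
  · refine lt_of_le_of_ne ?_ fun h => ?_
    · rintro _ ⟨v, hv, rfl⟩
      have hv' := mem_stdSubmodule.mp hv
      refine mem_stdSubmodule.mpr ⟨?_, unif_mul_mem_fracIdeal_one.mpr hv'.2⟩
      exact fracIdeal_mono zero_le_one (unif_mul_mem_fracIdeal_one.mpr hv'.1)
    · have h1 : ![1, 0] ∈ stdSubmodule κ 1 :=
        mem_stdSubmodule.mpr ⟨one_mem_fracIdeal_zero, Submodule.zero_mem _⟩
      change (stdSubmodule κ 0).map _ = stdSubmodule κ 1 at h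
      rw [← h] at h1
      obtain ⟨v, hv, hv'⟩ := h1
      have h2 : unif κ * v 0 = unif κ ^ (0 : ℤ) := by simpa using congrFun hv' 0
      have h3 := unif_mul_mem_fracIdeal_one.mpr (mem_stdSubmodule.mp hv).1
      rw [h2, unif_zpow_mem] at h3
      omega
  · refine lt_of_le_not_ge (fun v hv => ?_) fun h => ?_
    · have hv' := mem_stdSubmodule.mp hv
      exact mem_stdSubmodule.mpr ⟨hv'.1, fracIdeal_mono zero_le_one hv'.2⟩
    · have h1 : ![0, 1] ∈ stdSubmodule κ 0 :=
        mem_stdSubmodule.mpr ⟨Submodule.zero_mem _, one_mem_fracIdeal_zero⟩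
      have h2 : (1 : LS κ) ∈ fracIdeal κ 1 := (mem_stdSubmodule.mp (h h1)).2
      rw [← zpow_zero (unif κ), unif_zpow_mem] at h2
      omega

theorem adj_std (i : ℤ) : (building κ).Adj (stdVertex κ i) (stdVertex κ (i + 1)) := by
  have := (adj_actVertex (diagZpow κ i) (adj_std_one_zero (κ := κ))).symm
  rwa [actVertex_diagZpow_std, actVertex_diagZpow_std, zero_add, add_comm] at this

theorem neighbors_std_zero {w : Vertex κ} (h : (building κ).Adj w (stdVertex κ 0)) :
    w = stdVertex κ (-1) ∨
      ∃ y ∈ fracIdeal κ 0, w = actVertex (lowerUnip y) (stdVertex κ 1) := by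
  obtain ⟨M₀, M₁, rfl, hM, h1, h2⟩ := h
  obtain ⟨c, hc, hM₁⟩ : ∃ c : LS κ, c ≠ 0 ∧ (stdSubmodule κ 0).map (homothety c) = M₁.1 :=
    Quotient.exact hM.symm
  -- rescale: `N = c⁻¹ M₀` lies between `t M` and `M`, where `M` is the standard lattice
  let N : Submodule (PS κ) (Fin 2 → LS κ) := M₀.1.comap (homothety c)
  have hN : ∀ v, v ∈ N ↔ c • v ∈ M₀.1 := fun v => Iff.rfl
  have hM' : ∀ v, v ∈ stdSubmodule κ 0 ↔ c • v ∈ M₁.1 := by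
    intro v
    rw [← hM₁]
    refine ⟨fun hv => ⟨v, hv, rfl⟩, ?_⟩
    rintro ⟨w, hw, hwv⟩
    rwa [← (smul_right_injective _ hc : Function.Injective fun x : Fin 2 → LS κ => c • x) hwv]
  have hle : ∀ v ∈ N, v 0 ∈ fracIdeal κ 0 ∧ v 1 ∈ fracIdeal κ 0 := fun v hv =>
    mem_stdSubmodule.mp ((hM' v).mpr (h2.le hv))
  have hge : ∀ v : Fin 2 → LS κ, v 0 ∈ fracIdeal κ 1 → v 1 ∈ fracIdeal κ 1 → v ∈ N := by
    intro v hv0 hv1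
    have hv : (unif κ)⁻¹ • v ∈ stdSubmodule κ 0 := by
      refine mem_stdSubmodule.mpr ⟨unif_mul_mem_fracIdeal_one.mp ?_,
        unif_mul_mem_fracIdeal_one.mp ?_⟩
      · simpa [unif_ne_zero] using hv0
      · simpa [unif_ne_zero] using hv1
    have := h1.le ⟨_, (hM' _).mp hv, rfl⟩
    rw [homothety_apply, smul_comm c, smul_smul, mul_inv_cancel₀ unif_ne_zero, one_smul] at this
    exact this
  have hne : ¬(![1, 0] ∈ N ∧ ![0, 1] ∈ N) := by
    rintro ⟨e, f⟩
    refine not_le_of_gt h2 ?_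
    intro v hv
    rw [← hM₁] at hv
    obtain ⟨w, hw, rfl⟩ := hv
    have hw' := mem_stdSubmodule.mp hw
    have : w = w 0 • ![1, 0] + w 1 • ![0, 1] := by
      funext j; fin_cases j <;> simp
    change w ∈ N
    rw [this]
    exact N.add_mem (smul_mem_of_mem_fracIdeal_zero N hw'.1 e)
      (smul_mem_of_mem_fracIdeal_zero N hw'.2 f)
  have hsplit : ∀ a b : LS κ, ![a, b] = ![a, 0] + ![0, b] := fun a b => by simp
  by_cases hcase : ∃ v ∈ N, v 0 ∉ fracIdeal κ 1
  · right
    obtain ⟨v, hv, hv0⟩ := hcase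
    obtain ⟨hne0, hinv⟩ := inv_mem_of_notMem_fracIdeal_one hv0
    have hy : ![1, (v 0)⁻¹ * v 1] ∈ N := by
      have := smul_mem_of_mem_fracIdeal_zero N hinv hv
      convert this using 1
      funext j; fin_cases j <;> simp [hne0]
    refine ⟨(v 0)⁻¹ * v 1, (hle _ hy).2, ?_⟩
    refine ((actVertex_vertex_eq_iff _ _ M₀).mpr ⟨c, hc, fun w => ?_⟩).symm
    change w ∈ stdSubmodule κ 1 ↔ _
    rw [← hN, lowerUnip_mulVec, mem_stdSubmodule]
    generalize (v 0)⁻¹ * v 1 = y at hy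
    have hdec : ![w 0, y * w 0 + w 1] = w 0 • ![1, y] + ![0, w 1] := by
      simp [mul_comm]
    constructor
    · rintro ⟨hw0, hw1⟩
      rw [hdec]
      exact N.add_mem (smul_mem_of_mem_fracIdeal_zero N hw0 hy) (hge _ (Submodule.zero_mem _) hw1)
    · intro hw
      have hw0 : w 0 ∈ fracIdeal κ 0 := (hle _ hw).1
      refine ⟨hw0, ?_⟩
      rw [hdec] at hw
      have hw1 : ![0, w 1] ∈ N :=
        (N.add_mem_iff_right (smul_mem_of_mem_fracIdeal_zero N hw0 hy)).mp hw
      by_contra hcon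
      obtain ⟨hw1ne, hw1inv⟩ := inv_mem_of_notMem_fracIdeal_one hcon
      have hf : ![0, 1] ∈ N := by
        have := smul_mem_of_mem_fracIdeal_zero N hw1inv hw1
        simpa [hw1ne] using this
      refine hne ⟨?_, hf⟩
      have := smul_mem_of_mem_fracIdeal_zero N (hle _ hy).2 hf
      rw [hsplit] at hy
      exact (N.add_mem_iff_left (by simpa using this)).mp hy
  · left
    push Not at hcase
    have hf : ![0, 1] ∈ N := by
      by_contra hcon
      refine not_le_of_gt h1 fun w hw => ?_
      have hv : c⁻¹ • w ∈ N := by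
        rw [hN, smul_smul, mul_inv_cancel₀ hc, one_smul]; exact hw
      have hv1 : (c⁻¹ • w) 1 ∈ fracIdeal κ 1 := by
        by_contra hcon'
        obtain ⟨hne1, hinv⟩ := inv_mem_of_notMem_fracIdeal_one hcon'
        refine hcon ?_
        have h3 : ![(c⁻¹ • w) 0, 0] ∈ N := hge _ (hcase (c⁻¹ • w) hv) (Submodule.zero_mem _)
        have h4 : ![0, (c⁻¹ • w) 1] ∈ N := by
          refine (N.add_mem_iff_right h3).mp ?_
          rw [← hsplit]
          convert hv using 1
          funext j; fin_cases j <;> rfl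
        have := smul_mem_of_mem_fracIdeal_zero N hinv h4
        rwa [Matrix.smul_cons, Matrix.smul_cons, Matrix.smul_empty, smul_zero, smul_eq_mul,
          inv_mul_cancel₀ hne1] at this
      have hv0 := hcase _ hv
      refine ⟨(unif κ)⁻¹ • w, ?_, ?_⟩
      · have : (unif κ)⁻¹ • w = c • ((unif κ)⁻¹ • c⁻¹ • w) := by
          rw [smul_comm c, smul_smul c, mul_inv_cancel₀ hc, one_smul]
        rw [this]
        refine (hM' _).mp (mem_stdSubmodule.mpr ⟨unif_mul_mem_fracIdeal_one.mp ?_,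
          unif_mul_mem_fracIdeal_one.mp ?_⟩)
        · rwa [Pi.smul_apply, smul_eq_mul, mul_inv_cancel_left₀ unif_ne_zero]
        · rwa [Pi.smul_apply, smul_eq_mul, mul_inv_cancel_left₀ unif_ne_zero]
      · rw [homothety_apply, smul_smul, mul_inv_cancel₀ unif_ne_zero, one_smul]
    symm
    rw [← actVertex_one (stdVertex κ (-1))]
    refine (actVertex_vertex_eq_iff _ _ M₀).mpr
      ⟨c * unif κ, mul_ne_zero hc unif_ne_zero, fun w => ?_⟩
    change w ∈ stdSubmodule κ (-1) ↔ _
    have hu := zpow_mul_mem_fracIdeal (κ := κ) (n := 1) (m := -1) (x := w 1)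
    rw [zpow_one, add_neg_cancel] at hu
    rw [Units.val_one, Matrix.one_mulVec, mul_smul, ← hN, mem_stdSubmodule, ← hu,
      ← unif_mul_mem_fracIdeal_one]
    constructor
    · rintro ⟨hw0, hw1⟩
      have : unif κ • w = ![unif κ * w 0, 0] + (unif κ * w 1) • ![0, 1] := by
        funext j; fin_cases j <;> simp
      rw [this]
      exact N.add_mem (hge _ hw0 (Submodule.zero_mem _)) (smul_mem_of_mem_fracIdeal_zero N hw1 hf)
    · intro hw
      exact ⟨hcase _ hw, (hle _ hw).2⟩

/-- The neighbours of `P_n` are `P_{n-1}` and the vertices `u_y P_{n+1}` with `y ∈ t^n κ[[t]]`. -/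
theorem neighbors_std {n : ℤ} {w : Vertex κ} (h : (building κ).Adj w (stdVertex κ n)) :
    w = stdVertex κ (n - 1) ∨
      ∃ y ∈ fracIdeal κ n, w = actVertex (lowerUnip y) (stdVertex κ (n + 1)) := by
  have h' := adj_actVertex (diagZpow κ n)⁻¹ h
  have e : actVertex (diagZpow κ n)⁻¹ (stdVertex κ n) = stdVertex κ 0 := by
    rw [eq_comm, ← actVertex_eq_iff_eq_inv, actVertex_diagZpow_std, zero_add]
  rw [e] at h'
  rcases neighbors_std_zero h' with h0 | ⟨y, hy, h0⟩
  · left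
    rw [eq_comm, ← actVertex_eq_iff_eq_inv, actVertex_diagZpow_std] at h0
    rw [← h0, neg_add_eq_sub]
  · right
    rw [eq_comm, ← actVertex_eq_iff_eq_inv, ← actVertex_mul, diagZpow_mul_lowerUnip, actVertex_mul,
      actVertex_diagZpow_std, add_comm 1 n] at h0
    refine ⟨_, ?_, h0.symm⟩
    have := zpow_mul_mem_fracIdeal (κ := κ) (n := n) (m := 0) (x := y)
    rw [add_zero] at this
    exact this.mpr hy

theorem lowerUnip_mem_iwahori {y : LS κ} (hy : y ∈ fracIdeal κ 1) : lowerUnip y ∈ iwahori κ := by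
  obtain ⟨a, ha⟩ := mem_fracIdeal_one.mp hy
  exact ⟨⟨1, by simp⟩, ⟨0, by simp⟩, ⟨a, by simpa using ha⟩, ⟨1, by simp⟩⟩

/-- The Iwahori subgroup acts transitively on the walks without backtracking of a given length which
begin with the base alcove, traversed from `P_0` to `P_1`. -/
theorem exists_iwahori_eq_std {p : ℕ → Vertex κ} {N : ℕ} (hN : 1 ≤ N)
    (hadj : ∀ j < N, (building κ).Adj (p j) (p (j + 1)))
    (hnb : ∀ j, j + 2 ≤ N → p j ≠ p (j + 2)) (h0 : p 0 = stdVertex κ 0) (h1 : p 1 = stdVertex κ 1) :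
    ∃ h ∈ iwahori κ, ∀ j ≤ N, p j = actVertex h (stdVertex κ j) := by
  induction N, hN using Nat.le_induction with
  | base =>
    refine ⟨1, one_mem _, fun j hj => ?_⟩
    obtain rfl | rfl : j = 0 ∨ j = 1 := by omega
    · simpa using h0
    · simpa using h1
  | succ N hN ih =>
    obtain ⟨h, hI, hp⟩ := ih (fun j hj => hadj j (by omega)) (fun j hj => hnb j (by omega))
    have ha := adj_actVertex h⁻¹ (hadj N (by omega)).symm
    rw [hp N le_rfl, actVertex_inv_actVertex] at ha
    rcases neighbors_std ha with hw | ⟨y, hy, hw⟩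
    · exfalso
      rw [eq_comm, ← actVertex_eq_iff_eq_inv] at hw
      have := hp (N - 1) (by omega)
      rw [Nat.cast_sub hN, Nat.cast_one, hw] at this
      refine hnb (N - 1) (by omega) (this.trans ?_)
      congr 1
      omega
    · -- the unipotent matrix which moves `P_{N+1}` to its place fixes `P_0, …, P_N`
      refine ⟨h * lowerUnip y, mul_mem hI (lowerUnip_mem_iwahori
        (fracIdeal_mono (by omega) hy)), fun j hj => ?_⟩
      rw [actVertex_mul]
      rcases Nat.lt_or_ge N j with hlt | hle
      · obtain rfl : j = N + 1 := by omega
        rw [Nat.cast_add, Nat.cast_one, ← hw, actVertex_actVertex_inv]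
      · rw [actVertex_lowerUnip_std (fracIdeal_mono (by omega) hy)]
        exact hp j hle

/-- `GL₂(κ((t)))` acts transitively on the pairs of adjacent vertices. -/
theorem exists_eq_act_of_adj {v w : Vertex κ} (h : (building κ).Adj v w) :
    ∃ g, v = actVertex g (stdVertex κ 0) ∧ w = actVertex g (stdVertex κ 1) := by
  obtain ⟨y, n, rfl⟩ := exists_eq_lowerUnip_std v
  have e : actVertex (lowerUnip y) (stdVertex κ n) =
      actVertex (lowerUnip y * diagZpow κ n) (stdVertex κ 0) := by
    rw [actVertex_mul, actVertex_diagZpow_std, zero_add]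
  rw [e] at h ⊢
  generalize lowerUnip y * diagZpow κ n = g at h
  have h' := adj_actVertex g⁻¹ h.symm
  rw [actVertex_inv_actVertex] at h'
  rcases neighbors_std_zero h' with hw | ⟨y, hy, hw⟩
  · rw [eq_comm, ← actVertex_eq_iff_eq_inv] at hw
    refine ⟨g * (diagZpow κ (-1) * bOne κ), ?_, ?_⟩
    · rw [actVertex_mul, actVertex_mul, actVertex_bOne_std, actVertex_diagZpow_std]
      rfl
    · rw [actVertex_mul, actVertex_mul, actVertex_bOne_std, actVertex_diagZpow_std, ← hw]
      rfl
  · rw [eq_comm, ← actVertex_eq_iff_eq_inv] at hw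
    refine ⟨g * lowerUnip y, ?_, ?_⟩
    · rw [actVertex_mul, actVertex_lowerUnip_std hy]
    · rw [actVertex_mul, hw]

theorem exists_iwahori_eq_act {p : ℕ → Vertex κ} {N : ℕ} (hN : 1 ≤ N)
    (hadj : ∀ j < N, (building κ).Adj (p j) (p (j + 1)))
    (hnb : ∀ j, j + 2 ≤ N → p j ≠ p (j + 2)) {g : GL (Fin 2) (LS κ)}
    (h0 : p 0 = actVertex g (stdVertex κ 0)) (h1 : p 1 = actVertex g (stdVertex κ 1)) :
    ∃ h ∈ iwahori κ, ∀ j ≤ N, p j = actVertex (g * h) (stdVertex κ j) := by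
  obtain ⟨h, hI, hp⟩ := exists_iwahori_eq_std (p := fun j => actVertex g⁻¹ (p j)) hN
    (fun j hj => adj_actVertex _ (hadj j hj))
    (fun j hj he => hnb j hj (actVertex_injective _ he)) (by simp [h0]) (by simp [h1])
  exact ⟨h, hI, fun j hj => by rw [actVertex_mul, actVertex_eq_iff_eq_inv.mp (hp j hj), inv_inv]⟩

/-- A cycle would be a closed non-backtracking gallery, hence the image of an injective segment of the
standard apartment. -/
theorem building_isAcyclic : (building κ).IsAcyclic := by
  intro v c hc
  have h3 := hc.three_le_length
  obtain ⟨g, h0, h1⟩ := exists_eq_act_of_adj (c.adj_getVert_succ (i := 0) (by omega))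
  obtain ⟨h, -, hp⟩ := exists_iwahori_eq_act (p := c.getVert) (N := c.length) (by omega)
    (fun j hj => c.adj_getVert_succ hj)
    (fun j hj => by
      have := hc.getVert_sub_one_ne_getVert_add_one (i := j + 1) (by omega)
      simpa using this) h0 h1
  have e0 := hp 0 (by omega)
  have e1 := hp c.length le_rfl
  rw [SimpleGraph.Walk.getVert_zero] at e0
  rw [SimpleGraph.Walk.getVert_length] at e1
  have := stdVertex_injective (actVertex_injective _ (e0.symm.trans e1))
  omega

theorem reachable_std (n : ℤ) : (building κ).Reachable (stdVertex κ 0) (stdVertex κ n) := by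
  induction n with
  | zero => rfl
  | succ n ih => exact ih.trans (adj_std _).reachable
  | pred n ih =>
    refine ih.trans ?_
    have := adj_std (κ := κ) (-n - 1)
    rw [sub_add_cancel] at this
    exact this.symm.reachable

theorem building_connected : (building κ).Connected := by
  have : Nonempty (Vertex κ) := ⟨stdVertex κ 0⟩
  have key : ∀ v, (building κ).Reachable (stdVertex κ 0) v := by
    intro v
    obtain ⟨y, n, rfl⟩ := exists_eq_lowerUnip_std v
    -- `u_y` fixes `P_m` for `m` sufficiently small
    obtain ⟨m, hm⟩ : ∃ m, y ∈ fracIdeal κ m :=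
      ⟨y.order, mem_fracIdeal_iff_coeff.mpr fun i hi => HahnSeries.coeff_eq_zero_of_lt_order hi⟩
    have h1 := ((reachable_std (κ := κ) m).symm.trans (reachable_std n)).map (actHom (lowerUnip y))
    rw [actHom_apply, actHom_apply, actVertex_lowerUnip_std hm] at h1
    exact (reachable_std m).trans h1
  exact ⟨fun v w => (key v).symm.trans (key w)⟩

theorem exists_iwahori_of_isPath {v w : Vertex κ} (W : (building κ).Walk v w) (hW : W.IsPath)
    (hl : 1 ≤ W.length) {g : GL (Fin 2) (LS κ)} (h0 : v = actVertex g (stdVertex κ 0))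
    (h1 : W.getVert 1 = actVertex g (stdVertex κ 1)) :
    ∃ h ∈ iwahori κ, ∀ j ≤ W.length, W.getVert j = actVertex (g * h) (stdVertex κ j) :=
  exists_iwahori_eq_act (p := W.getVert) hl (fun _ hj => W.adj_getVert_succ hj)
    (fun j hj he => by
      have := hW.getVert_injOn (by simp; omega) (by simp; omega) he
      omega)
    (by rw [SimpleGraph.Walk.getVert_zero, h0]) h1

end Tree

/-! ### Types of vertices -/

section Types

variable {κ : Type*} [Field κ]

/-- The valuation of the determinant. -/
noncomputable def valDet (g : GL (Fin 2) (LS κ)) : ℤ := (g.1.det : LS κ).order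

theorem det_GL_ne_zero (g : GL (Fin 2) (LS κ)) : g.1.det ≠ 0 :=
  ((Matrix.isUnit_iff_isUnit_det g.1).mp g.isUnit).ne_zero

theorem valDet_mul (g h : GL (Fin 2) (LS κ)) : valDet (g * h) = valDet g + valDet h := by
  rw [valDet, Units.val_mul, Matrix.det_mul, HahnSeries.order_mul (det_GL_ne_zero g)
    (det_GL_ne_zero h)]
  rfl

theorem valDet_one : valDet (1 : GL (Fin 2) (LS κ)) = 0 := by
  simp [valDet]

theorem valDet_inv (g : GL (Fin 2) (LS κ)) : valDet g⁻¹ = -valDet g := by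
  have := valDet_mul g g⁻¹
  rw [mul_inv_cancel, valDet_one] at this
  omega

theorem valDet_zpow (g : GL (Fin 2) (LS κ)) (n : ℤ) : valDet (g ^ n) = n * valDet g := by
  let f : GL (Fin 2) (LS κ) →* Multiplicative ℤ :=
    { toFun := fun g => Multiplicative.ofAdd (valDet g)
      map_one' := by rw [valDet_one]; rfl
      map_mul' := fun g h => by rw [valDet_mul]; rfl }
  have := congrArg Multiplicative.toAdd (map_zpow f g n)
  rw [toAdd_zpow, smul_eq_mul] at this
  exact this

theorem valDet_bOne : valDet (bOne κ) = 1 := by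
  simp [valDet, Matrix.det_fin_two, HahnSeries.order_neg, order_unif]

theorem valDet_toGL (x : Matrix.SpecialLinearGroup (Fin 2) (LS κ)) :
    valDet (Matrix.SpecialLinearGroup.toGL x) = 0 := by
  have : (Matrix.SpecialLinearGroup.toGL x).1.det = 1 := x.det_coe
  rw [valDet, this, HahnSeries.order_one]

theorem valDet_eq_zero_iff {g : GL (Fin 2) (LS κ)} :
    valDet g = 0 ↔ ∃ u : (PS κ)ˣ, g.1.det = algebraMap (PS κ) (LS κ) u :=
  order_eq_zero_iff_unit (det_GL_ne_zero g)

theorem valDet_of_mem_iwahori {g : GL (Fin 2) (LS κ)} (hg : g ∈ iwahori κ) : valDet g = 0 := by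
  obtain ⟨⟨a, ha⟩, ⟨b, hb⟩, ⟨c, hc⟩, ⟨d, hd⟩⟩ := hg
  have u : IsUnit (a.val * d.val - b * (PowerSeries.X * c)) := by
    rw [PowerSeries.isUnit_iff_constantCoeff]
    simp only [map_sub, map_mul, PowerSeries.constantCoeff_X, zero_mul, mul_zero, sub_zero]
    exact (a.isUnit.map _).mul (d.isUnit.map _)
  obtain ⟨u, hu⟩ := u
  refine valDet_eq_zero_iff.mpr ⟨u, ?_⟩
  rw [hu, Matrix.det_fin_two, ha, hb, hc, hd]
  simp only [map_sub, map_mul]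

theorem wedge_map {f : (Fin 2 → LS κ) →ₗ[PS κ] (Fin 2 → LS κ)} {δ : LS κ}
    (hf : ∀ x y, Matrix.det (Matrix.of ![f x, f y]) = δ * Matrix.det (Matrix.of ![x, y]))
    (M : Submodule (PS κ) (Fin 2 → LS κ)) :
    wedge (M.map f) = (wedge M).map (LinearMap.mulLeft (PS κ) δ) := by
  rw [wedge, wedge, Submodule.map_span]
  congr 1
  ext d
  constructor
  · rintro ⟨_, ⟨x, hx, rfl⟩, _, ⟨y, hy, rfl⟩, rfl⟩
    exact ⟨_, ⟨x, hx, y, hy, rfl⟩, (hf x y).symm⟩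
  · rintro ⟨_, ⟨x, hx, y, hy, rfl⟩, rfl⟩
    exact ⟨_, ⟨x, hx, rfl⟩, _, ⟨y, hy, rfl⟩, (hf x y).symm⟩

theorem det_linAct (g : Matrix (Fin 2) (Fin 2) (LS κ)) (x y : Fin 2 → LS κ) :
    Matrix.det (Matrix.of ![linAct g x, linAct g y]) =
      g.det * Matrix.det (Matrix.of ![x, y]) := by
  simp [Matrix.det_fin_two]
  ring

theorem det_homothety (c : LS κ) (x y : Fin 2 → LS κ) :
    Matrix.det (Matrix.of ![homothety c x, homothety c y]) =
      (c * c) * Matrix.det (Matrix.of ![x, y]) := by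
  simp [Matrix.det_fin_two]
  ring

theorem wedge_map_map {g : GL (Fin 2) (LS κ)} {c a : LS κ}
    {M : Submodule (PS κ) (Fin 2 → LS κ)} (hM : wedge M = Submodule.span (PS κ) {a}) :
    wedge ((M.map (linAct g.1)).map (homothety c)) =
      Submodule.span (PS κ) {c * c * (g.1.det * a)} := by
  rw [wedge_map (det_homothety c), wedge_map (det_linAct g.1), hM, Submodule.map_span,
    Submodule.map_span, Set.image_singleton, Set.image_singleton, LinearMap.mulLeft_apply,
    LinearMap.mulLeft_apply]

theorem wedge_std (i : ℤ) : wedge (stdSubmodule κ i) = Submodule.span (PS κ) {unif κ ^ i} := by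
  refine le_antisymm (Submodule.span_le.mpr ?_) ?_
  · rintro _ ⟨x, hx, y, hy, rfl⟩
    rw [mem_stdSubmodule] at hx hy
    have h1 := mul_mem_fracIdeal hx.1 hy.2
    have h2 := mul_mem_fracIdeal hx.2 hy.1
    rw [zero_add] at h1
    rw [add_zero] at h2
    have := Submodule.sub_mem _ h1 h2
    rw [Matrix.det_fin_two]
    exact this
  · rw [Submodule.span_singleton_le_iff_mem]
    refine Submodule.subset_span ⟨![1, 0], ?_, ![0, unif κ ^ i], ?_, ?_⟩
    · exact mem_stdSubmodule.mpr ⟨one_mem_fracIdeal_zero, Submodule.zero_mem _⟩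
    · exact mem_stdSubmodule.mpr ⟨Submodule.zero_mem _, unif_zpow_mem.mpr le_rfl⟩
    · simp [Matrix.det_fin_two]

theorem order_homothety_of_map_std {g : GL (Fin 2) (LS κ)} {c : LS κ} (hc : c ≠ 0) {i n : ℤ}
    {M : Submodule (PS κ) (Fin 2 → LS κ)} (hM : wedge M = Submodule.span (PS κ) {unif κ ^ n})
    (h : ((stdSubmodule κ i).map (linAct g.1)).map (homothety c) = M) :
    2 * c.order + (valDet g + i) = n := by
  have h1 := (wedge_map_map (g := g) (c := c) (wedge_std i)).symm
  rw [h, hM] at h1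
  have hd := det_GL_ne_zero g
  have ht := unif_zpow_ne_zero (κ := κ)
  have h2 := order_eq_of_span_eq (mul_ne_zero (mul_ne_zero hc hc) (mul_ne_zero hd (ht i))) (ht n) h1
  rw [HahnSeries.order_mul (mul_ne_zero hc hc) (mul_ne_zero hd (ht i)), HahnSeries.order_mul hc hc,
    HahnSeries.order_mul hd (ht i), order_unif_zpow, order_unif_zpow] at h2
  rw [valDet]
  omega

theorem span_singleton_eq_zpow {x : LS κ} (hx : x ≠ 0) :
    Submodule.span (PS κ) {x} = Submodule.span (PS κ) {unif κ ^ x.order} := by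
  obtain ⟨u, hu⟩ := exists_unit_mul_zpow hx
  conv_lhs => rw [hu, ← Algebra.smul_def]
  exact Submodule.span_singleton_smul_eq u.isUnit _

theorem hasType_act_std_iff {g : GL (Fin 2) (LS κ)} {i : ℤ} {m : ℕ} :
    HasType (actVertex g (stdVertex κ i)) m ↔ (valDet g + i) % 2 = (m : ℤ) := by
  constructor
  · rintro ⟨M, n, hM, hw, hn⟩
    obtain ⟨c, hc, h⟩ := Quotient.exact hM.symm
    have := order_homothety_of_map_std hc hw h
    omega
  · intro h
    refine ⟨actLat g ⟨stdSubmodule κ i, isLattice_std κ i⟩, valDet g + i, rfl, ?_, h⟩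
    have hne := mul_ne_zero (det_GL_ne_zero g) (unif_zpow_ne_zero (κ := κ) i)
    change wedge ((stdSubmodule κ i).map (linAct g.1)) = _
    rw [wedge_map (det_linAct g.1), wedge_std, Submodule.map_span, Set.image_singleton,
      LinearMap.mulLeft_apply, span_singleton_eq_zpow hne,
      HahnSeries.order_mul (det_GL_ne_zero g) (unif_zpow_ne_zero i), order_unif_zpow, valDet]

theorem hasType_std_iff {i : ℤ} {m : ℕ} : HasType (stdVertex κ i) m ↔ i % 2 = (m : ℤ) := by
  rw [← actVertex_one (stdVertex κ i), hasType_act_std_iff, valDet_one, zero_add]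

theorem hasType_act_of_valDet_eq_zero {g : GL (Fin 2) (LS κ)} (hg : valDet g = 0) {v : Vertex κ}
    {m : ℕ} : HasType (actVertex g v) m ↔ HasType v m := by
  obtain ⟨y, n, rfl⟩ := exists_eq_lowerUnip_std v
  rw [← actVertex_mul, hasType_act_std_iff, hasType_act_std_iff, valDet_mul, hg, zero_add]

theorem hasType_unique {v : Vertex κ} {m m' : ℕ} (h : HasType v m) (h' : HasType v m') :
    m = m' := by
  obtain ⟨y, n, rfl⟩ := exists_eq_lowerUnip_std v
  rw [hasType_act_std_iff] at h h'
  omega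

theorem actAlcove_std (g : GL (Fin 2) (LS κ)) (i : ℤ) :
    actAlcove g (stdAlcove κ i) =
      s(actVertex g (stdVertex κ (i + 1)), actVertex g (stdVertex κ i)) := rfl

theorem actAlcove_injective (g : GL (Fin 2) (LS κ)) : Function.Injective (actAlcove g) :=
  Function.LeftInverse.injective (g := actAlcove g⁻¹) fun D => by
    rw [← actAlcove_mul, inv_mul_cancel, actAlcove_one]

theorem actAlcove_bOne_zpow (n : ℤ) : actAlcove (bOne κ ^ n) (stdAlcove κ 0) = stdAlcove κ 0 := by
  have h1 : actAlcove (bOne κ) (stdAlcove κ 0) = stdAlcove κ 0 := by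
    rw [actAlcove_std, actVertex_bOne_std, actVertex_bOne_std, stdAlcove]
    exact Sym2.eq_swap
  induction n with
  | zero => rw [zpow_zero, actAlcove_one]
  | succ n ih => rw [zpow_add_one, actAlcove_mul, h1, ih]
  | pred n ih =>
    rw [zpow_sub_one, actAlcove_mul, ← ih]
    congr 1
    refine actAlcove_injective (bOne κ) ?_
    rw [← actAlcove_mul, mul_inv_cancel, actAlcove_one, ih, h1]

/-- The elements of the stabilizer of the base alcove whose determinant is a unit form the Iwahori
subgroup. -/
theorem mem_iwahori_of_actAlcove {g : GL (Fin 2) (LS κ)} (hd : valDet g = 0)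
    (h : actAlcove g (stdAlcove κ 0) = stdAlcove κ 0) : g ∈ iwahori κ := by
  have hfix : actVertex g (stdVertex κ 1) = stdVertex κ 1 ∧
      actVertex g (stdVertex κ 0) = stdVertex κ 0 := by
    rw [actAlcove_std, stdAlcove, zero_add, Sym2.eq_iff] at h
    refine h.resolve_right fun h' => ?_
    -- the two vertices are not exchanged since `g` preserves types
    have h0 := (hasType_act_of_valDet_eq_zero hd (v := stdVertex κ 0) (m := 0)).mpr
      (hasType_std_iff.mpr rfl)
    rw [h'.2, hasType_std_iff] at h0
    omega
  have key : ∀ i, actVertex g (stdVertex κ i) = stdVertex κ i →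
      ∀ v ∈ stdSubmodule κ i, g.1 *ᵥ v ∈ stdSubmodule κ i := by
    intro i hi v hv
    obtain ⟨c, hc, h⟩ : ∃ c : LS κ, c ≠ 0 ∧
        ((stdSubmodule κ i).map (linAct g.1)).map (homothety c) = stdSubmodule κ i :=
      Quotient.exact hi
    have hc0 := order_homothety_of_map_std hc (wedge_std i) h
    rw [hd] at hc0
    have hmem : c • (g.1 *ᵥ v) ∈ stdSubmodule κ i := h.le ⟨_, ⟨v, hv, rfl⟩, rfl⟩
    have hci : c⁻¹ ∈ fracIdeal κ 0 := by
      rw [mem_fracIdeal_iff_order (inv_ne_zero hc), order_inv hc]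
      omega
    have := smul_mem_of_mem_fracIdeal_zero _ hci hmem
    rwa [smul_smul, inv_mul_cancel₀ hc, one_smul] at this
  have col0 : g.1 *ᵥ ![1, 0] = ![g.1 0 0, g.1 1 0] := by
    funext j; fin_cases j <;> simp [Matrix.mulVec, dotProduct]
  have col1 : g.1 *ᵥ ![0, 1] = ![g.1 0 1, g.1 1 1] := by
    funext j; fin_cases j <;> simp [Matrix.mulVec, dotProduct]
  have m0 := key 1 hfix.1 ![1, 0]
    (mem_stdSubmodule.mpr ⟨one_mem_fracIdeal_zero, Submodule.zero_mem _⟩)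
  have m1 := key 0 hfix.2 ![0, 1]
    (mem_stdSubmodule.mpr ⟨Submodule.zero_mem _, one_mem_fracIdeal_zero⟩)
  rw [col0, mem_stdSubmodule] at m0
  rw [col1, mem_stdSubmodule] at m1
  obtain ⟨ha, hc⟩ : g.1 0 0 ∈ fracIdeal κ 0 ∧ g.1 1 0 ∈ fracIdeal κ 1 := m0
  obtain ⟨hb, hd'⟩ : g.1 0 1 ∈ fracIdeal κ 0 ∧ g.1 1 1 ∈ fracIdeal κ 0 := m1
  have hprod : g.1 0 0 * g.1 1 1 ∉ fracIdeal κ 1 := by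
    intro hm
    have hbc := mul_mem_fracIdeal hb hc
    rw [zero_add] at hbc
    have hdet := Submodule.sub_mem _ hm hbc
    rw [← Matrix.det_fin_two, mem_fracIdeal_iff_order (det_GL_ne_zero g)] at hdet
    rw [valDet] at hd
    omega
  have hunit : ∀ {x : LS κ}, x ∈ fracIdeal κ 0 → x ∉ fracIdeal κ 1 →
      ∃ u : (PS κ)ˣ, x = algebraMap (PS κ) (LS κ) u := by
    intro x h0 h1
    have hx := (inv_mem_of_notMem_fracIdeal_one h1).1
    rw [mem_fracIdeal_iff_order hx] at h0 h1
    exact (order_eq_zero_iff_unit hx).mp (by omega)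
  refine ⟨hunit ha fun h => hprod ?_, mem_fracIdeal_zero.mp hb, mem_fracIdeal_one.mp hc,
    hunit hd' fun h => hprod ?_⟩
  · simpa using mul_mem_fracIdeal h hd'
  · simpa using mul_mem_fracIdeal ha h

theorem bOne_conj_mem_iwahori {h : GL (Fin 2) (LS κ)} (hh : h ∈ iwahori κ) :
    bOne κ * h * (bOne κ)⁻¹ ∈ iwahori κ := by
  refine mem_iwahori_of_actAlcove ?_ ?_
  · rw [valDet_mul, valDet_mul, valDet_inv, valDet_of_mem_iwahori hh]
    ring
  · have h1 := actAlcove_bOne_zpow (κ := κ) (-1)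
    have h2 := actAlcove_bOne_zpow (κ := κ) 1
    rw [zpow_neg_one] at h1
    rw [zpow_one] at h2
    rw [actAlcove_mul, actAlcove_mul, h1, iwahori_fix_alcove hh, h2]

theorem stdAlcove_mem_edgeSet (i : ℤ) : stdAlcove κ i ∈ (building κ).edgeSet :=
  (adj_std i).symm

theorem actAlcove_mem_edgeSet (g : GL (Fin 2) (LS κ)) {D : Sym2 (Vertex κ)}
    (hD : D ∈ (building κ).edgeSet) : actAlcove g D ∈ (building κ).edgeSet := by
  induction D using Sym2.ind with
  | h v w => exact adj_actVertex g hD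

/-- `SL₂` acts transitively on the alcoves in a `GL₂`-orbit. -/
theorem exists_toGL_actAlcove (g : GL (Fin 2) (LS κ)) :
    ∃ x : Matrix.SpecialLinearGroup (Fin 2) (LS κ),
      actAlcove (Matrix.SpecialLinearGroup.toGL x) (stdAlcove κ 0) =
        actAlcove g (stdAlcove κ 0) := by
  -- correct the determinant by a power of `b₁` and by a diagonal unit matrix
  have h0 : valDet (g * bOne κ ^ (-valDet g)) = 0 := by
    rw [valDet_mul, valDet_zpow, valDet_bOne]
    ring
  have h1 : actAlcove (g * bOne κ ^ (-valDet g)) (stdAlcove κ 0) =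
      actAlcove g (stdAlcove κ 0) := by
    rw [actAlcove_mul, actAlcove_bOne_zpow]
  rw [← h1]
  generalize g * bOne κ ^ (-valDet g) = g' at h0
  obtain ⟨u, hu⟩ := valDet_eq_zero_iff.mp h0
  have huu : algebraMap (PS κ) (LS κ) u * algebraMap (PS κ) (LS κ) (u⁻¹ : (PS κ)ˣ) = 1 := by
    rw [← map_mul, Units.mul_inv, map_one]
  let d : GL (Fin 2) (LS κ) := Matrix.GeneralLinearGroup.mkOfDetNeZero
    !![1, 0; 0, algebraMap (PS κ) (LS κ) (u⁻¹ : (PS κ)ˣ)]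
    (by rw [Matrix.det_fin_two_of]; simpa using right_ne_zero_of_mul_eq_one huu)
  have hd : d ∈ iwahori κ := ⟨⟨1, by simp [d]⟩, ⟨0, by simp [d]⟩, ⟨0, by simp [d]⟩, ⟨u⁻¹, rfl⟩⟩
  have hdet : (g' * d).1.det = 1 := by
    rw [Units.val_mul, Matrix.det_mul, hu]
    change _ * Matrix.det !![1, 0; 0, algebraMap (PS κ) (LS κ) (u⁻¹ : (PS κ)ˣ)] = 1
    rw [Matrix.det_fin_two_of, one_mul, mul_zero, sub_zero, huu]
  refine ⟨⟨(g' * d).1, hdet⟩, ?_⟩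
  have : Matrix.SpecialLinearGroup.toGL ⟨(g' * d).1, hdet⟩ = g' * d := Units.ext rfl
  rw [this, actAlcove_mul, iwahori_fix_alcove hd]

theorem alcoveOf_mk (x : Matrix.SpecialLinearGroup (Fin 2) (LS κ)) :
    alcoveOf (x : Matrix.SpecialLinearGroup (Fin 2) (LS κ) ⧸ iwahoriSL κ) =
      actAlcove (Matrix.SpecialLinearGroup.toGL x) (stdAlcove κ 0) := rfl

theorem alcoveOf_injective : Function.Injective (alcoveOf (κ := κ)) := by
  intro c c'
  induction c using QuotientGroup.induction_on with
  | H x =>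
    induction c' using QuotientGroup.induction_on with
    | H y =>
      rw [alcoveOf_mk, alcoveOf_mk]
      intro h
      refine QuotientGroup.eq.mpr ?_
      refine mem_iwahori_of_actAlcove (valDet_toGL _) ?_
      rw [map_mul, actAlcove_mul, ← h, ← actAlcove_mul, ← map_mul, inv_mul_cancel, map_one,
        actAlcove_one]

theorem exists_alcoveOf_eq {D : Sym2 (Vertex κ)} (hD : D ∈ (building κ).edgeSet) :
    ∃ x : Matrix.SpecialLinearGroup (Fin 2) (LS κ),
      D = actAlcove (Matrix.SpecialLinearGroup.toGL x) (stdAlcove κ 0) := by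
  induction D using Sym2.ind with
  | h v w =>
    obtain ⟨g, rfl, rfl⟩ := exists_eq_act_of_adj hD
    obtain ⟨x, hx⟩ := exists_toGL_actAlcove g
    exact ⟨x, by rw [hx, actAlcove_std, zero_add, Sym2.eq_swap]⟩

theorem alcoveOf_bijOn : Set.BijOn (alcoveOf (κ := κ)) Set.univ (building κ).edgeSet := by
  refine ⟨fun c _ => ?_, alcoveOf_injective.injOn, fun D hD => ?_⟩
  · induction c using QuotientGroup.induction_on with
    | H x => exact actAlcove_mem_edgeSet _ (stdAlcove_mem_edgeSet 0)
  · obtain ⟨x, rfl⟩ := exists_alcoveOf_eq hD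
    exact ⟨_, trivial, alcoveOf_mk x⟩

end Types

/-! ### The affine Weyl group -/

section WeylGroup

variable {κ : Type*} [Field κ]

theorem stdAlcove_injective : Function.Injective (stdAlcove κ) := by
  intro i j h
  rw [stdAlcove, stdAlcove, Sym2.eq_iff] at h
  rcases h with ⟨h1, -⟩ | ⟨h1, h2⟩
  · have := stdVertex_injective h1
    omega
  · have := stdVertex_injective h1
    have := stdVertex_injective h2
    omega

theorem mem_torusO_of_eq {z : Matrix.SpecialLinearGroup (Fin 2) (LS κ)} (u : (PS κ)ˣ)
    (h00 : z 0 0 = algebraMap (PS κ) (LS κ) u)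
    (h11 : z 1 1 = algebraMap (PS κ) (LS κ) (u⁻¹ : (PS κ)ˣ)) (h01 : z 0 1 = 0) (h10 : z 1 0 = 0) :
    z ∈ torusO κ := by
  refine ⟨⟨!![u, 0; 0, (u⁻¹ : (PS κ)ˣ)], by simp [Matrix.det_fin_two]⟩, ⟨rfl, rfl⟩, ?_⟩
  refine Matrix.SpecialLinearGroup.ext _ _ fun i j => ?_
  fin_cases i <;> fin_cases j
  · exact h00.symm
  · exact (map_zero (algebraMap (PS κ) (LS κ))).trans h01.symm
  · exact (map_zero (algebraMap (PS κ) (LS κ))).trans h10.symm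
  · exact h11.symm

theorem SL_conj_apply (n z : Matrix.SpecialLinearGroup (Fin 2) (LS κ)) (h01 : z 0 1 = 0)
    (h10 : z 1 0 = 0) :
    (n * z * n⁻¹) 0 1 = n 0 0 * n 0 1 * (z 1 1 - z 0 0) ∧
      (n * z * n⁻¹) 1 0 = n 1 0 * n 1 1 * (z 0 0 - z 1 1) := by
  have e : ((n * z * n⁻¹ : Matrix.SpecialLinearGroup (Fin 2) (LS κ)) :
      Matrix (Fin 2) (Fin 2) (LS κ)) = n.1 * z.1 * n.1.adjugate := rfl
  constructor
  · rw [e, Matrix.adjugate_fin_two]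
    simp [Matrix.mul_apply, Fin.sum_univ_two, h01, h10]
    ring
  · rw [e, Matrix.adjugate_fin_two]
    simp [Matrix.mul_apply, Fin.sum_univ_two, h01, h10]
    ring

/-- The normalizer of the torus consists of the monomial matrices. -/
theorem mem_normTorus_iff {n : Matrix.SpecialLinearGroup (Fin 2) (LS κ)} :
    n ∈ normTorus κ ↔ (n 0 1 = 0 ∧ n 1 0 = 0) ∨ (n 0 0 = 0 ∧ n 1 1 = 0) := by
  constructor
  · intro hn
    -- `diag(t, t⁻¹)` has distinct eigenvalues
    let z : Matrix.SpecialLinearGroup (Fin 2) (LS κ) :=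
      ⟨!![unif κ, 0; 0, (unif κ)⁻¹], by simp [Matrix.det_fin_two, unif_ne_zero]⟩
    have hz : unif κ - (unif κ)⁻¹ ≠ 0 := by
      intro h
      have h' := congrArg HahnSeries.order (sub_eq_zero.mp h)
      rw [order_inv unif_ne_zero, order_unif] at h'
      omega
    obtain ⟨h1, h2⟩ := (Subgroup.mem_normalizer_iff.mp hn z).mp ⟨rfl, rfl⟩
    obtain ⟨e1, e2⟩ := SL_conj_apply n z rfl rfl
    rw [e1] at h1
    rw [e2] at h2
    have h1' : n 0 0 * n 0 1 = 0 :=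
      (mul_eq_zero.mp h1).resolve_right fun h => hz (by
        rw [← neg_sub]; exact neg_eq_zero.mpr h)
    have h2' : n 1 0 * n 1 1 = 0 := (mul_eq_zero.mp h2).resolve_right hz
    have hdet := n.det_coe
    rw [Matrix.det_fin_two] at hdet
    rcases mul_eq_zero.mp h1' with h | h <;> rcases mul_eq_zero.mp h2' with h' | h' <;>
      simp_all
  · intro hn
    have key : ∀ m : Matrix.SpecialLinearGroup (Fin 2) (LS κ),
        (m 0 1 = 0 ∧ m 1 0 = 0) ∨ (m 0 0 = 0 ∧ m 1 1 = 0) →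
        ∀ z ∈ torus (LS κ), m * z * m⁻¹ ∈ torus (LS κ) := by
      rintro m hm z ⟨h01, h10⟩
      obtain ⟨e1, e2⟩ := SL_conj_apply m z h01 h10
      refine ⟨e1.trans ?_, e2.trans ?_⟩ <;> rcases hm with ⟨h, h'⟩ | ⟨h, h'⟩ <;> simp [h, h']
    refine Subgroup.mem_normalizer_iff.mpr fun z => ⟨key n hn z, fun hz => ?_⟩
    have hn' : (n⁻¹ 0 1 = 0 ∧ n⁻¹ 1 0 = 0) ∨ (n⁻¹ 0 0 = 0 ∧ n⁻¹ 1 1 = 0) := by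
      have e : (n⁻¹).1 = n.1.adjugate := rfl
      change ((n⁻¹).1 0 1 = 0 ∧ (n⁻¹).1 1 0 = 0) ∨ ((n⁻¹).1 0 0 = 0 ∧ (n⁻¹).1 1 1 = 0)
      rw [e, Matrix.adjugate_fin_two]
      simpa [and_comm] using hn
    have := key n⁻¹ hn' _ hz
    rwa [inv_inv, ← mul_assoc, inv_mul_cancel_left, inv_mul_cancel_right] at this

variable (κ) in
/-- The translation `P_i ↦ P_{i+2a}` of the standard apartment. -/
noncomputable def transN (a : ℤ) : normTorus κ :=
  ⟨⟨!![unif κ ^ (-a), 0; 0, unif κ ^ a], by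
    rw [Matrix.det_fin_two_of, ← zpow_add₀ unif_ne_zero]; simp⟩,
    mem_normTorus_iff.mpr (Or.inl ⟨rfl, rfl⟩)⟩

variable (κ) in
/-- The reflection `P_i ↦ P_{2a-i}` of the standard apartment. -/
noncomputable def reflN (a : ℤ) : normTorus κ :=
  ⟨⟨!![0, unif κ ^ (-a); -unif κ ^ a, 0], by
    rw [Matrix.det_fin_two_of, mul_neg, ← zpow_add₀ unif_ne_zero]; simp⟩,
    mem_normTorus_iff.mpr (Or.inr ⟨rfl, rfl⟩)⟩

theorem actVertex_transN (a i : ℤ) :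
    actVertex (Matrix.SpecialLinearGroup.toGL (transN κ a).1) (stdVertex κ i) =
      stdVertex κ (i + 2 * a) := by
  refine (actVertex_std_eq_iff _ _ _).mpr ⟨unif κ ^ a, unif_zpow_ne_zero _, fun v => ?_⟩
  have e : unif κ ^ a • ((Matrix.SpecialLinearGroup.toGL (transN κ a).1).1 *ᵥ v) =
      ![v 0, unif κ ^ (2 * a) * v 1] := by
    change unif κ ^ a • (!![unif κ ^ (-a), 0; 0, unif κ ^ a] *ᵥ v) = _
    funext j
    fin_cases j
    · simp [dotProduct, mul_inv_cancel_left₀ (unif_zpow_ne_zero a)]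
    · simp [dotProduct, two_mul, zpow_add₀ unif_ne_zero, mul_assoc]
  rw [e, mem_stdSubmodule, mem_stdSubmodule, add_comm i,
    ← zpow_mul_mem_fracIdeal (n := 2 * a) (m := i)]
  rfl

theorem actVertex_reflN (a i : ℤ) :
    actVertex (Matrix.SpecialLinearGroup.toGL (reflN κ a).1) (stdVertex κ i) =
      stdVertex κ (2 * a - i) := by
  refine (actVertex_std_eq_iff _ _ _).mpr ⟨unif κ ^ (a - i), unif_zpow_ne_zero _, fun v => ?_⟩
  have e : unif κ ^ (a - i) • ((Matrix.SpecialLinearGroup.toGL (reflN κ a).1).1 *ᵥ v) =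
      ![unif κ ^ (-i) * v 1, -(unif κ ^ (2 * a - i) * v 0)] := by
    change unif κ ^ (a - i) • (!![0, unif κ ^ (-a); -unif κ ^ a, 0] *ᵥ v) = _
    have e1 : unif κ ^ (-i) = unif κ ^ (a - i) * unif κ ^ (-a) := by
      rw [← zpow_add₀ unif_ne_zero]; congr 1; ring
    have e2 : unif κ ^ (2 * a - i) = unif κ ^ (a - i) * unif κ ^ a := by
      rw [← zpow_add₀ unif_ne_zero]; congr 1; ring
    rw [e1, e2]
    funext j
    fin_cases j
    · simp [dotProduct, mul_assoc]
    · simp [dotProduct, mul_assoc]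
  rw [e, mem_stdSubmodule, mem_stdSubmodule, and_comm, ← zpow_mul_mem_fracIdeal (n := -i) (m := i),
    ← zpow_mul_mem_fracIdeal (n := 2 * a - i) (m := 0), neg_add_cancel, add_zero]
  refine and_congr_right fun _ => ?_
  exact (Submodule.neg_mem_iff _).symm

theorem actAlcove_transN (a i : ℤ) :
    actAlcove (Matrix.SpecialLinearGroup.toGL (transN κ a).1) (stdAlcove κ i) =
      stdAlcove κ (i + 2 * a) := by
  rw [actAlcove_std, actVertex_transN, actVertex_transN, stdAlcove, add_right_comm]

theorem actAlcove_reflN (a i : ℤ) :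
    actAlcove (Matrix.SpecialLinearGroup.toGL (reflN κ a).1) (stdAlcove κ i) =
      stdAlcove κ (2 * a - 1 - i) := by
  rw [actAlcove_std, actVertex_reflN, actVertex_reflN, stdAlcove,
    show 2 * a - 1 - i + 1 = 2 * a - i by ring, show 2 * a - (i + 1) = 2 * a - 1 - i by ring]
  exact Sym2.eq_swap

theorem weylAlcove_mk (n : normTorus κ) : weylAlcove (n : Weyl κ) =
    actAlcove (Matrix.SpecialLinearGroup.toGL n.1) (stdAlcove κ 0) := rfl

theorem weylAlcove_mul (n : normTorus κ) (w : Weyl κ) : weylAlcove ((n : Weyl κ) * w) =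
    actAlcove (Matrix.SpecialLinearGroup.toGL n.1) (weylAlcove w) := by
  induction w using QuotientGroup.induction_on with
  | H m =>
    rw [← QuotientGroup.mk_mul, weylAlcove_mk, weylAlcove_mk, ← actAlcove_mul]
    rfl

theorem weylAlcove_one : weylAlcove (1 : Weyl κ) = stdAlcove κ 0 := by
  rw [← QuotientGroup.mk_one, weylAlcove_mk, OneMemClass.coe_one, map_one, actAlcove_one]

theorem Weyl.eq_transN_or_reflN (w : Weyl κ) :
    (∃ a, w = (transN κ a : Weyl κ)) ∨ ∃ a, w = (reflN κ a : Weyl κ) := by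
  induction w using QuotientGroup.induction_on with
  | H n =>
    have e : ∀ m : normTorus κ, (m⁻¹ * n).1.1 = m.1.1.adjugate * n.1.1 := fun m => rfl
    have hdet := n.1.det_coe
    rw [Matrix.det_fin_two] at hdet
    rcases mem_normTorus_iff.mp n.2 with ⟨h1, h2⟩ | ⟨h1, h2⟩
    · left
      have hprod : n.1 0 0 * n.1 1 1 = 1 := by simpa [h1, h2] using hdet
      have h0 := left_ne_zero_of_mul_eq_one hprod
      obtain ⟨u, hu⟩ := exists_unit_mul_zpow h0
      have huu : algebraMap (PS κ) (LS κ) u * algebraMap (PS κ) (LS κ) (u⁻¹ : (PS κ)ˣ) = 1 := by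
        rw [← map_mul, Units.mul_inv, map_one]
      generalize (n.1 0 0).order = j at hu
      have htt : unif κ ^ (-j) * unif κ ^ j = 1 := by
        rw [← zpow_add₀ unif_ne_zero, neg_add_cancel, zpow_zero]
      refine ⟨-j, (QuotientGroup.eq.mpr (Subgroup.mem_subgroupOf.mpr ?_)).symm⟩
      have ea : (transN κ (-j)).1.1.adjugate = !![unif κ ^ (-j), 0; 0, unif κ ^ j] := by
        change (!![unif κ ^ (- -j), 0; 0, unif κ ^ (-j)] : Matrix _ _ (LS κ)).adjugate = _
        rw [Matrix.adjugate_fin_two_of, neg_neg, neg_zero]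
      have hmul : ((transN κ (-j))⁻¹ * n).1.1 =
          !![unif κ ^ (-j), 0; 0, unif κ ^ j] * n.1.1 := by rw [e, ea]
      refine mem_torusO_of_eq u ?_ ?_ ?_ ?_
      · change ((transN κ (-j))⁻¹ * n).1.1 0 0 = _
        rw [hmul]
        simp only [Matrix.mul_apply, Fin.sum_univ_two, Matrix.of_apply, Matrix.cons_val_zero,
          Matrix.cons_val_one, zero_mul, add_zero]
        rw [show n.1.1 0 0 = _ from hu]
        linear_combination (algebraMap (PS κ) (LS κ) u) * htt
      · change ((transN κ (-j))⁻¹ * n).1.1 1 1 = _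
        rw [hmul]
        simp only [Matrix.mul_apply, Fin.sum_univ_two, Matrix.of_apply, Matrix.cons_val_zero,
          Matrix.cons_val_one, zero_mul, zero_add]
        refine mul_left_cancel₀ h0 ?_
        have h11 : n.1 0 0 * n.1.1 1 1 = 1 := hprod
        rw [mul_left_comm, h11, hu]
        linear_combination -(unif κ ^ j) * huu
      · change ((transN κ (-j))⁻¹ * n).1.1 0 1 = _
        rw [hmul]
        simp [Matrix.mul_apply, Fin.sum_univ_two, h1]
      · change ((transN κ (-j))⁻¹ * n).1.1 1 0 = _
        rw [hmul]
        simp [Matrix.mul_apply, Fin.sum_univ_two, h2]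
    · right
      have hprod : n.1 0 1 * n.1 1 0 = -1 := by
        have h1' : n.1.1 0 0 = 0 := h1
        have : -(n.1 0 1 * n.1 1 0) = 1 := by simpa [h1'] using hdet
        linear_combination -this
      have h0 : n.1 0 1 ≠ 0 := by
        intro h
        simp [h] at hprod
      obtain ⟨u, hu⟩ := exists_unit_mul_zpow h0
      have huu : algebraMap (PS κ) (LS κ) u * algebraMap (PS κ) (LS κ) (u⁻¹ : (PS κ)ˣ) = 1 := by
        rw [← map_mul, Units.mul_inv, map_one]
      generalize (n.1 0 1).order = j at hu
      have htt : unif κ ^ (-j) * unif κ ^ j = 1 := by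
        rw [← zpow_add₀ unif_ne_zero, neg_add_cancel, zpow_zero]
      refine ⟨-j, (QuotientGroup.eq.mpr (Subgroup.mem_subgroupOf.mpr ?_)).symm⟩
      have ea : (reflN κ (-j)).1.1.adjugate = !![0, -unif κ ^ j; unif κ ^ (-j), 0] := by
        change (!![0, unif κ ^ (- -j); -unif κ ^ (-j), 0] : Matrix _ _ (LS κ)).adjugate = _
        rw [Matrix.adjugate_fin_two_of, neg_neg, neg_neg]
      have hmul : ((reflN κ (-j))⁻¹ * n).1.1 =
          !![0, -unif κ ^ j; unif κ ^ (-j), 0] * n.1.1 := by rw [e, ea]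
      refine mem_torusO_of_eq u⁻¹ ?_ ?_ ?_ ?_
      · change ((reflN κ (-j))⁻¹ * n).1.1 0 0 = _
        rw [hmul]
        simp only [Matrix.mul_apply, Fin.sum_univ_two, Matrix.of_apply, Matrix.cons_val_zero,
          Matrix.cons_val_one, zero_mul, zero_add]
        refine mul_left_cancel₀ h0 ?_
        have h10 : n.1 0 1 * n.1.1 1 0 = -1 := hprod
        rw [mul_left_comm, h10, hu]
        linear_combination -(unif κ ^ j) * huu
      · change ((reflN κ (-j))⁻¹ * n).1.1 1 1 = _
        rw [hmul, inv_inv]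
        simp only [Matrix.mul_apply, Fin.sum_univ_two, Matrix.of_apply, Matrix.cons_val_zero,
          Matrix.cons_val_one, zero_mul, add_zero]
        rw [show n.1.1 0 1 = _ from hu]
        linear_combination (algebraMap (PS κ) (LS κ) u) * htt
      · change ((reflN κ (-j))⁻¹ * n).1.1 0 1 = _
        rw [hmul]
        simp [Matrix.mul_apply, Fin.sum_univ_two, h2]
      · change ((reflN κ (-j))⁻¹ * n).1.1 1 0 = _
        rw [hmul]
        simp [Matrix.mul_apply, Fin.sum_univ_two, h1]

theorem weylAlcove_transN (a : ℤ) : weylAlcove (transN κ a : Weyl κ) = stdAlcove κ (2 * a) := by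
  rw [weylAlcove_mk, actAlcove_transN, zero_add]

theorem weylAlcove_reflN (a : ℤ) :
    weylAlcove (reflN κ a : Weyl κ) = stdAlcove κ (2 * a - 1) := by
  rw [weylAlcove_mk, actAlcove_reflN, sub_zero]

theorem exists_weylAlcove_eq (w : Weyl κ) : ∃ j, weylAlcove w = stdAlcove κ j := by
  rcases w.eq_transN_or_reflN with ⟨a, rfl⟩ | ⟨a, rfl⟩
  · exact ⟨_, weylAlcove_transN a⟩
  · exact ⟨_, weylAlcove_reflN a⟩

theorem exists_weyl_eq (j : ℤ) : ∃ w : Weyl κ, weylAlcove w = stdAlcove κ j := by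
  rcases Int.even_or_odd' j with ⟨a, rfl | rfl⟩
  · exact ⟨_, weylAlcove_transN a⟩
  · refine ⟨_, (weylAlcove_reflN (a + 1)).trans ?_⟩
    congr 1
    ring

/-- The affine Weyl group acts simply transitively on the alcoves of the standard apartment. -/
theorem weylAlcove_injective : Function.Injective (weylAlcove (κ := κ)) := by
  intro w w' h
  rcases w.eq_transN_or_reflN with ⟨a, rfl⟩ | ⟨a, rfl⟩ <;>
    rcases w'.eq_transN_or_reflN with ⟨b, rfl⟩ | ⟨b, rfl⟩ <;>
    simp only [weylAlcove_transN, weylAlcove_reflN] at h <;>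
    have := stdAlcove_injective h
  · rw [show a = b by omega]
  · omega
  · omega
  · rw [show a = b by omega]

theorem weyl_eq_one_iff {w : Weyl κ} {j : ℤ} (hw : weylAlcove w = stdAlcove κ j) :
    w = 1 ↔ j = 0 := by
  rw [← weylAlcove_injective.eq_iff, hw, weylAlcove_one, stdAlcove_injective.eq_iff]

theorem mem_simpleReflections_iff {s : Weyl κ} :
    s ∈ simpleReflections ↔ s = (reflN κ 0 : Weyl κ) ∨ s = (reflN κ 1 : Weyl κ) := by
  have e0 : (reflN κ 0).1.1 = !![0, 1; -1, 0] := by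
    change !![0, unif κ ^ (-0 : ℤ); -unif κ ^ (0 : ℤ), 0] = _
    simp
  have e1 : (reflN κ 1).1.1 = !![0, (unif κ)⁻¹; -unif κ, 0] := by
    change !![0, unif κ ^ (-1 : ℤ); -unif κ ^ (1 : ℤ), 0] = _
    simp
  constructor
  · rintro ⟨n, rfl, h | h⟩
    · exact Or.inl (congrArg _ (Subtype.ext (Subtype.ext (h.trans e0.symm))))
    · exact Or.inr (congrArg _ (Subtype.ext (Subtype.ext (h.trans e1.symm))))
  · rintro (rfl | rfl)
    · exact ⟨_, rfl, Or.inl e0⟩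
    · exact ⟨_, rfl, Or.inr e1⟩

/-- A simple reflection changes the index of an alcove of the standard apartment by at most one in
absolute value. -/
theorem exists_weylAlcove_prod (l : List (Weyl κ)) (hl : ∀ s ∈ l, s ∈ simpleReflections) :
    ∃ j : ℤ, j.natAbs ≤ l.length ∧ weylAlcove l.prod = stdAlcove κ j := by
  induction l with
  | nil => exact ⟨0, by simp, by rw [List.prod_nil, weylAlcove_one]⟩
  | cons s l ih =>
    obtain ⟨j, hj, hw⟩ := ih fun s hs => hl s (List.mem_cons_of_mem _ hs)
    rw [List.prod_cons, List.length_cons]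
    rcases mem_simpleReflections_iff.mp (hl s List.mem_cons_self) with rfl | rfl
    · exact ⟨2 * 0 - 1 - j, by omega, by rw [weylAlcove_mul, hw, actAlcove_reflN]⟩
    · exact ⟨2 * 1 - 1 - j, by omega, by rw [weylAlcove_mul, hw, actAlcove_reflN]⟩

theorem exists_list_prod (n : ℕ) : ∀ (w : Weyl κ) (j : ℤ), weylAlcove w = stdAlcove κ j →
    j.natAbs = n → ∃ l : List (Weyl κ), l.length = n ∧ (∀ s ∈ l, s ∈ simpleReflections) ∧
      l.prod = w := by
  induction n with
  | zero =>
    intro w j hw hj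
    refine ⟨[], rfl, by simp, ?_⟩
    rw [List.prod_nil, eq_comm, weyl_eq_one_iff hw]
    omega
  | succ n ih =>
    intro w j hw hj
    -- multiplication by a suitable simple reflection moves the alcove closer to `C^0`
    have step : ∀ a : ℤ, (reflN κ a : Weyl κ) ∈ simpleReflections →
        (2 * a - 1 - j).natAbs = n → ∃ l : List (Weyl κ), l.length = n + 1 ∧
          (∀ s ∈ l, s ∈ simpleReflections) ∧ l.prod = w := by
      intro a ha hn
      obtain ⟨l, hl, hs, hp⟩ := ih ((reflN κ a : Weyl κ) * w) (2 * a - 1 - j)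
        (by rw [weylAlcove_mul, hw, actAlcove_reflN]) hn
      refine ⟨(reflN κ a : Weyl κ) :: l, by rw [List.length_cons, hl], ?_, ?_⟩
      · intro s hs'
        rcases List.mem_cons.mp hs' with rfl | h
        · exact ha
        · exact hs s h
      · refine weylAlcove_injective ?_
        rw [List.prod_cons, hp, weylAlcove_mul, weylAlcove_mul, hw, actAlcove_reflN,
          actAlcove_reflN]
        congr 1
        ring
    rcases lt_or_ge 0 j with h | h
    · exact step 1 (mem_simpleReflections_iff.mpr (Or.inr rfl)) (by omega)
    · exact step 0 (mem_simpleReflections_iff.mpr (Or.inl rfl)) (by omega)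

/-- The length of `w` is the distance between the alcoves `C^0` and `w C^0`. -/
theorem weylLength_eq {w : Weyl κ} {j : ℤ} (hw : weylAlcove w = stdAlcove κ j) :
    weylLength w = j.natAbs := by
  refine le_antisymm (Nat.sInf_le (exists_list_prod _ w j hw rfl)) ?_
  refine le_csInf ⟨_, exists_list_prod _ w j hw rfl⟩ ?_
  rintro n ⟨l, rfl, hs, rfl⟩
  obtain ⟨i, hi, h⟩ := exists_weylAlcove_prod l hs
  rw [hw] at h
  rwa [stdAlcove_injective h]

end WeylGroup

/-! ### Exit paths and galleries in a tree -/

section Graph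

open SimpleGraph

variable {V : Type*} {G : SimpleGraph V}

/-- A set of vertices is walk-connected if any two of its elements are joined by a walk in it. -/
def WalkConnected (G : SimpleGraph V) (S : Set V) : Prop :=
  ∀ P ∈ S, ∀ P' ∈ S, ∃ r : G.Walk P P', ∀ z ∈ r.support, z ∈ S

/-- A nontrivial path which meets the set `S` in its last vertex only. -/
structure IsExitPath (S : Set V) {v P : V} (q : G.Walk v P) : Prop where
  isPath : q.IsPath
  mem : P ∈ S
  eq_of_mem : ∀ z ∈ q.support, z ∈ S → z = P
  not_nil : ¬q.Nil

theorem IsExitPath.penultimate_notMem {S : Set V} {v P : V} {q : G.Walk v P}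
    (hq : IsExitPath S q) : q.penultimate ∉ S := fun h =>
  (Walk.adj_penultimate hq.not_nil).ne (hq.eq_of_mem _ (q.getVert_mem_support _) h)

theorem isPath_append (hG : G.IsAcyclic) {u v w : V} {A : G.Walk u v} {B : G.Walk v w}
    (hA : A.IsPath) (hB : B.IsPath) (h : ¬A.Nil → ¬B.Nil → A.penultimate ≠ B.snd) :
    (A.append B).IsPath := by
  rw [hG.isPath_iff_isChain, Walk.edges_append, List.isChain_append]
  refine ⟨(hG.isPath_iff_isChain A).mp hA, (hG.isPath_iff_isChain B).mp hB, ?_⟩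
  intro x hx y hy
  obtain ⟨hx0, rfl⟩ := List.mem_getLast?_eq_getLast hx
  have hy0 : B.edges ≠ [] := List.ne_nil_of_mem (List.mem_of_mem_head? hy)
  have hy' : B.edges.head hy0 = y := by
    rw [List.head?_eq_some_head hy0] at hy
    simpa using hy
  have hAn : ¬A.Nil := fun hn => hx0 (Walk.edges_eq_nil.mpr hn)
  have hBn : ¬B.Nil := fun hn => hy0 (Walk.edges_eq_nil.mpr hn)
  rw [← hy', Walk.getLast_edges_eq_mk_penultimate_end, Walk.head_edges_eq_mk_start_snd]
  intro he
  rcases Sym2.eq_iff.mp he with ⟨h1, -⟩ | ⟨h1, -⟩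
  · exact (Walk.adj_penultimate hAn).ne h1
  · exact h hAn hBn h1

theorem snd_append {u v w : V} {A : G.Walk u v} (B : G.Walk v w) (hA : ¬A.Nil) :
    (A.append B).snd = A.snd := by
  cases A with
  | nil => exact absurd Walk.Nil.nil hA
  | cons h p => simp

theorem isPath_exit_append (hG : G.IsAcyclic) {S : Set V} {v P P' : V} {q : G.Walk v P}
    (hq : IsExitPath S q) {r : G.Walk P P'} (hr : r.IsPath) (hrS : ∀ z ∈ r.support, z ∈ S) :
    (q.append r).IsPath :=
  isPath_append hG hq.isPath hr fun _ _ he =>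
    hq.penultimate_notMem (he ▸ hrS _ (r.getVert_mem_support _))

/-- Two exit paths and a path inside `S` between their endpoints compose to a path, unless they
leave `S` through the same edge. -/
theorem isPath_exit_append_exit (hG : G.IsAcyclic) {S : Set V} {v v' P P' : V} {q : G.Walk v P}
    (hq : IsExitPath S q) {q' : G.Walk v' P'} (hq' : IsExitPath S q') {r : G.Walk P P'}
    (hr : r.IsPath) (hrS : ∀ z ∈ r.support, z ∈ S)
    (hne : P = P' → q.penultimate ≠ q'.penultimate) :
    (q.append (r.append q'.reverse)).IsPath := by
  refine isPath_append hG hq.isPath (isPath_append hG hr hq'.isPath.reverse ?_) ?_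
  · intro _ _ he
    rw [Walk.snd_reverse] at he
    exact hq'.penultimate_notMem (he ▸ hrS _ (r.getVert_mem_support _))
  · intro _ _ he
    cases r with
    | nil =>
      rw [Walk.nil_append, Walk.snd_reverse] at he
      exact hne rfl he
    | cons h p =>
      rw [snd_append _ (by simp)] at he
      exact hq.penultimate_notMem (he ▸ hrS _ (Walk.getVert_mem_support _ _))

theorem WalkConnected.exists_path {S : Set V} (hS : WalkConnected G S) {P P' : V} (hP : P ∈ S)
    (hP' : P' ∈ S) : ∃ r : G.Walk P P', r.IsPath ∧ ∀ z ∈ r.support, z ∈ S := by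
  classical
  obtain ⟨r, hr⟩ := hS P hP P' hP'
  exact ⟨r.bypass, r.bypass_isPath, fun z hz => hr z (r.support_bypass_subset_support hz)⟩

/-- The endpoint of an exit path is the unique element of `S` which is closest to its start. -/
theorem IsExitPath.length_le (hG : G.IsAcyclic) {S : Set V} (hS : WalkConnected G S) {v P P' : V}
    {q : G.Walk v P} (hq : IsExitPath S q) (hP' : P' ∈ S) (p : G.Walk v P') :
    q.length ≤ p.length ∧ (p.length ≤ q.length → P = P') := by
  classical
  obtain ⟨r, hr, hrS⟩ := hS.exists_path hq.mem hP'
  have hu := (hG.subsingleton_path _ _).elim ⟨_, isPath_exit_append hG hq hr hrS⟩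
    ⟨_, p.bypass_isPath⟩
  have hlen := congrArg (fun p : G.Path v P' => p.1.length) hu
  simp only [Walk.length_append] at hlen
  have hb := p.length_bypass_le_length
  refine ⟨by omega, fun h => ?_⟩
  exact Walk.eq_of_length_eq_zero (p := r) (by omega)

theorem Gallery.exists_walk {l : ℕ} (Γ : Gallery G l) :
    ∀ (i : ℕ) (hi : i < l + 1) (P : V), P ∈ Γ.alcove ⟨i, hi⟩ →
      ∃ u ∈ Γ.alcove 0, ∃ p : G.Walk u P, p.length ≤ i := by
  intro i
  induction i with
  | zero => exact fun hi P hP => ⟨P, hP, Walk.nil, le_rfl⟩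
  | succ i ih =>
    intro hi P hP
    obtain ⟨v, hv, hv'⟩ := Γ.adjacent ⟨i, by omega⟩
    obtain ⟨u, hu, p, hp⟩ := ih (by omega) v hv
    have hedge := Γ.mem ⟨i + 1, hi⟩
    change v ∈ Γ.alcove ⟨i + 1, hi⟩ at hv'
    by_cases hvP : v = P
    · subst hvP
      exact ⟨u, hu, p, by omega⟩
    · rw [(Sym2.mem_and_mem_iff hvP).mp ⟨hv', hP⟩] at hedge
      have hadj : G.Adj v P := hedge
      exact ⟨u, hu, p.concat hadj, by rw [Walk.length_concat]; omega⟩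

theorem exists_gallery {D : Sym2 V} (hD : D ∈ G.edgeSet) {u P : V} (hu : u ∈ D) (p : G.Walk u P) :
    ∃ Γ : Gallery G p.length, Γ.Joins D P := by
  refine ⟨⟨fun i => if (i : ℕ) = 0 then D else s(p.getVert (i - 1), p.getVert i), ?_, ?_⟩, ?_⟩
  · intro i
    split_ifs with h
    · exact hD
    · have := p.adj_getVert_succ (i := i - 1) (by omega)
      rwa [Nat.sub_add_cancel (by omega)] at this
  · intro i
    refine ⟨p.getVert i, ?_, ?_⟩
    · dsimp only [Fin.val_castSucc]
      split_ifs with h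
      · rwa [h, Walk.getVert_zero]
      · simp
    · simp
  · refine ⟨by simp, Fin.last _, ?_⟩
    dsimp only [Fin.val_last]
    split_ifs with h
    · rwa [← Walk.eq_of_length_eq_zero h]
    · simp

theorem exists_exitPath_of_mem_departing {S : G.Subgraph}
    (hfull : ∀ a ∈ S.verts, ∀ b ∈ S.verts, G.Adj a b → S.Adj a b) {P : V} {n : ℕ} {D : Sym2 V}
    (hD : D ∈ departing S P n) :
    ∃ v, ∃ q : G.Walk v P, IsExitPath S.verts q ∧ D = s(v, q.snd) ∧ q.length = n := by
  classical
  obtain ⟨hDG, hDS, hP, l, Γ, ⟨rfl, ⟨i, hi⟩, hPi⟩, hn, hmin⟩ := hD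
  obtain ⟨u, hu, p, hp⟩ := Γ.exists_walk i hi P hPi
  have hmin' : ∀ u' ∈ Γ.alcove 0, ∀ P' ∈ S.verts, ∀ p' : G.Walk u' P', l ≤ p'.length := by
    intro u' hu' P' hP' p'
    obtain ⟨Γ', hΓ'⟩ := exists_gallery hDG hu' p'
    exact hmin _ Γ' P' hP' hΓ'
  have hlen := hmin' u hu P hP p.bypass
  have hlen' := p.length_bypass_le_length
  have hpath := p.bypass_isPath
  generalize p.bypass = p' at *
  obtain ⟨v, hv⟩ := Sym2.mem_iff_exists.mp hu
  rw [hv] at hDG hDS hmin'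
  have hadj : G.Adj v u := hDG.symm
  have hvp : v ∉ p'.support := by
    intro hvp
    have h1 := hmin' v (by simp) P hP (p'.dropUntil v hvp)
    have h2 := congrArg Walk.length (p'.take_spec hvp)
    rw [Walk.length_append] at h2
    have h3 : (p'.takeUntil v hvp).length ≠ 0 := fun h =>
      hadj.ne (Walk.eq_of_length_eq_zero h).symm
    omega
  refine ⟨v, Walk.cons hadj p', ⟨?_, hP, ?_, by simp⟩, ?_, ?_⟩
  · exact (Walk.cons_isPath_iff hadj p').mpr ⟨hpath, hvp⟩
  · intro z hz hzS
    rcases List.mem_cons.mp (by simpa using hz) with rfl | hz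
    · exfalso
      have h1 := hmin' z (by simp) z hzS Walk.nil
      rw [Walk.length_nil] at h1
      have h2 : u = P := Walk.eq_of_length_eq_zero (p := p') (by omega)
      subst h2
      exact hDS (hfull _ hP _ hzS hadj.symm)
    · have h1 := hmin' u (by simp) z hzS (p'.takeUntil z hz)
      have h2 := congrArg Walk.length (p'.take_spec hz)
      rw [Walk.length_append] at h2
      exact Walk.eq_of_length_eq_zero (p := p'.dropUntil z hz) (by omega)
  · rw [hv, Walk.snd_cons, Sym2.eq_swap]
  · rw [Walk.length_cons]
    omega

theorem exists_mem_departing (hG : G.Connected) {S : G.Subgraph} (hS : S.verts.Nonempty)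
    {D : Sym2 V} (hD : D ∈ G.edgeSet) (hDS : D ∉ S.edgeSet) :
    ∃ P ∈ S.verts, ∃ n, 0 < n ∧ D ∈ departing S P n := by
  classical
  have hex : ∃ l, ∃ Γ : Gallery G l, ∃ P ∈ S.verts, Γ.Joins D P := by
    obtain ⟨P, hP⟩ := hS
    obtain ⟨u, hu⟩ : ∃ u, u ∈ D := ⟨_, D.out_fst_mem⟩
    obtain ⟨p⟩ := hG.preconnected u P
    obtain ⟨Γ, hΓ⟩ := exists_gallery hD hu p
    exact ⟨_, Γ, P, hP, hΓ⟩
  obtain ⟨Γ, P, hP, hΓ⟩ := Nat.find_spec hex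
  exact ⟨P, hP, 1 + Nat.find hex, by omega, hD, hDS, hP, _, Γ, hΓ, rfl,
    fun l' Γ' P' hP' hΓ' => Nat.find_min' hex ⟨Γ', P', hP', hΓ'⟩⟩

/-- In a tree the alcoves which are not in a connected full subcomplex have a unique vertex of
departure. -/
theorem departing_unique (hG : G.IsAcyclic) {S : G.Subgraph}
    (hfull : ∀ a ∈ S.verts, ∀ b ∈ S.verts, G.Adj a b → S.Adj a b)
    (hS : WalkConnected G S.verts) {P P' : V} {n : ℕ} {D : Sym2 V}
    (hD : D ∈ departing S P n) (hD' : D ∈ departing S P' n) : P = P' := by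
  obtain ⟨v, q, hq, h1, h2⟩ := exists_exitPath_of_mem_departing hfull hD
  obtain ⟨v', q', hq', h1', h2'⟩ := exists_exitPath_of_mem_departing hfull hD'
  rw [h1, Sym2.eq_iff] at h1'
  rcases h1' with ⟨rfl, -⟩ | ⟨h, -⟩
  · exact (hq.length_le hG hS hq'.mem q').2 (by omega)
  · exfalso
    have h3 := (hq.length_le hG hS hq'.mem (q'.tail.copy h.symm rfl)).1
    have h4 := Walk.length_tail_add_one hq'.not_nil
    rw [Walk.length_copy] at h3
    omega

end Graph

/-! ### Base change and the Frobenius -/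

section BaseChangeCoordinates

variable (k K : Type*) [Field k] [Field K] [Algebra k K]

theorem incl_unif : incl k K (unif k) = unif K := by
  rw [unif, incl_ps, PowerSeries.map_X, unif]

variable {k}

theorem incl_mem_fracIdeal_iff {n : ℤ} {y : LS k} :
    incl k K y ∈ fracIdeal K n ↔ y ∈ fracIdeal k n := by
  rw [mem_fracIdeal_iff_coeff, mem_fracIdeal_iff_coeff]
  refine forall₂_congr fun m _ => ?_
  rw [incl, mapLS_coeff, map_eq_zero]

theorem extendVertex_act (g : GL (Fin 2) (LS k)) (v : Vertex k) :
    extendVertex K (actVertex g v) =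
      actVertex (Matrix.GeneralLinearGroup.map (incl k K) g) (extendVertex K v) := by
  induction v using Quotient.inductionOn with
  | h M =>
    refine congrArg (Quotient.mk _) (Subtype.ext ?_)
    change extend K (M.1.map (linAct g.1)) = (extend K M.1).map (linAct (g.1.map (incl k K)))
    rw [extend, extend, Submodule.map_span, Submodule.map_coe, Set.image_image, Set.image_image]
    congr 2
    funext x i
    simp [inclVec, Matrix.mulVec, dotProduct]

theorem extendVertex_std (n : ℤ) : extendVertex K (stdVertex k n) = stdVertex K n := by
  refine congrArg (Quotient.mk _) (Subtype.ext ?_)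
  change extend K (stdSubmodule k n) = stdSubmodule K n
  rw [stdSubmodule, extend_span, Set.image_pair, stdSubmodule]
  congr 2
  · funext i; fin_cases i <;> simp [inclVec]
  · congr 1
    funext i; fin_cases i
    · simp [inclVec]
    · simp [inclVec, incl_unif]

theorem map_lowerUnip {κ κ' : Type*} [Field κ] [Field κ'] (f : LS κ →+* LS κ') (y : LS κ) :
    Matrix.GeneralLinearGroup.map f (lowerUnip y) = lowerUnip (f y) := by
  refine Units.ext ?_
  change (!![1, 0; y, 1] : Matrix _ _ (LS κ)).map f = !![1, 0; f y, 1]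
  ext1 i j
  fin_cases i <;> fin_cases j <;> simp

theorem extendVertex_lowerUnip_std (y : LS k) (n : ℤ) :
    extendVertex K (actVertex (lowerUnip y) (stdVertex k n)) =
      actVertex (lowerUnip (incl k K y)) (stdVertex K n) := by
  rw [extendVertex_act, extendVertex_std, map_lowerUnip]

theorem extendVertex_injective : Function.Injective (extendVertex (k := k) K) := by
  intro v w h
  obtain ⟨y, n, rfl⟩ := exists_eq_lowerUnip_std v
  obtain ⟨z, m, rfl⟩ := exists_eq_lowerUnip_std w
  rwa [extendVertex_lowerUnip_std, extendVertex_lowerUnip_std,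
    actVertex_lowerUnip_std_eq_lowerUnip_iff, ← map_sub, incl_mem_fracIdeal_iff,
    ← actVertex_lowerUnip_std_eq_lowerUnip_iff] at h

variable (k)

theorem mem_rationalBuilding_verts {v : Vertex K} :
    v ∈ (rationalBuilding k K).verts ↔ ∃ w : Vertex k, extendVertex K w = v := by
  change v ∈ extendVertex K '' Set.univ ↔ _
  rw [Set.image_univ]
  rfl

theorem rationalBuilding_walkConnected :
    WalkConnected (building K) (rationalBuilding k K).verts := by
  intro P hP P' hP'
  obtain ⟨v, rfl⟩ := (mem_rationalBuilding_verts k K).mp hP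
  obtain ⟨w, rfl⟩ := (mem_rationalBuilding_verts k K).mp hP'
  obtain ⟨p⟩ := (building_connected (κ := k)).preconnected v w
  refine ⟨p.map (extendHom K), fun z hz => ?_⟩
  have hz' : z ∈ p.support.map (extendHom K) := by
    rw [← SimpleGraph.Walk.support_map]
    exact hz
  obtain ⟨x, -, rfl⟩ := List.mem_map.mp hz'
  exact (mem_rationalBuilding_verts k K).mpr ⟨x, rfl⟩

/-- The building over `k` is a full subcomplex of the building over `K`: a path over `k` between two
vertices which become adjacent over `K` has length one, by uniqueness of paths. -/
theorem rationalBuilding_full : ∀ a ∈ (rationalBuilding k K).verts,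
    ∀ b ∈ (rationalBuilding k K).verts, (building K).Adj a b → (rationalBuilding k K).Adj a b := by
  intro a ha b hb hab
  obtain ⟨v, rfl⟩ := (mem_rationalBuilding_verts k K).mp ha
  obtain ⟨w, rfl⟩ := (mem_rationalBuilding_verts k K).mp hb
  obtain ⟨p, hp⟩ := (building_connected (κ := k)).exists_isPath v w
  have hp' : (p.map (extendHom K)).IsPath :=
    hp.map (extendVertex_injective K)
  have hq : hab.toWalk.IsPath := by simp [hab.ne]
  have h := congrArg (fun p : (building K).Path _ _ => p.1.length)
    ((building_isAcyclic.subsingleton_path _ _).elim ⟨_, hp'⟩ ⟨_, hq⟩)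
  have hlen : p.length = 1 := (SimpleGraph.Walk.length_map _ p).symm.trans h
  have hadj : (building k).Adj v w := SimpleGraph.Walk.adj_of_length_eq_one hlen
  exact ⟨v, w, hadj, rfl, rfl⟩

end BaseChangeCoordinates

section Frobenius

variable (k K : Type*) [Field k] [Fintype k] [Field K] [Algebra k K]

/-- The action of the Frobenius on the building, which is base change along the `q`-power map
`K → K`. -/
noncomputable def frobHom : building K →g building K :=
  @extendHom K K _ _ (FiniteField.frobeniusAlgHom k K : K →+* K).toAlgebra

theorem frobHom_act (g : GL (Fin 2) (LS K)) (v : Vertex K) :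
    frobHom k K (actVertex g v) =
      actVertex (Matrix.GeneralLinearGroup.map (frob k K) g) (frobHom k K v) :=
  @extendVertex_act K K _ _ (FiniteField.frobeniusAlgHom k K : K →+* K).toAlgebra g v

theorem frobHom_std (n : ℤ) : frobHom k K (stdVertex K n) = stdVertex K n :=
  @extendVertex_std K K _ _ (FiniteField.frobeniusAlgHom k K : K →+* K).toAlgebra n

theorem frobHom_injective : Function.Injective (frobHom k K) :=
  @extendVertex_injective K K _ _ (FiniteField.frobeniusAlgHom k K : K →+* K).toAlgebra

theorem frobHom_lowerUnip_std (y : LS K) (n : ℤ) :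
    frobHom k K (actVertex (lowerUnip y) (stdVertex K n)) =
      actVertex (lowerUnip (frob k K y)) (stdVertex K n) := by
  rw [frobHom_act, frobHom_std, map_lowerUnip]

theorem frob_coeff (y : LS K) (n : ℤ) :
    (frob k K y).coeff n = y.coeff n ^ Fintype.card k := rfl

theorem frob_incl (y : LS k) : frob k K (incl k K y) = incl k K y := by
  ext n
  rw [frob_coeff, incl, mapLS_coeff, ← map_pow, FiniteField.pow_card]

theorem frobHom_extendVertex (v : Vertex k) :
    frobHom k K (extendVertex K v) = extendVertex K v := by
  obtain ⟨y, n, rfl⟩ := exists_eq_lowerUnip_std v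
  rw [extendVertex_lowerUnip_std, frobHom_lowerUnip_std, frob_incl]

variable {K} in
theorem exists_algebraMap_eq_of_pow_card_eq {x : K} (hx : x ^ Fintype.card k = x) :
    ∃ a : k, algebraMap k K a = x := by
  classical
  have h1 : 1 < Fintype.card k := Fintype.one_lt_card
  have hr := FiniteField.roots_X_pow_card_sub_X k
  have hdeg := FiniteField.X_pow_card_sub_X_natDegree_eq k h1
  have hm : (Polynomial.X ^ Fintype.card k - Polynomial.X : Polynomial k).Monic :=
    Polynomial.monic_X_pow_sub (by rw [Polynomial.degree_X]; exact_mod_cast h1)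
  have hprod := Polynomial.prod_multiset_X_sub_C_of_monic_of_roots_card_eq hm
    (by rw [hr, hdeg]; rfl)
  rw [hr] at hprod
  have he := congrArg (Polynomial.aeval x) hprod
  simp only [map_multiset_prod, Multiset.map_map, map_sub, map_pow, Polynomial.aeval_X, hx,
    sub_self, Multiset.prod_eq_zero_iff, Multiset.mem_map] at he
  obtain ⟨a, -, ha⟩ := he
  refine ⟨a, ?_⟩
  rw [Function.comp_apply, map_sub, Polynomial.aeval_X, Polynomial.aeval_C] at ha
  exact (sub_eq_zero.mp ha).symm

variable {K} in
theorem exists_incl_sub_mem_fracIdeal {y : LS K} {n : ℤ} (h : frob k K y - y ∈ fracIdeal K n) :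
    ∃ z : LS k, incl k K z - y ∈ fracIdeal K n := by
  classical
  rw [mem_fracIdeal_iff_coeff] at h
  have hex : ∀ m, m < n → ∃ a : k, algebraMap k K a = y.coeff m := fun m hm =>
    exists_algebraMap_eq_of_pow_card_eq k (by
      have := h m hm
      rwa [HahnSeries.coeff_sub, frob_coeff, sub_eq_zero] at this)
  choose! f hf using hex
  refine ⟨HahnSeries.ofSuppBddBelow (fun m => if m < n then f m else 0) ⟨y.order, fun m hm => ?_⟩,
    mem_fracIdeal_iff_coeff.mpr fun m hm => ?_⟩
  · by_contra hlt
    refine hm ?_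
    dsimp only
    split_ifs with hmn
    · have := hf m hmn
      rw [HahnSeries.coeff_eq_zero_of_lt_order (not_le.mp hlt)] at this
      exact (map_eq_zero _).mp this
    · rfl
  · rw [HahnSeries.coeff_sub, incl, mapLS_coeff]
    change algebraMap k K (if m < n then f m else 0) - _ = 0
    rw [if_pos hm, hf m hm, sub_self]

/-- The vertices which are fixed by the Frobenius are the rational ones: the coordinate of such a
vertex can be truncated to a Laurent series over `k`. -/
theorem mem_rationalBuilding_verts_iff_frobHom {v : Vertex K} :
    v ∈ (rationalBuilding k K).verts ↔ frobHom k K v = v := by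
  rw [mem_rationalBuilding_verts]
  constructor
  · rintro ⟨w, rfl⟩
    exact frobHom_extendVertex k K w
  · intro h
    obtain ⟨y, n, rfl⟩ := exists_eq_lowerUnip_std v
    rw [frobHom_lowerUnip_std, actVertex_lowerUnip_std_eq_lowerUnip_iff] at h
    obtain ⟨z, hz⟩ := exists_incl_sub_mem_fracIdeal k h.2
    refine ⟨actVertex (lowerUnip z) (stdVertex k n), ?_⟩
    rw [extendVertex_lowerUnip_std, actVertex_lowerUnip_std_eq_lowerUnip_iff]
    exact ⟨rfl, hz⟩

end Frobenius

/-! ### Relative positions of alcoves -/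

section RelativePosition

variable {κ : Type*} [Field κ]

/-- The alcoves `D` and `D'` have relative position `C^j`: there is `x ∈ SL₂(κ((t)))` with
`D = x C^0` such that `x⁻¹ D'` is in the orbit of `C^j` under the Iwahori subgroup. -/
def RelPos (D D' : Sym2 (Vertex κ)) (j : ℤ) : Prop :=
  ∃ x : Matrix.SpecialLinearGroup (Fin 2) (LS κ), ∃ h ∈ iwahori κ,
    D = actAlcove (Matrix.SpecialLinearGroup.toGL x) (stdAlcove κ 0) ∧
      D' = actAlcove (Matrix.SpecialLinearGroup.toGL x * h) (stdAlcove κ j)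

theorem RelPos.mem_edgeSet {D D' : Sym2 (Vertex κ)} {j : ℤ} (h : RelPos D D' j) :
    D ∈ (building κ).edgeSet := by
  obtain ⟨x, h, -, rfl, -⟩ := h
  exact actAlcove_mem_edgeSet _ (stdAlcove_mem_edgeSet 0)

theorem relPos_self {D : Sym2 (Vertex κ)} (hD : D ∈ (building κ).edgeSet) : RelPos D D 0 := by
  obtain ⟨x, hx⟩ := exists_alcoveOf_eq hD
  exact ⟨x, 1, one_mem _, hx, by rw [mul_one, hx]⟩

theorem exists_walk_std (i : ℤ) (n : ℕ) :
    ∃ r : (building κ).Walk (stdVertex κ i) (stdVertex κ (i + n)),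
      r.support = (List.range (n + 1)).map fun j : ℕ => stdVertex κ (i + j) := by
  induction n with
  | zero =>
    refine ⟨SimpleGraph.Walk.nil.copy rfl (by simp), ?_⟩
    rw [SimpleGraph.Walk.support_copy]
    simp
  | succ n ih =>
    obtain ⟨r, hr⟩ := ih
    have hadj := adj_std (κ := κ) (i + n)
    refine ⟨(r.concat hadj).copy rfl (by push_cast; rw [add_assoc]), ?_⟩
    rw [SimpleGraph.Walk.support_copy, SimpleGraph.Walk.support_concat, hr, List.range_succ,
      List.map_append, List.range_succ, List.map_append, List.range_succ, List.map_append]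
    simp [add_assoc]

theorem exists_path_std (i : ℤ) (n : ℕ) :
    ∃ r : (building κ).Walk (stdVertex κ i) (stdVertex κ (i + n)), r.IsPath ∧ r.length = n ∧
      ∀ z, z ∈ r.support ↔ ∃ j : ℕ, j ≤ n ∧ z = stdVertex κ (i + j) := by
  obtain ⟨r, hr⟩ := exists_walk_std (κ := κ) i n
  refine ⟨r, ?_, ?_, fun z => ?_⟩
  · rw [SimpleGraph.Walk.isPath_def, hr]
    refine List.nodup_range.map fun a b hab => ?_
    have := stdVertex_injective hab
    omega
  · have := congrArg List.length hr
    rw [SimpleGraph.Walk.length_support, List.length_map, List.length_range] at this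
    omega
  · rw [hr, List.mem_map]
    simp only [List.mem_range, Nat.lt_succ_iff, eq_comm]

theorem dist_std_add (i : ℤ) (n : ℕ) :
    (building κ).dist (stdVertex κ i) (stdVertex κ (i + n)) = n := by
  classical
  obtain ⟨r, hr, hl, -⟩ := exists_path_std (κ := κ) i n
  refine le_antisymm ((SimpleGraph.dist_le r).trans hl.le) ?_
  obtain ⟨p, hp⟩ := (building_connected (κ := κ)).exists_walk_length_eq_dist
    (stdVertex κ i) (stdVertex κ (i + n))
  have h := congrArg (fun p : (building κ).Path _ _ => p.1.length)
    ((building_isAcyclic.subsingleton_path _ _).elim ⟨r, hr⟩ ⟨_, p.bypass_isPath⟩)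
  have := p.length_bypass_le_length
  dsimp only at h
  omega

theorem dist_std (i j : ℤ) :
    (building κ).dist (stdVertex κ i) (stdVertex κ j) = (j - i).natAbs := by
  rcases le_total i j with h | h
  · have := dist_std_add (κ := κ) i (j - i).natAbs
    rwa [show i + (j - i).natAbs = j by omega] at this
  · have := dist_std_add (κ := κ) j (j - i).natAbs
    rwa [show j + (j - i).natAbs = i by omega, SimpleGraph.dist_comm] at this

theorem dist_actVertex (g : GL (Fin 2) (LS κ)) (v w : Vertex κ) :
    (building κ).dist (actVertex g v) (actVertex g w) = (building κ).dist v w := by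
  have key : ∀ (g : GL (Fin 2) (LS κ)) (v w : Vertex κ),
      (building κ).dist (actVertex g v) (actVertex g w) ≤ (building κ).dist v w := by
    intro g v w
    obtain ⟨p, hp⟩ := (building_connected (κ := κ)).exists_walk_length_eq_dist v w
    rw [← hp, ← SimpleGraph.Walk.length_map (actHom g) p]
    exact SimpleGraph.dist_le _
  refine le_antisymm (key g v w) ?_
  have := key g⁻¹ (actVertex g v) (actVertex g w)
  rwa [actVertex_inv_actVertex, actVertex_inv_actVertex] at this

/-- The alcoves `C^j` are in different orbits of the Iwahori subgroup, since the distances of their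
vertices from the two vertices of `C^0` are different. -/
theorem eq_of_iwahori_act_std {h : GL (Fin 2) (LS κ)} (hh : h ∈ iwahori κ) {i j : ℤ}
    (he : actAlcove h (stdAlcove κ i) = stdAlcove κ j) : i = j := by
  have key : ∀ {a b : ℤ}, actVertex h (stdVertex κ a) = stdVertex κ b → a = b := by
    intro a b hab
    have h0 := dist_actVertex h (stdVertex κ 0) (stdVertex κ a)
    have h1 := dist_actVertex h (stdVertex κ 1) (stdVertex κ a)
    rw [iwahori_fix hh (Or.inl rfl), hab, dist_std, dist_std] at h0
    rw [iwahori_fix hh (Or.inr rfl), hab, dist_std, dist_std] at h1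
    omega
  rw [actAlcove_std, stdAlcove, Sym2.eq_iff] at he
  rcases he with ⟨h1, -⟩ | ⟨h1, h2⟩
  · have := key h1
    omega
  · have := key h1
    have := key h2
    omega

theorem RelPos.unique {D D' : Sym2 (Vertex κ)} {i j : ℤ} (h : RelPos D D' i)
    (h' : RelPos D D' j) : i = j := by
  obtain ⟨x, h, hI, hD, hD'⟩ := h
  obtain ⟨x', h', hI', h1, h2⟩ := h'
  have hx : (Matrix.SpecialLinearGroup.toGL x)⁻¹ * Matrix.SpecialLinearGroup.toGL x' ∈
      iwahori κ := by
    refine mem_iwahori_of_actAlcove ?_ ?_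
    · rw [valDet_mul, valDet_inv, valDet_toGL, valDet_toGL, neg_zero, add_zero]
    · rw [actAlcove_mul, ← h1, hD, ← actAlcove_mul, inv_mul_cancel, actAlcove_one]
  rw [hD'] at h2
  refine (eq_of_iwahori_act_std (mul_mem (inv_mem hI') (mul_mem (inv_mem hx) hI)) ?_)
  refine actAlcove_injective (Matrix.SpecialLinearGroup.toGL x' * h') ?_
  rw [← h2, ← actAlcove_mul]
  congr 1
  group

theorem exists_hasType (v : Vertex κ) : HasType v 0 ∨ HasType v 1 := by
  obtain ⟨y, n, rfl⟩ := exists_eq_lowerUnip_std v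
  rw [hasType_act_std_iff, hasType_act_std_iff]
  omega

theorem hasType_of_walk {v w : Vertex κ} (p : (building κ).Walk v w) {m : ℕ} (h : HasType v m) :
    HasType w ((m + p.length) % 2) := by
  induction p generalizing m with
  | nil =>
    obtain ⟨M, n, -, -, hn⟩ := id h
    rwa [SimpleGraph.Walk.length_nil, add_zero, Nat.mod_eq_of_lt (by omega)]
  | cons hadj p ih =>
    obtain ⟨g, rfl, rfl⟩ := exists_eq_act_of_adj hadj
    rw [hasType_act_std_iff] at h
    have := ih (m := (m + 1) % 2) (by rw [hasType_act_std_iff]; omega)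
    rwa [SimpleGraph.Walk.length_cons, show (m + (p.length + 1)) % 2 =
      ((m + 1) % 2 + p.length) % 2 by omega]

/-- A path whose first and last edges are `D` and `D'` determines the relative position of `D` and
`D'`: its absolute value is the distance, and its sign is given by the type of the first vertex. -/
theorem relPos_of_isPath {v w : Vertex κ} (W : (building κ).Walk v w) (hW : W.IsPath)
    (hl : 1 ≤ W.length) :
    (HasType v 0 → RelPos s(v, W.snd) s(w, W.penultimate) (W.length - 1)) ∧
      (HasType v 1 → RelPos s(v, W.snd) s(w, W.penultimate) (-(W.length - 1))) := by
  have hadj : (building κ).Adj v W.snd := by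
    have := W.adj_getVert_succ (i := 0) (by omega)
    rwa [SimpleGraph.Walk.getVert_zero] at this
  obtain ⟨x, hx⟩ := exists_alcoveOf_eq (D := s(v, W.snd)) hadj
  have htype : ∀ {i : ℤ} {m : ℕ}, HasType (actVertex (Matrix.SpecialLinearGroup.toGL x)
      (stdVertex κ i)) m ↔ i % 2 = m := by
    intro i m
    rw [hasType_act_of_valDet_eq_zero (valDet_toGL x), hasType_std_iff]
  have hx' := hx
  rw [actAlcove_std, zero_add, Sym2.eq_iff] at hx'
  have hlast := W.getVert_length
  constructor
  · intro hv
    obtain ⟨h0, h1⟩ := hx'.resolve_left fun h => by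
      rw [h.1, htype] at hv
      omega
    obtain ⟨h, hI, hp⟩ := exists_iwahori_of_isPath W hW hl h0 h1
    refine ⟨x, h, hI, hx, ?_⟩
    have e1 := hp W.length le_rfl
    have e2 := hp (W.length - 1) (by omega)
    rw [hlast] at e1
    rw [Nat.cast_sub hl, Nat.cast_one] at e2
    rw [actAlcove_std, sub_add_cancel]
    exact Sym2.eq_iff.mpr (Or.inl ⟨e1, e2⟩)
  · intro hv
    obtain ⟨h0, h1⟩ := hx'.resolve_right fun h => by
      rw [h.1, htype] at hv
      omega
    -- `b₁` exchanges the two vertices of the base alcove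
    obtain ⟨h, hI, hp⟩ := exists_iwahori_of_isPath W hW hl
      (g := Matrix.SpecialLinearGroup.toGL x * bOne κ)
      (by rw [actVertex_mul, actVertex_bOne_std, h0, sub_zero])
      (by rw [actVertex_mul, actVertex_bOne_std, sub_self]; exact h1)
    refine ⟨x, bOne κ * h * (bOne κ)⁻¹, bOne_conj_mem_iwahori hI, hx, ?_⟩
    have hp' : ∀ j ≤ W.length, W.getVert j = actVertex
        (Matrix.SpecialLinearGroup.toGL x * (bOne κ * h * (bOne κ)⁻¹)) (stdVertex κ (1 - j)) := by
      intro j hj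
      rw [hp j hj, ← actVertex_bOne_std, ← actVertex_mul, mul_assoc _ _ (bOne κ),
        inv_mul_cancel_right, mul_assoc]
    have e1 := hp' W.length le_rfl
    have e2 := hp' (W.length - 1) (by omega)
    rw [hlast] at e1
    rw [Nat.cast_sub hl, Nat.cast_one] at e2
    rw [actAlcove_std, show (-((W.length : ℤ) - 1) + 1) = 1 - (W.length - 1) by ring,
      show -((W.length : ℤ) - 1) = 1 - W.length by ring]
    exact Sym2.eq_iff.mpr (Or.inr ⟨e1, e2⟩)

/-- An alcove at the end of an exit path to `S` and its image under an injective endomorphism which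
preserves `S`: the path which joins them passes through `S`. -/
theorem relPos_of_isExitPath {τ : building κ →g building κ} (hτ : Function.Injective τ)
    {S : Set (Vertex κ)} (hS : ∀ z, τ z ∈ S ↔ z ∈ S) {v P : Vertex κ}
    {q : (building κ).Walk v P} (hq : IsExitPath S q) {r : (building κ).Walk P (τ P)}
    (hr : r.IsPath) (hrS : ∀ z ∈ r.support, z ∈ S)
    (hfix : r.length = 0 → ∀ z, z ∉ S → τ z ≠ z) :
    (HasType v 0 → RelPos s(v, q.snd) (Sym2.map τ s(v, q.snd))
        (2 * q.length + r.length - 1)) ∧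
      (HasType v 1 → RelPos s(v, q.snd) (Sym2.map τ s(v, q.snd))
        (-(2 * q.length + r.length - 1))) := by
  have hq' : IsExitPath S (q.map τ) := by
    refine ⟨hq.isPath.map hτ, (hS P).mpr hq.mem, fun z hz hzS => ?_, ?_⟩
    · rw [SimpleGraph.Walk.support_map] at hz
      obtain ⟨y, hy, rfl⟩ := List.mem_map.mp hz
      rw [hq.eq_of_mem y hy ((hS y).mp hzS)]
    · rw [← SimpleGraph.Walk.length_eq_zero_iff, SimpleGraph.Walk.length_map,
        SimpleGraph.Walk.length_eq_zero_iff]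
      exact hq.not_nil
  have hpen : (q.map τ).penultimate = τ q.penultimate := by
    rw [SimpleGraph.Walk.penultimate, SimpleGraph.Walk.getVert_map, SimpleGraph.Walk.length_map]
  have hW := isPath_exit_append_exit building_isAcyclic hq hq' hr hrS (by
    intro hP
    have hr0 : r.length = 0 := by
      have hn : ∀ {Q : Vertex κ} (r : (building κ).Walk P Q), P = Q → r.IsPath →
          r.length = 0 := by
        rintro Q r rfl hr
        rw [SimpleGraph.Walk.length_eq_zero_iff]
        exact SimpleGraph.Walk.isPath_iff_nil.mp hr
      exact hn r hP hr
    rw [hpen]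
    exact (hfix hr0 _ hq.penultimate_notMem).symm)
  have hqpos : 0 < q.length := SimpleGraph.Walk.not_nil_iff_lt_length.mp hq.not_nil
  have hlen : (q.append (r.append (q.map τ).reverse)).length = 2 * q.length + r.length := by
    simp only [SimpleGraph.Walk.length_append, SimpleGraph.Walk.length_reverse,
      SimpleGraph.Walk.length_map]
    omega
  have hsnd : (q.append (r.append (q.map τ).reverse)).snd = q.snd := snd_append _ hq.not_nil
  have hpen' : (q.append (r.append (q.map τ).reverse)).penultimate = τ q.snd := by
    rw [← SimpleGraph.Walk.snd_reverse, SimpleGraph.Walk.reverse_append,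
      SimpleGraph.Walk.reverse_append, SimpleGraph.Walk.reverse_reverse,
      ← SimpleGraph.Walk.append_assoc, snd_append _ hq'.not_nil]
    exact SimpleGraph.Walk.getVert_map _ _ _
  have h := relPos_of_isPath _ hW (by omega)
  rw [hsnd, hpen', hlen] at h
  push_cast at h
  exact h

end RelativePosition

/-! ### Alcoves departing from an invariant subcomplex -/

section MinimalSubcomplex

variable {κ : Type*} [Field κ]

/-- A connected full subcomplex `S` of the building which is preserved by the injective endomorphism
`τ`, such that `τ` moves every vertex of `S` by the distance `d` inside `S`; if `d = 0`, then there
are no fixed vertices outside `S`. The relative position of an alcove of `S` and its image is at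
most `d`. -/
structure IsMinSubcomplex (τ : building κ →g building κ) (S : (building κ).Subgraph) (d : ℕ) :
    Prop where
  injective : Function.Injective τ
  nonempty : S.verts.Nonempty
  full : ∀ a ∈ S.verts, ∀ b ∈ S.verts, (building κ).Adj a b → S.Adj a b
  walkConnected : WalkConnected (building κ) S.verts
  map_mem_iff : ∀ z, τ z ∈ S.verts ↔ z ∈ S.verts
  exists_path : ∀ P ∈ S.verts, ∃ r : (building κ).Walk P (τ P), r.IsPath ∧ r.length = d ∧
    ∀ z ∈ r.support, z ∈ S.verts
  ne_of_notMem : d = 0 → ∀ z, z ∉ S.verts → τ z ≠ z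
  relPos_le : ∀ D ∈ S.edgeSet, ∀ j, RelPos D (Sym2.map τ D) j → j.natAbs ≤ d

variable {τ : building κ →g building κ} {S : (building κ).Subgraph} {d : ℕ}

theorem IsMinSubcomplex.relPos_of_exitPath (hS : IsMinSubcomplex τ S d) {v P : Vertex κ}
    {q : (building κ).Walk v P} (hq : IsExitPath S.verts q) :
    (HasType v 0 → RelPos s(v, q.snd) (Sym2.map τ s(v, q.snd)) (2 * q.length + d - 1)) ∧
      (HasType v 1 → RelPos s(v, q.snd) (Sym2.map τ s(v, q.snd)) (-(2 * q.length + d - 1))) := by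
  obtain ⟨r, hr, hd, hrS⟩ := hS.exists_path P hq.mem
  have := relPos_of_isExitPath hS.injective hS.map_mem_iff hq hr hrS
    (fun h => hS.ne_of_notMem (hd.symm.trans h))
  rwa [hd] at this

theorem IsMinSubcomplex.relPos_of_mem_departing (hS : IsMinSubcomplex τ S d) {P : Vertex κ}
    {i : ℕ} {D : Sym2 (Vertex κ)} (hD : D ∈ departing S P i) :
    (HasType P (i % 2) ∧ RelPos D (Sym2.map τ D) (2 * i + d - 1)) ∨
      (HasType P ((i + 1) % 2) ∧ RelPos D (Sym2.map τ D) (-(2 * i + d - 1))) := by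
  obtain ⟨v, q, hq, rfl, rfl⟩ := exists_exitPath_of_mem_departing hS.full hD
  have h := hS.relPos_of_exitPath hq
  rcases exists_hasType v with hv | hv
  · have := hasType_of_walk q hv
    rw [zero_add] at this
    exact Or.inl ⟨this, h.1 hv⟩
  · have := hasType_of_walk q hv
    rw [add_comm] at this
    exact Or.inr ⟨this, h.2 hv⟩

theorem IsMinSubcomplex.mem_edgeSet_or_departing (hS : IsMinSubcomplex τ S d)
    {D : Sym2 (Vertex κ)} (hD : D ∈ (building κ).edgeSet) :
    D ∈ S.edgeSet ∨ ∃ P ∈ S.verts, ∃ i, 0 < i ∧ D ∈ departing S P i := by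
  by_cases h : D ∈ S.edgeSet
  · exact Or.inl h
  · exact Or.inr (exists_mem_departing building_connected hS.nonempty hD h)

/-- The alcoves outside `S` have relative positions of the form `± (2 i + d - 1)` with `i > 0`. -/
theorem IsMinSubcomplex.mem_edgeSet_of_relPos (hS : IsMinSubcomplex τ S d)
    {D : Sym2 (Vertex κ)} {j : ℤ} (h : RelPos D (Sym2.map τ D) j)
    (hj : ∀ i : ℕ, 0 < i → (j.natAbs : ℤ) ≠ 2 * i + d - 1) : D ∈ S.edgeSet := by
  refine (hS.mem_edgeSet_or_departing h.mem_edgeSet).resolve_right ?_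
  rintro ⟨P, -, i, hi, hD⟩
  have hi' := hj i hi
  rcases hS.relPos_of_mem_departing hD with ⟨-, h'⟩ | ⟨-, h'⟩
  · have := h.unique h'
    omega
  · have := h.unique h'
    omega

/-- The alcoves with a given relative position greater than `d` to their image are those which
depart from a vertex of the right type of `S` at the right distance. -/
theorem IsMinSubcomplex.setOf_relPos (hS : IsMinSubcomplex τ S d) {i : ℕ} (hi : 0 < i) :
    {D | RelPos D (Sym2.map τ D) (2 * i + d - 1)} =
        ⋃ P ∈ vertsOfType S (i % 2), departing S P i ∧
      {D | RelPos D (Sym2.map τ D) (-(2 * i + d - 1))} =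
        ⋃ P ∈ vertsOfType S ((i + 1) % 2), departing S P i := by
  have hcases : ∀ {D : Sym2 (Vertex κ)} {j : ℤ}, j.natAbs = 2 * i + d - 1 →
      RelPos D (Sym2.map τ D) j → ∃ P ∈ S.verts, D ∈ departing S P i := by
    intro D j hj h
    rcases hS.mem_edgeSet_or_departing h.mem_edgeSet with hD | ⟨P, hP, i', hi', hD⟩
    · have := hS.relPos_le D hD j h
      omega
    · obtain rfl : i' = i := by
        rcases hS.relPos_of_mem_departing hD with ⟨-, h'⟩ | ⟨-, h'⟩
        · have := h.unique h'
          omega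
        · have := h.unique h'
          omega
      exact ⟨P, hP, hD⟩
  constructor
  · ext D
    simp only [Set.mem_ofPred_eq, Set.mem_iUnion, exists_prop]
    constructor
    · intro h
      obtain ⟨P, hP, hD⟩ := hcases (by omega) h
      rcases hS.relPos_of_mem_departing hD with ⟨ht, -⟩ | ⟨-, h'⟩
      · exact ⟨P, ⟨hP, ht⟩, hD⟩
      · have := h.unique h'
        omega
    · rintro ⟨P, ⟨-, ht⟩, hD⟩
      rcases hS.relPos_of_mem_departing hD with ⟨-, h⟩ | ⟨ht', -⟩
      · exact h
      · have := hasType_unique ht ht'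
        omega
  · ext D
    simp only [Set.mem_ofPred_eq, Set.mem_iUnion, exists_prop]
    constructor
    · intro h
      obtain ⟨P, hP, hD⟩ := hcases (by omega) h
      rcases hS.relPos_of_mem_departing hD with ⟨-, h'⟩ | ⟨ht, -⟩
      · have := h.unique h'
        omega
      · exact ⟨P, ⟨hP, ht⟩, hD⟩
    · rintro ⟨P, ⟨-, ht⟩, hD⟩
      rcases hS.relPos_of_mem_departing hD with ⟨ht', -⟩ | ⟨-, h⟩
      · have := hasType_unique ht ht'
        omega
      · exact h

theorem IsMinSubcomplex.pairwiseDisjoint (hS : IsMinSubcomplex τ S d) (s : Set (Vertex κ))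
    (i : ℕ) : s.PairwiseDisjoint fun P => departing S P i := by
  intro P _ P' _ hne
  refine Set.disjoint_left.mpr fun D hD hD' => hne ?_
  exact departing_unique building_isAcyclic hS.full hS.walkConnected hD hD'

/-- If from every vertex `P_m` there is a ray which meets `S` in `P_m` only, then all the relative
positions greater than `d` allowed by parity occur. -/
theorem IsMinSubcomplex.exists_relPos (hS : IsMinSubcomplex τ S d)
    (hstd : ∀ m, stdVertex κ m ∈ S.verts)
    (hray : ∀ m : ℤ, ∃ y ∈ fracIdeal κ m, ∀ n, m < n →
      actVertex (lowerUnip y) (stdVertex κ n) ∉ S.verts)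
    {i : ℕ} (hi : 0 < i) {j : ℤ} (hj : (j.natAbs : ℤ) = 2 * i + d - 1) :
    ∃ D, RelPos D (Sym2.map τ D) j := by
  have key : ∀ e : ℕ, e < 2 → ∃ v P, ∃ q : (building κ).Walk v P, IsExitPath S.verts q ∧
      q.length = i ∧ HasType v e := by
    intro e he
    obtain ⟨y, hy, hyS⟩ := hray (e - i)
    obtain ⟨r, hr, hl, hsupp⟩ := exists_path_std (κ := κ) (e - i) i
    have hP : actVertex (lowerUnip y) (stdVertex κ (e - i)) = stdVertex κ (e - i) :=
      actVertex_lowerUnip_std hy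
    refine ⟨_, _, (r.map (actHom (lowerUnip y))).reverse, ⟨?_, ?_, ?_, ?_⟩, ?_, ?_⟩
    · exact (hr.map (actVertex_injective _)).reverse
    · rw [actHom_apply, hP]
      exact hstd _
    · intro z hz hzS
      rw [SimpleGraph.Walk.support_reverse, List.mem_reverse, SimpleGraph.Walk.support_map] at hz
      obtain ⟨x, hx, rfl⟩ := List.mem_map.mp hz
      obtain ⟨l, -, rfl⟩ := (hsupp x).mp hx
      rcases Nat.eq_zero_or_pos l with rfl | hl0
      · simp
      · exact absurd hzS (hyS _ (by omega))
    · rw [← SimpleGraph.Walk.length_eq_zero_iff, SimpleGraph.Walk.length_reverse,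
        SimpleGraph.Walk.length_map]
      omega
    · rw [SimpleGraph.Walk.length_reverse, SimpleGraph.Walk.length_map, hl]
    · have hv : valDet (lowerUnip y) = 0 := by simp [valDet, Matrix.det_fin_two]
      rw [actHom_apply, hasType_act_of_valDet_eq_zero hv, hasType_std_iff]
      omega
  rcases le_or_gt 0 j with h | h
  · obtain ⟨v, P, q, hq, rfl, hv⟩ := key 0 (by omega)
    refine ⟨s(v, q.snd), ?_⟩
    rw [show j = 2 * q.length + d - 1 by omega]
    exact (hS.relPos_of_exitPath hq).1 hv
  · obtain ⟨v, P, q, hq, rfl, hv⟩ := key 1 (by omega)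
    refine ⟨s(v, q.snd), ?_⟩
    rw [show j = -(2 * q.length + d - 1) by omega]
    exact (hS.relPos_of_exitPath hq).2 hv

end MinimalSubcomplex

/-! ### Affine Deligne-Lusztig sets in terms of relative positions -/

section AffineDL

variable (k : Type*) {K : Type*} [Field k] [Fintype k] [Field K] [Algebra k K]

/-- The endomorphism `b σ` of the building. -/
noncomputable def twist (b : GL (Fin 2) (LS K)) : building K →g building K :=
  (actHom b).comp (frobHom k K)

theorem twist_apply (b : GL (Fin 2) (LS K)) (v : Vertex K) :
    twist k b v = actVertex b (frobHom k K v) := rfl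

theorem twist_injective (b : GL (Fin 2) (LS K)) : Function.Injective (twist k b) :=
  (actVertex_injective b).comp (frobHom_injective k K)

theorem twist_bDiag_std (α : ℕ) (i : ℤ) :
    twist k (bDiag K α) (stdVertex K i) = stdVertex K (i + α) := by
  rw [twist_apply, frobHom_std, bDiag_eq_diagZpow, actVertex_diagZpow_std]

theorem twist_bOne_std (i : ℤ) : twist k (bOne K) (stdVertex K i) = stdVertex K (1 - i) := by
  rw [twist_apply, frobHom_std, actVertex_bOne_std]

theorem map_twist_actAlcove (b : GL (Fin 2) (LS K))
    (x : Matrix.SpecialLinearGroup (Fin 2) (LS K)) :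
    Sym2.map (twist k b) (actAlcove (Matrix.SpecialLinearGroup.toGL x) (stdAlcove K 0)) =
      actAlcove (b * Matrix.SpecialLinearGroup.toGL
        (Matrix.SpecialLinearGroup.map (frob k K) x)) (stdAlcove K 0) := by
  have h : ∀ i, twist k b (actVertex (Matrix.SpecialLinearGroup.toGL x) (stdVertex K i)) =
      actVertex (b * Matrix.SpecialLinearGroup.toGL
        (Matrix.SpecialLinearGroup.map (frob k K) x)) (stdVertex K i) := by
    intro i
    rw [twist_apply, frobHom_act, frobHom_std, actVertex_mul]
    rfl
  rw [actAlcove_std, actAlcove_std, Sym2.map_mk, h, h]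

/-- The affine Deligne-Lusztig set of `b` and `w` consists of the alcoves `D` such that the relative
position of `D` and `b σ(D)` is `w C^0`. -/
theorem alcoveOf_image_affineDL {w : Weyl K} {j : ℤ} (hw : weylAlcove w = stdAlcove K j)
    (b : GL (Fin 2) (LS K)) :
    alcoveOf '' affineDL k w b = {D | RelPos D (Sym2.map (twist k b) D) j} := by
  ext D
  constructor
  · rintro ⟨_, ⟨x, n, rfl, rfl, hx⟩, rfl⟩
    obtain ⟨h, hh, h', hh', he⟩ := DoubleCoset.mem_doubleCoset.mp hx
    refine ⟨x, h, hh, alcoveOf_mk x, ?_⟩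
    have he' : b * Matrix.SpecialLinearGroup.toGL (Matrix.SpecialLinearGroup.map (frob k K) x) =
        Matrix.SpecialLinearGroup.toGL x * h * Matrix.SpecialLinearGroup.toGL n.1 *
          bOne K ^ (b.1.det : LS K).order * h' := by
      rw [mul_assoc, inv_mul_eq_iff_eq_mul] at he
      rw [he]
      simp only [mul_assoc]
    rw [alcoveOf_mk, map_twist_actAlcove, he', actAlcove_mul, iwahori_fix_alcove hh',
      actAlcove_mul, actAlcove_bOne_zpow, actAlcove_mul, ← weylAlcove_mk, hw]
  · rintro ⟨x, h, hh, rfl, hD⟩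
    rw [map_twist_actAlcove] at hD
    induction w using QuotientGroup.induction_on with
    | H n =>
      refine ⟨(x : Matrix.SpecialLinearGroup (Fin 2) (LS K) ⧸ iwahoriSL K),
        ⟨x, n, rfl, rfl, ?_⟩, alcoveOf_mk x⟩
      rw [← hw, weylAlcove_mk, ← actAlcove_mul] at hD
      change _ ∈ DoubleCoset.doubleCoset (_ * bOne K ^ valDet b) _ _
      have hstab : (Matrix.SpecialLinearGroup.toGL x * h * Matrix.SpecialLinearGroup.toGL n.1 *
          bOne K ^ valDet b)⁻¹ * (b * Matrix.SpecialLinearGroup.toGL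
            (Matrix.SpecialLinearGroup.map (frob k K) x)) ∈ iwahori K := by
        refine mem_iwahori_of_actAlcove ?_ ?_
        · simp only [valDet_mul, valDet_inv, valDet_zpow, valDet_toGL, valDet_bOne,
            valDet_of_mem_iwahori hh]
          ring
        · refine actAlcove_injective (Matrix.SpecialLinearGroup.toGL x * h *
            Matrix.SpecialLinearGroup.toGL n.1 * bOne K ^ valDet b) ?_
          rw [← actAlcove_mul, mul_inv_cancel_left, hD, actAlcove_mul _ (bOne K ^ valDet b),
            actAlcove_bOne_zpow]
      refine DoubleCoset.mem_doubleCoset.mpr ⟨h, hh, _, hstab, ?_⟩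
      group

theorem affineDL_nonempty_iff {w : Weyl K} {j : ℤ} (hw : weylAlcove w = stdAlcove K j)
    (b : GL (Fin 2) (LS K)) :
    (affineDL k w b).Nonempty ↔ ∃ D, RelPos D (Sym2.map (twist k b) D) j := by
  rw [← Set.image_nonempty (f := alcoveOf), alcoveOf_image_affineDL k hw]
  rfl

theorem departureType_pos {w : Weyl K} (i : ℕ) {j : ℤ} (hj : 0 < j)
    (hw : weylAlcove w = stdAlcove K j) : departureType w i j = i % 2 := by
  have hne : stdAlcove K j ≠ stdAlcove K (-j) := fun h => by
    have := stdAlcove_injective h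
    omega
  rw [departureType, hw]
  rcases Nat.even_or_odd i with hi | hi
  · rw [if_pos (Or.inr ⟨hi, rfl⟩), Nat.even_iff.mp hi]
  · rw [if_neg (by simp [hne, hi]), Nat.odd_iff.mp hi]

theorem departureType_neg {w : Weyl K} (i : ℕ) {j : ℤ} (hj : 0 < j)
    (hw : weylAlcove w = stdAlcove K (-j)) : departureType w i j = (i + 1) % 2 := by
  have hne : stdAlcove K (-j) ≠ stdAlcove K j := fun h => by
    have := stdAlcove_injective h
    omega
  rw [departureType, hw]
  rcases Nat.even_or_odd i with hi | hi
  · have := Nat.even_iff.mp hi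
    rw [if_neg (by simp [hne, hi])]
    omega
  · have := Nat.odd_iff.mp hi
    rw [if_pos (Or.inl ⟨hi, rfl⟩)]
    omega

theorem weylAlcove_eq_or {w : Weyl K} {j : ℤ} (hj : (weylLength w : ℤ) = j) :
    weylAlcove w = stdAlcove K j ∨ weylAlcove w = stdAlcove K (-j) := by
  obtain ⟨l, hl⟩ := exists_weylAlcove_eq w
  rw [weylLength_eq hl] at hj
  rcases le_total 0 l with h | h
  · left
    rw [hl, show l = j by omega]
  · right
    rw [hl, show l = -j by omega]

variable {k}

theorem IsMinSubcomplex.affineDL_eq {b : GL (Fin 2) (LS K)} {S : (building K).Subgraph} {d : ℕ}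
    (hS : IsMinSubcomplex (twist k b) S d) {w : Weyl K} {i : ℕ} (hi : 0 < i) {j : ℤ}
    (hj : j = 2 * i + d - 1) (hw : (weylLength w : ℤ) = j) :
    alcoveOf '' affineDL k w b =
      ⋃ P ∈ vertsOfType S (departureType w i j), departing S P i := by
  subst hj
  rcases weylAlcove_eq_or hw with h | h
  · rw [alcoveOf_image_affineDL k h, departureType_pos i (by omega) h]
    exact (hS.setOf_relPos hi).1
  · rw [alcoveOf_image_affineDL k h, departureType_neg i (by omega) h]
    exact (hS.setOf_relPos hi).2

end AffineDL

/-! ### The standard apartment -/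

section Apartment

variable {κ : Type*} [Field κ]

theorem adj_std_iff {i j : ℤ} :
    (building κ).Adj (stdVertex κ i) (stdVertex κ j) ↔ j = i + 1 ∨ i = j + 1 := by
  rw [← SimpleGraph.dist_eq_one_iff_adj, dist_std]
  omega

/-- A translation of the standard apartment moves `C^0` to `C^i`. -/
theorem relPos_std_of_even {i : ℤ} (hi : i % 2 = 0) (j : ℤ) :
    RelPos (stdAlcove κ i) (stdAlcove κ j) (j - i) := by
  refine ⟨(transN κ (i / 2)).1, 1, one_mem _, ?_, ?_⟩
  · rw [actAlcove_transN]
    congr 1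
    omega
  · rw [mul_one, actAlcove_transN]
    congr 1
    omega

/-- A reflection of the standard apartment moves `C^0` to `C^i`, and reverses the sign. -/
theorem relPos_std_of_odd {i : ℤ} (hi : i % 2 = 1) (j : ℤ) :
    RelPos (stdAlcove κ i) (stdAlcove κ j) (i - j) := by
  refine ⟨(reflN κ ((i + 1) / 2)).1, 1, one_mem _, ?_, ?_⟩
  · rw [actAlcove_reflN]
    congr 1
    omega
  · rw [mul_one, actAlcove_reflN]
    congr 1
    omega

theorem mem_apartment_verts {v : Vertex κ} :
    v ∈ (apartment κ).verts ↔ ∃ i, v = stdVertex κ i := by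
  change (∃ w : Weyl κ, v ∈ weylAlcove w) ↔ _
  constructor
  · rintro ⟨w, hw⟩
    obtain ⟨j, hj⟩ := exists_weylAlcove_eq w
    rw [hj, stdAlcove, Sym2.mem_iff] at hw
    rcases hw with h | h
    · exact ⟨_, h⟩
    · exact ⟨_, h⟩
  · rintro ⟨i, rfl⟩
    obtain ⟨w, hw⟩ := exists_weyl_eq (κ := κ) i
    exact ⟨w, by rw [hw]; exact Sym2.mem_mk_right _ _⟩

theorem mem_apartment_edgeSet {D : Sym2 (Vertex κ)} :
    D ∈ (apartment κ).edgeSet ↔ ∃ i, D = stdAlcove κ i := by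
  constructor
  · induction D using Sym2.ind with
    | h v w =>
      rintro ⟨hv, hw, h⟩
      obtain ⟨i, rfl⟩ := mem_apartment_verts.mp hv
      obtain ⟨j, rfl⟩ := mem_apartment_verts.mp hw
      rcases adj_std_iff.mp h with rfl | rfl
      · exact ⟨i, Sym2.eq_swap⟩
      · exact ⟨j, rfl⟩
  · rintro ⟨i, rfl⟩
    exact ⟨mem_apartment_verts.mpr ⟨_, rfl⟩, mem_apartment_verts.mpr ⟨_, rfl⟩,
      stdAlcove_mem_edgeSet i⟩

theorem apartment_walkConnected : WalkConnected (building κ) (apartment κ).verts := by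
  have key : ∀ (i j : ℤ), i ≤ j → ∃ r : (building κ).Walk (stdVertex κ i) (stdVertex κ j),
      ∀ z ∈ r.support, z ∈ (apartment κ).verts := by
    intro i j hij
    obtain ⟨n, rfl⟩ := Int.le.dest hij
    obtain ⟨r, -, -, hr⟩ := exists_path_std (κ := κ) i n
    refine ⟨r, fun z hz => ?_⟩
    obtain ⟨l, -, rfl⟩ := (hr z).mp hz
    exact mem_apartment_verts.mpr ⟨_, rfl⟩
  intro P hP P' hP'
  obtain ⟨i, rfl⟩ := mem_apartment_verts.mp hP
  obtain ⟨j, rfl⟩ := mem_apartment_verts.mp hP'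
  rcases le_total i j with h | h
  · exact key i j h
  · obtain ⟨r, hr⟩ := key j i h
    exact ⟨r.reverse, fun z hz => hr z (by simpa using hz)⟩

theorem mem_baseComplex_verts {v : Vertex κ} :
    v ∈ (baseComplex κ).verts ↔ v = stdVertex κ 1 ∨ v = stdVertex κ 0 :=
  Sym2.mem_iff

theorem baseComplex_edgeSet : (baseComplex κ).edgeSet = {stdAlcove κ 0} := by
  ext D
  rw [Set.mem_singleton_iff]
  constructor
  · induction D using Sym2.ind with
    | h v w =>
      rintro ⟨hv, hw, h⟩
      exact (Sym2.mem_and_mem_iff h.ne).mp ⟨hv, hw⟩ |>.symm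
  · rintro rfl
    exact ⟨Sym2.mem_mk_left _ _, Sym2.mem_mk_right _ _, stdAlcove_mem_edgeSet 0⟩

end Apartment

/-! ### The minimal subcomplexes of the three classes of `b` -/

section Cases

variable (k : Type*) {K : Type*} [Field k] [Fintype k] [Field K] [Algebra k K]

theorem twist_one_apply (v : Vertex K) : twist k 1 v = frobHom k K v := by
  rw [twist_apply, actVertex_one]

theorem mem_rationalBuilding_verts_iff_twist {v : Vertex K} :
    v ∈ (rationalBuilding k K).verts ↔ twist k 1 v = v := by
  rw [twist_one_apply, mem_rationalBuilding_verts_iff_frobHom]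

theorem map_twist_of_mem_rationalBuilding {D : Sym2 (Vertex K)}
    (hD : D ∈ (rationalBuilding k K).edgeSet) : Sym2.map (twist k 1) D = D := by
  induction D using Sym2.ind with
  | h v w =>
    have h : (rationalBuilding k K).Adj v w := hD
    rw [Sym2.map_mk, (mem_rationalBuilding_verts_iff_twist k).mp h.fst_mem,
      (mem_rationalBuilding_verts_iff_twist k).mp h.snd_mem]

theorem stdVertex_mem_rationalBuilding (i : ℤ) :
    stdVertex K i ∈ (rationalBuilding k K).verts := by
  rw [mem_rationalBuilding_verts_iff_frobHom, frobHom_std]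

theorem isMinSubcomplex_rationalBuilding :
    IsMinSubcomplex (twist k 1) (rationalBuilding k K) 0 where
  injective := twist_injective k 1
  nonempty := ⟨_, stdVertex_mem_rationalBuilding k 0⟩
  full := rationalBuilding_full k K
  walkConnected := rationalBuilding_walkConnected k K
  map_mem_iff z := by
    rw [mem_rationalBuilding_verts_iff_twist, mem_rationalBuilding_verts_iff_twist,
      (twist_injective k 1).eq_iff]
  exists_path P hP := by
    refine ⟨SimpleGraph.Walk.nil.copy rfl ((mem_rationalBuilding_verts_iff_twist k).mp hP).symm,
      ?_, ?_, ?_⟩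
    · rw [SimpleGraph.Walk.isPath_copy]
      exact SimpleGraph.Walk.IsPath.nil
    · rw [SimpleGraph.Walk.length_copy, SimpleGraph.Walk.length_nil]
    · intro z hz
      rw [SimpleGraph.Walk.support_copy, SimpleGraph.Walk.support_nil, List.mem_singleton] at hz
      rwa [hz]
  ne_of_notMem _ z hz h := hz ((mem_rationalBuilding_verts_iff_twist k).mpr h)
  relPos_le D hD j h := by
    rw [map_twist_of_mem_rationalBuilding k hD] at h
    rw [h.unique (relPos_self h.mem_edgeSet)]
    rfl

theorem exists_pow_card_ne [IsAlgClosure k K] : ∃ a : K, a ^ Fintype.card k ≠ a := by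
  have : IsAlgClosed K := IsAlgClosure.isAlgClosed k
  by_contra! h
  have hsurj : Function.Surjective (algebraMap k K) := fun a =>
    exists_algebraMap_eq_of_pow_card_eq k (h a)
  exact (Finite.of_surjective _ hsurj).not_infinite inferInstance

/-- The ray with coordinate `a t^m` leaves the building over `k` in `P_m` if `a` is not in `k`. This is
where `K` has to be larger than `k`. -/
theorem exists_ray_rationalBuilding [IsAlgClosure k K] (m : ℤ) :
    ∃ y ∈ fracIdeal K m, ∀ n, m < n →
      actVertex (lowerUnip y) (stdVertex K n) ∉ (rationalBuilding k K).verts := by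
  obtain ⟨a, ha⟩ := exists_pow_card_ne k (K := K)
  refine ⟨HahnSeries.single m a, mem_fracIdeal_iff_coeff.mpr fun l hl =>
    HahnSeries.coeff_single_of_ne hl.ne, fun n hn h => ha ?_⟩
  rw [mem_rationalBuilding_verts_iff_frobHom, frobHom_lowerUnip_std,
    actVertex_lowerUnip_std_eq_lowerUnip_iff, mem_fracIdeal_iff_coeff] at h
  have := h.2 m hn
  rwa [HahnSeries.coeff_sub, frob_coeff, HahnSeries.coeff_single_same, sub_eq_zero] at this

theorem affineDL_one_nonempty_iff [IsAlgClosure k K] (w : Weyl K) :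
    (affineDL k w 1).Nonempty ↔ w = 1 ∨ Odd (weylLength w) := by
  have hS := isMinSubcomplex_rationalBuilding k (K := K)
  obtain ⟨j, hj⟩ := exists_weylAlcove_eq w
  rw [affineDL_nonempty_iff k hj, weyl_eq_one_iff hj, weylLength_eq hj]
  constructor
  · rintro ⟨D, hD⟩
    rcases Nat.even_or_odd j.natAbs with he | ho
    · left
      have hD' := hS.mem_edgeSet_of_relPos hD (by
        intro i _
        obtain ⟨c, hc⟩ := he
        omega)
      have := hS.relPos_le D hD' j hD
      omega
    · exact Or.inr ho
  · rintro (rfl | ⟨c, hc⟩)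
    · have h0 : Sym2.map (twist k 1) (stdAlcove K 0) = stdAlcove K 0 := by
        rw [stdAlcove, Sym2.map_mk, twist_one_apply, twist_one_apply, frobHom_std, frobHom_std]
      refine ⟨stdAlcove K 0, ?_⟩
      rw [h0]
      exact relPos_self (stdAlcove_mem_edgeSet 0)
    · exact hS.exists_relPos (stdVertex_mem_rationalBuilding k) (exists_ray_rationalBuilding k)
        (i := c + 1) (by omega) (by omega)

theorem alcoveOf_image_affineDL_one_one :
    alcoveOf '' affineDL k (1 : Weyl K) 1 = (rationalBuilding k K).edgeSet := by
  rw [alcoveOf_image_affineDL k weylAlcove_one]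
  ext D
  constructor
  · exact fun h => (isMinSubcomplex_rationalBuilding k).mem_edgeSet_of_relPos h (by omega)
  · intro h
    rw [Set.mem_ofPred_eq, map_twist_of_mem_rationalBuilding k h]
    exact relPos_self (SimpleGraph.Subgraph.edgeSet_subset _ h)

theorem map_twist_bDiag_std (α : ℕ) (i : ℤ) :
    Sym2.map (twist k (bDiag K α)) (stdAlcove K i) = stdAlcove K (i + α) := by
  rw [stdAlcove, Sym2.map_mk, twist_bDiag_std, twist_bDiag_std, add_right_comm]
  rfl

theorem isMinSubcomplex_apartment {α : ℕ} (hα : 0 < α) :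
    IsMinSubcomplex (twist k (bDiag K α)) (apartment K) α where
  injective := twist_injective k _
  nonempty := ⟨_, mem_apartment_verts.mpr ⟨0, rfl⟩⟩
  full _ ha _ hb h := ⟨ha, hb, h⟩
  walkConnected := apartment_walkConnected
  map_mem_iff z := by
    rw [mem_apartment_verts, mem_apartment_verts]
    constructor
    · rintro ⟨i, hi⟩
      refine ⟨i - α, twist_injective k (bDiag K α) ?_⟩
      rw [hi, twist_bDiag_std, sub_add_cancel]
    · rintro ⟨i, rfl⟩
      exact ⟨_, twist_bDiag_std k α i⟩
  exists_path P hP := by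
    obtain ⟨i, rfl⟩ := mem_apartment_verts.mp hP
    obtain ⟨r, hr, hl, hsupp⟩ := exists_path_std (κ := K) i α
    refine ⟨r.copy rfl (twist_bDiag_std k α i).symm, ?_, ?_, ?_⟩
    · rwa [SimpleGraph.Walk.isPath_copy]
    · rwa [SimpleGraph.Walk.length_copy]
    · intro z hz
      rw [SimpleGraph.Walk.support_copy] at hz
      obtain ⟨l, -, rfl⟩ := (hsupp z).mp hz
      exact mem_apartment_verts.mpr ⟨_, rfl⟩
  ne_of_notMem h := absurd h hα.ne'
  relPos_le D hD j h := by
    obtain ⟨i, rfl⟩ := mem_apartment_edgeSet.mp hD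
    rw [map_twist_bDiag_std] at h
    rcases Int.emod_two_eq_zero_or_one i with hi | hi
    · have := h.unique (relPos_std_of_even hi _)
      omega
    · have := h.unique (relPos_std_of_odd hi _)
      omega

/-- The ray with coordinate `t^m` leaves the standard apartment in `P_m`. -/
theorem exists_ray_apartment (m : ℤ) : ∃ y ∈ fracIdeal K m, ∀ n, m < n →
    actVertex (lowerUnip y) (stdVertex K n) ∉ (apartment K).verts := by
  refine ⟨unif K ^ m, unif_zpow_mem.mpr le_rfl, fun n hn h => ?_⟩
  obtain ⟨j, hj⟩ := mem_apartment_verts.mp h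
  obtain ⟨rfl, hj⟩ := actVertex_lowerUnip_std_eq_iff.mp hj
  have := unif_zpow_mem.mp hj
  omega

theorem relPos_bDiag_std_iff {α : ℕ} {i j : ℤ} :
    RelPos (stdAlcove K i) (Sym2.map (twist k (bDiag K α)) (stdAlcove K i)) j ↔
      i % 2 = 0 ∧ j = α ∨ i % 2 = 1 ∧ j = -α := by
  rw [map_twist_bDiag_std]
  rcases Int.emod_two_eq_zero_or_one i with hi | hi
  · have h := relPos_std_of_even (κ := K) hi (i + α)
    rw [add_sub_cancel_left] at h
    constructor
    · exact fun h' => Or.inl ⟨hi, h'.unique h⟩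
    · rintro (⟨-, rfl⟩ | ⟨hi', -⟩)
      · exact h
      · omega
  · have h := relPos_std_of_odd (κ := K) hi (i + α)
    rw [sub_add_cancel_left] at h
    constructor
    · exact fun h' => Or.inr ⟨hi, h'.unique h⟩
    · rintro (⟨hi', -⟩ | ⟨-, rfl⟩)
      · omega
      · exact h

theorem affineDL_bDiag_nonempty_iff {α : ℕ} (hα : 0 < α) (w : Weyl K) :
    (affineDL k w (bDiag K α)).Nonempty ↔
      weylLength w = α ∨ ∃ i : ℕ, 0 < i ∧ weylLength w = α + (2 * i - 1) := by
  have hS := isMinSubcomplex_apartment k (K := K) hα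
  obtain ⟨j, hj⟩ := exists_weylAlcove_eq w
  rw [affineDL_nonempty_iff k hj, weylLength_eq hj]
  constructor
  · rintro ⟨D, hD⟩
    by_contra! hne
    have hD' := hS.mem_edgeSet_of_relPos hD (by
      intro i hi
      have := hne.2 i hi
      omega)
    obtain ⟨i, rfl⟩ := mem_apartment_edgeSet.mp hD'
    rcases (relPos_bDiag_std_iff k).mp hD with ⟨-, h⟩ | ⟨-, h⟩ <;> omega
  · rintro (h | ⟨i, hi, h⟩)
    · rcases le_total 0 j with h0 | h0
      · exact ⟨_, (relPos_bDiag_std_iff k (i := 0)).mpr (Or.inl ⟨rfl, by omega⟩)⟩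
      · exact ⟨_, (relPos_bDiag_std_iff k (i := 1)).mpr (Or.inr ⟨rfl, by omega⟩)⟩
    · exact hS.exists_relPos (fun m => mem_apartment_verts.mpr ⟨m, rfl⟩)
        exists_ray_apartment hi (by omega)

theorem mem_apartment_of_relPos_bDiag {α : ℕ} (hα : 0 < α) {D : Sym2 (Vertex K)} {j : ℤ}
    (h : RelPos D (Sym2.map (twist k (bDiag K α)) D) j) (hj : j.natAbs = α) :
    ∃ i, D = stdAlcove K i :=
  mem_apartment_edgeSet.mp
    ((isMinSubcomplex_apartment k hα).mem_edgeSet_of_relPos h (by omega))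

theorem affineDL_bDiag_eq_of_pos {α : ℕ} (hα : 0 < α) {w : Weyl K}
    (hw : weylAlcove w = stdAlcove K α) :
    alcoveOf '' affineDL k w (bDiag K α) = ⋃ j : ℤ, {stdAlcove K (2 * j)} := by
  rw [alcoveOf_image_affineDL k hw]
  ext D
  rw [Set.mem_iUnion]
  constructor
  · intro h
    obtain ⟨i, rfl⟩ := mem_apartment_of_relPos_bDiag k hα h (by omega)
    rcases (relPos_bDiag_std_iff k).mp h with ⟨hi, -⟩ | ⟨-, h⟩
    · exact ⟨i / 2, by rw [show 2 * (i / 2) = i by omega]; rfl⟩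
    · omega
  · rintro ⟨j, rfl⟩
    exact (relPos_bDiag_std_iff k).mpr (Or.inl ⟨by omega, rfl⟩)

theorem affineDL_bDiag_eq_of_neg {α : ℕ} (hα : 0 < α) {w : Weyl K}
    (hw : weylAlcove w = stdAlcove K (-α)) :
    alcoveOf '' affineDL k w (bDiag K α) = ⋃ j : ℤ, {stdAlcove K (2 * j + 1)} := by
  rw [alcoveOf_image_affineDL k hw]
  ext D
  rw [Set.mem_iUnion]
  constructor
  · intro h
    obtain ⟨i, rfl⟩ := mem_apartment_of_relPos_bDiag k hα h (by omega)
    rcases (relPos_bDiag_std_iff k).mp h with ⟨-, h⟩ | ⟨hi, -⟩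
    · omega
    · exact ⟨i / 2, by rw [show 2 * (i / 2) + 1 = i by omega]; rfl⟩
  · rintro ⟨j, rfl⟩
    exact (relPos_bDiag_std_iff k).mpr (Or.inr ⟨by omega, rfl⟩)

/-- `b₁ σ` reverses the standard apartment, and exchanges the vertices of `C^0`. -/
theorem map_twist_bOne_std (i : ℤ) :
    Sym2.map (twist k (bOne K)) (stdAlcove K i) = stdAlcove K (-i) := by
  rw [stdAlcove, Sym2.map_mk, twist_bOne_std, twist_bOne_std, Sym2.eq_swap, stdAlcove,
    show 1 - i = -i + 1 by ring, show 1 - (i + 1) = -i by ring]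

theorem isMinSubcomplex_baseComplex :
    IsMinSubcomplex (twist k (bOne K)) (baseComplex K) 1 where
  injective := twist_injective k _
  nonempty := ⟨_, mem_baseComplex_verts.mpr (Or.inr rfl)⟩
  full _ ha _ hb h := ⟨ha, hb, h⟩
  walkConnected := by
    have h10 : (building K).Adj (stdVertex K 1) (stdVertex K 0) := stdAlcove_mem_edgeSet 0
    intro P hP P' hP'
    by_cases hne : P = P'
    · subst hne
      exact ⟨SimpleGraph.Walk.nil, by simpa using hP⟩
    · have hadj : (building K).Adj P P' := by
        rcases mem_baseComplex_verts.mp hP with rfl | rfl <;>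
          rcases mem_baseComplex_verts.mp hP' with rfl | rfl
        · exact absurd rfl hne
        · exact h10
        · exact h10.symm
        · exact absurd rfl hne
      refine ⟨hadj.toWalk, fun z hz => ?_⟩
      rcases List.mem_pair.mp hz with rfl | rfl
      · exact hP
      · exact hP'
  map_mem_iff z := by
    have h0 := twist_bOne_std k (K := K) 0
    have h1 := twist_bOne_std k (K := K) 1
    rw [sub_zero] at h0
    rw [sub_self] at h1
    rw [mem_baseComplex_verts, mem_baseComplex_verts]
    nth_rw 1 [← h0]
    nth_rw 2 [← h1]
    rw [(twist_injective k (bOne K)).eq_iff, (twist_injective k (bOne K)).eq_iff, or_comm]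
  exists_path P hP := by
    obtain ⟨hadj, hmem⟩ : (building K).Adj P (twist k (bOne K) P) ∧
        twist k (bOne K) P ∈ (baseComplex K).verts := by
      rcases mem_baseComplex_verts.mp hP with rfl | rfl
      · rw [twist_bOne_std, sub_self]
        exact ⟨stdAlcove_mem_edgeSet 0, mem_baseComplex_verts.mpr (Or.inr rfl)⟩
      · rw [twist_bOne_std, sub_zero]
        exact ⟨adj_std 0, mem_baseComplex_verts.mpr (Or.inl rfl)⟩
    refine ⟨hadj.toWalk, by simp [hadj.ne], rfl, fun z hz => ?_⟩
    rcases List.mem_pair.mp hz with rfl | rfl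
    · exact hP
    · exact hmem
  ne_of_notMem h := absurd h one_ne_zero
  relPos_le D hD j h := by
    rw [baseComplex_edgeSet] at hD
    obtain rfl := hD
    rw [map_twist_bOne_std, neg_zero] at h
    rw [h.unique (relPos_self h.mem_edgeSet)]
    exact zero_le_one

theorem affineDL_bOne_nonempty_iff (w : Weyl K) :
    (affineDL k w (bOne K)).Nonempty ↔ Even (weylLength w) := by
  have hS := isMinSubcomplex_baseComplex k (K := K)
  obtain ⟨j, hj⟩ := exists_weylAlcove_eq w
  rw [affineDL_nonempty_iff k hj, weylLength_eq hj]
  constructor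
  · rintro ⟨D, hD⟩
    by_contra ho
    obtain ⟨c, hc⟩ := Nat.not_even_iff_odd.mp ho
    have hD' := hS.mem_edgeSet_of_relPos hD (by omega)
    rw [baseComplex_edgeSet] at hD'
    obtain rfl := hD'
    rw [map_twist_bOne_std, neg_zero] at hD
    have := hD.unique (relPos_self hD.mem_edgeSet)
    omega
  · intro he
    obtain ⟨c, rfl⟩ : ∃ c, j = c + c := Int.natAbs_even.mp he
    rcases Int.emod_two_eq_zero_or_one c with hc | hc
    · refine ⟨stdAlcove K (-c), ?_⟩
      rw [map_twist_bOne_std]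
      have := relPos_std_of_even (κ := K) (i := -c) (by omega) (- -c)
      rwa [show - -c - -c = c + c by ring] at this
    · refine ⟨stdAlcove K c, ?_⟩
      rw [map_twist_bOne_std]
      have := relPos_std_of_odd (κ := K) hc (-c)
      rwa [sub_neg_eq_add] at this

theorem alcoveOf_image_affineDL_one_bOne :
    alcoveOf '' affineDL k (1 : Weyl K) (bOne K) = {stdAlcove K 0} := by
  rw [alcoveOf_image_affineDL k weylAlcove_one, ← baseComplex_edgeSet]
  ext D
  constructor
  · exact fun h => (isMinSubcomplex_baseComplex k).mem_edgeSet_of_relPos h (by omega)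
  · rw [baseComplex_edgeSet]
    rintro rfl
    rw [Set.mem_ofPred_eq, map_twist_bOne_std, neg_zero]
    exact relPos_self (stdAlcove_mem_edgeSet 0)

theorem vertsOfType_baseComplex {m : ℕ} (hm : m < 2) :
    vertsOfType (baseComplex K) m = {stdVertex K m} := by
  ext P
  rw [Set.mem_singleton_iff]
  constructor
  · rintro ⟨hP, ht⟩
    rcases mem_baseComplex_verts.mp hP with rfl | rfl <;> rw [hasType_std_iff] at ht <;>
      exact congrArg (stdVertex K) ht
  · rintro rfl
    refine ⟨mem_baseComplex_verts.mpr ?_, hasType_std_iff.mpr (by omega)⟩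
    interval_cases m
    · exact Or.inr rfl
    · exact Or.inl rfl

theorem departureType_lt (w : Weyl K) (i : ℕ) (j : ℤ) : departureType w i j < 2 := by
  rw [departureType]
  split_ifs <;> omega

end Cases
end ADLV

theorem mainTheorem12 (k K : Type*) [Field k] [Fintype k] [Field K] [Algebra k K]
    [IsAlgClosure k K] :
    Set.BijOn (alcoveOf (κ := K)) Set.univ (building K).edgeSet ∧
    -- the case of the trivial element
    ((∀ w : Weyl K, (affineDL k w 1).Nonempty ↔ w = 1 ∨ Odd (weylLength w)) ∧
      alcoveOf '' affineDL k (1 : Weyl K) 1 = (rationalBuilding k K).edgeSet ∧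
      ∀ (w : Weyl K) (i : ℕ), 0 < i → weylLength w = 2 * i - 1 →
        (weylAlcove w = stdAlcove K (2 * i - 1) ∨ weylAlcove w = stdAlcove K (-(2 * i - 1))) ∧
        (vertsOfType (rationalBuilding k K) (departureType w i (2 * i - 1))).PairwiseDisjoint
          (fun P => departing (rationalBuilding k K) P i) ∧
        alcoveOf '' affineDL k w 1 =
          ⋃ P ∈ vertsOfType (rationalBuilding k K) (departureType w i (2 * i - 1)),
            departing (rationalBuilding k K) P i) ∧
    -- the case of the diagonal matrices `diag(1, t^α)`
    (∀ α : ℕ, 0 < α →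
      (∀ w : Weyl K, (affineDL k w (bDiag K α)).Nonempty ↔
        weylLength w = α ∨ ∃ i : ℕ, 0 < i ∧ weylLength w = α + (2 * i - 1)) ∧
      Function.Injective (stdAlcove K) ∧
      (∀ w : Weyl K, weylLength w = α →
        weylAlcove w = stdAlcove K α ∨ weylAlcove w = stdAlcove K (-α)) ∧
      (∀ w : Weyl K, weylAlcove w = stdAlcove K α →
        alcoveOf '' affineDL k w (bDiag K α) = ⋃ j : ℤ, {stdAlcove K (2 * j)}) ∧
      (∀ w : Weyl K, weylAlcove w = stdAlcove K (-α) →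
        alcoveOf '' affineDL k w (bDiag K α) = ⋃ j : ℤ, {stdAlcove K (2 * j + 1)}) ∧
      ∀ (w : Weyl K) (i : ℕ), 0 < i → weylLength w = α + (2 * i - 1) →
        (weylAlcove w = stdAlcove K (α + (2 * i - 1)) ∨
          weylAlcove w = stdAlcove K (-(α + (2 * i - 1)))) ∧
        (vertsOfType (apartment K) (departureType w i (α + (2 * i - 1)))).PairwiseDisjoint
          (fun P => departing (apartment K) P i) ∧
        alcoveOf '' affineDL k w (bDiag K α) =
          ⋃ P ∈ vertsOfType (apartment K) (departureType w i (α + (2 * i - 1))),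
            departing (apartment K) P i) ∧
    -- the case of the matrix `b₁`
    ((∀ w : Weyl K, (affineDL k w (bOne K)).Nonempty ↔ Even (weylLength w)) ∧
      alcoveOf '' affineDL k (1 : Weyl K) (bOne K) = {stdAlcove K 0} ∧
      ∀ (w : Weyl K) (i : ℕ), 0 < i → weylLength w = 2 * i →
        (weylAlcove w = stdAlcove K (2 * i) ∨ weylAlcove w = stdAlcove K (-(2 * i))) ∧
        alcoveOf '' affineDL k w (bOne K) =
          departing (baseComplex K) (stdVertex K (departureType w i (2 * i))) i) := by
  refine ⟨alcoveOf_bijOn, ⟨affineDL_one_nonempty_iff k, alcoveOf_image_affineDL_one_one k,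
    fun w i hi hw => ?_⟩, fun α hα => ⟨affineDL_bDiag_nonempty_iff k hα, stdAlcove_injective,
    fun w hw => weylAlcove_eq_or (by omega), fun w hw => affineDL_bDiag_eq_of_pos k hα hw,
    fun w hw => affineDL_bDiag_eq_of_neg k hα hw, fun w i hi hw => ?_⟩,
    affineDL_bOne_nonempty_iff k, alcoveOf_image_affineDL_one_bOne k, fun w i hi hw => ?_⟩
  · have hS := isMinSubcomplex_rationalBuilding k (K := K)
    have hl : (weylLength w : ℤ) = 2 * i - 1 := by omega
    exact ⟨weylAlcove_eq_or hl, hS.pairwiseDisjoint _ i, hS.affineDL_eq hi (by simp) hl⟩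
  · have hS := isMinSubcomplex_apartment k (K := K) hα
    have hl : (weylLength w : ℤ) = α + (2 * i - 1) := by omega
    exact ⟨weylAlcove_eq_or hl, hS.pairwiseDisjoint _ i, hS.affineDL_eq hi (by ring) hl⟩
  · have hS := isMinSubcomplex_baseComplex k (K := K)
    have hl : (weylLength w : ℤ) = 2 * i := by omega
    refine ⟨weylAlcove_eq_or hl, ?_⟩
    rw [hS.affineDL_eq hi (by push_cast; ring) hl, vertsOfType_baseComplex (departureType_lt _ _ _),
      Set.biUnion_singleton]
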